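/- Let $K$ be a $p$-adic field (a finite extension of $\mathbb{Q}_p$), let $U\subseteq K^n$ be an open neighbourhood of $0$, and let $f=(f_1,\dots,f_l):U\to K^l$ be a $K$-analytic mapping with $f(0)=0$ which is not constant near $0$; write $f_i(x)=\sum_m c_{m,i}x^m$ near $0$ and $\operatorname{supp}(f_i)=\{m\in\mathbb{N}^n : c_{m,i}\neq 0\}$. Let $\Gamma(f)\subseteq\mathbb{R}_+^n$ be the convex hull of $\bigcup_i\bigcup_{m\in \operatorname{supp}(f_i)}(m+\mathbb{R}_+^n)$. Suppose that $f$ is strongly non-degenerate at the origin with respect to $\Gamma(f)$: for every compact (nonempty) face $\tau$ of $\Gamma(f)$ and every $z\in(K^\times)^n$ with $f_{1,\tau}(z)=\dots=f_{l,\tau}(z)=0$, where $f_{i,\tau}=\sum_{m\in\operatorname{supp}(f_i)\cap\tau}c_{m,i}x^m$, the matrix $[\partial f_{i,\tau}/\partial x_j(z)]$ has rank $\min\{l,n\}$. Let $\mathcal{F}$ be a simple fan subordinated to $\Gamma(f)$, i.e. a finite fan with support $\mathbb{R}_+^n$, each of whose cones is generated by a part of a basis of $\mathbb{Z}^n$,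 such that $a\mapsto F(a)=\{x\in\Gamma(f) : \langle a,x\rangle=\min_{y\in\Gamma(f)}\langle a,y\rangle\}$ is constant on the relative interior of each cone. Let $Y\to K^n$ be the toric map from the ($K$-analytic) toric manifold of $\mathcal{F}$, which in the chart $K^n$ of an $n$-dimensional cone with generators $a_1,\dots,a_n$ is given by $x_i=\prod_j y_j^{a_{j,i}}$. Then there is an open neighbourhood $U_0\subseteq U$ of $0$ such that for every open neighbourhood $V\subseteq U_0$ of $0$ the following holds. Let $\sigma_0:Y_V\to V$ be the restriction of the toric map to the inverse image $Y_V$ of $V$, and let $Z$ be the set of common zeros of $f_1,\dots,f_l$ in $V\cap(K^\times)^n$. Either $Z=\varnothing$, or $Z$ is a submanifold of codimension $l$ and $l<n$. Call an ideal sheaf of analytic functions on an analytic manifold principal and monomial at a point if its stalk there is generated by one monomial in suitable local analytic coordinates. Write $\mathcal{I}_f=(f_1,\dots,f_l)$. (1) If $Z=\varnothing$ or $l=1$, then the ideal $\sigma_0^*(\mathcal{I}_f)$ generated by the $f_i\circ\sigma_0$ is principal and monomial at every point of some neighbourhood of $\sigma_0^{-1}\{0\}$. (2) If $Z\neq\varnothing$,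 then the closure $Z_Y$ of $Z$ in $Y_V$ (that is, of $\sigma_0^{-1}(Z)\cong Z$) is a closed submanifold of $Y_V$ of codimension $l$, having normal crossings with the exceptional divisor of $\sigma_0$ (the set of points where $\sigma_0$ is not a local analytic isomorphism): around every point of $Z_Y$ there are local coordinates in which $Z_Y$ is a coordinate subspace and the exceptional divisor is a union of coordinate hyperplanes. The blowing-up $\sigma_1:X\to Y_V$ with centre $Z_Y$ exists, and for $\sigma=\sigma_0\circ\sigma_1$ the ideal $\sigma^*(\mathcal{I}_f)$ is principal and monomial at every point of some neighbourhood of $\sigma^{-1}\{0\}$. -/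

import Mathlib

open Set Filter Topology
open scoped Manifold ContDiff

noncomputable section

namespace NewtonPrincipalization

/-! ### Newton polyhedra -/

/-- The real vector of an exponent. -/
def expVec {n : ℕ} (m : Fin n →₀ ℕ) : Fin n → ℝ := fun i => (m i : ℝ)

/-- The Newton polyhedron of a set `G` of exponents: the convex hull of the union of the
translated orthants `m + ℝ₊ⁿ`, `m ∈ G`. -/
def newtonPolyhedron {n : ℕ} (G : Set (Fin n →₀ ℕ)) : Set (Fin n → ℝ) :=
  convexHull ℝ (⋃ m ∈ G, {x | expVec m ≤ x})

/-- The union of the supports of the power series `φ₁, …, φ_l`. -/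
def support {n l : ℕ} {K : Type*} [Field K] (φ : Fin l → MvPowerSeries (Fin n) K) :
    Set (Fin n →₀ ℕ) :=
  {m | ∃ i, MvPowerSeries.coeff m (φ i) ≠ 0}

/-- The first meet locus `F(a)` of `a` in `Γ`. -/
def firstMeet {n : ℕ} (Γ : Set (Fin n → ℝ)) (a : Fin n → ℝ) : Set (Fin n → ℝ) :=
  {x ∈ Γ | ∀ y ∈ Γ, a ⬝ᵥ x ≤ a ⬝ᵥ y}

/-- Nonempty faces of `Γ` (with `Γ` itself, which is cut out by the zero functional). -/
def IsFace {n : ℕ} (Γ τ : Set (Fin n → ℝ)) : Prop :=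
  τ.Nonempty ∧ IsExposed ℝ Γ τ

/-- The restriction `φ_τ` of a power series to the exponents in `τ`. It is used for compact `τ`,
where the sum is finite. -/
def faceRestriction {n : ℕ} {K : Type*} [Field K] (φ : MvPowerSeries (Fin n) K)
    (τ : Set (Fin n → ℝ)) : MvPolynomial (Fin n) K :=
  ∑ᶠ m ∈ {m : Fin n →₀ ℕ | MvPowerSeries.coeff m φ ≠ 0 ∧ expVec m ∈ τ},
    MvPolynomial.monomial m (MvPowerSeries.coeff m φ)

/-- Strong non-degeneracy at the origin with respect to the Newton polyhedron: on every compact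
face, at each common zero in the torus, the Jacobian matrix has rank `min l n`. -/
def StronglyNondegenerate {n l : ℕ} {K : Type*} [Field K]
    (φ : Fin l → MvPowerSeries (Fin n) K) : Prop :=
  ∀ τ : Set (Fin n → ℝ), IsFace (newtonPolyhedron (support φ)) τ → IsCompact τ →
    ∀ z : Fin n → K, (∀ j, z j ≠ 0) →
      (∀ i, MvPolynomial.eval z (faceRestriction (φ i) τ) = 0) →
      (Matrix.of fun (i : Fin l) (j : Fin n) =>
        MvPolynomial.eval z (MvPolynomial.pderiv j (faceRestriction (φ i) τ))).rank = min l n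

/-- `φ` is the power series expansion of `f` at the origin. -/
def HasExpansion {n l : ℕ} {K : Type*} [NontriviallyNormedField K]
    (f : (Fin n → K) → Fin l → K) (φ : Fin l → MvPowerSeries (Fin n) K) : Prop :=
  ∀ᶠ x in 𝓝 (0 : Fin n → K), ∀ i,
    HasSum (fun m : Fin n →₀ ℕ => MvPowerSeries.coeff m (φ i) * ∏ j, x j ^ m j) (f x i)

/-! ### Simple fans -/

/-- The cone strictly spanned by a finite set of integral vectors. -/
def openCone {n : ℕ} (s : Finset (Fin n → ℤ)) : Set (Fin n → ℝ) :=
  {x | ∃ c : (Fin n → ℤ) → ℝ, (∀ a ∈ s, 0 < c a) ∧ x = ∑ a ∈ s, c a • fun i => (a i : ℝ)}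

/-- A simple fan with support `ℝ₊ⁿ`. Each cone is recorded by its set of generators, a part of a
basis of `ℤⁿ`; the empty set stands for the cone `{0}`. -/
structure SimpleFan (n : ℕ) where
  cones : Finset (Finset (Fin n → ℤ))
  nonneg : ∀ s ∈ cones, ∀ a ∈ s, 0 ≤ a
  simple : ∀ s ∈ cones, ∃ b : Module.Basis (Fin n) ℤ (Fin n → ℤ), (s : Set (Fin n → ℤ)) ⊆ range b
  faces : ∀ s ∈ cones, ∀ t ⊆ s, t ∈ cones
  partition : ∀ a : Fin n → ℝ, 0 ≤ a → ∃! s, s ∈ cones ∧ a ∈ openCone s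

/-- The fan is subordinated to `Γ`: the first meet locus is constant on every open cone. -/
def SimpleFan.Subordinated {n : ℕ} (F : SimpleFan n) (Γ : Set (Fin n → ℝ)) : Prop :=
  ∀ s ∈ F.cones, ∀ a ∈ openCone s, ∀ b ∈ openCone s, firstMeet Γ a = firstMeet Γ b

/-! ### The toric manifold of a simple fan -/

/-- The `n`-dimensional cones of the fan with an ordering of their generators. -/
abbrev SimpleFan.MaxCone {n : ℕ} (F : SimpleFan n) : Type :=
  {b : Module.Basis (Fin n) ℤ (Fin n → ℤ) // Finset.univ.image b ∈ F.cones}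

/-- The value of the Laurent monomial with exponent `m` (a linear form on the lattice of the fan)
at the point `y` of the chart `Kⁿ` with generators `b`, or `none` if it has a pole there. -/
def laurentValue {n : ℕ} (F : SimpleFan n) (K : Type*) [Field K] (q : F.MaxCone × (Fin n → K))
    (m : (Fin n → ℤ) →ₗ[ℤ] ℤ) : Option K :=
  open Classical in
  if ∀ j, q.2 j = 0 → 0 ≤ m (q.1.1 j) then some (∏ j, q.2 j ^ m (q.1.1 j)) else none

/-- The points of two charts are glued if all Laurent monomials take the same values there. -/
def toricSetoid {n : ℕ} (F : SimpleFan n) (K : Type*) [Field K] :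
    Setoid (F.MaxCone × (Fin n → K)) :=
  Setoid.ker (laurentValue F K)

/-- The toric manifold of a simple fan: copies of `Kⁿ`, one for each `n`-dimensional cone, glued
along the monomial coordinate changes. -/
def ToricManifold {n : ℕ} (F : SimpleFan n) (K : Type*) [Field K] : Type _ :=
  Quotient (toricSetoid F K)

section Toric

variable {n : ℕ} (F : SimpleFan n) (K : Type*)

/-- The point with coordinates `y` in the chart of the cone `c`. -/
def toricPoint [Field K] (c : F.MaxCone) (y : Fin n → K) : ToricManifold F K :=
  Quotient.mk (toricSetoid F K) (c, y)

/-- The Laurent monomials as functions on the toric manifold. -/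
def ToricManifold.laurent {F : SimpleFan n} {K : Type*} [Field K] (q : ToricManifold F K) :
    ((Fin n → ℤ) →ₗ[ℤ] ℤ) → Option K :=
  Quotient.lift (laurentValue F K) (fun _ _ h => h) q

theorem toricPoint_eq_iff [Field K] {c c' : F.MaxCone} {y y' : Fin n → K} :
    toricPoint F K c y = toricPoint F K c' y' ↔
      laurentValue F K (c, y) = laurentValue F K (c', y') :=
  Quotient.eq (r := toricSetoid F K)

theorem laurentValue_coord [Field K] (c : F.MaxCone) (y : Fin n → K) (k : Fin n) :
    laurentValue F K (c, y) (c.1.coord k) = some (y k) := by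
  classical
  have h : ∀ j, c.1.coord k (c.1 j) = if j = k then 1 else 0 := by
    intro j
    simp [Module.Basis.coord_apply, Finsupp.single_apply]
  unfold laurentValue
  rw [if_pos]
  · congr 1
    simp only [h]
    rw [Finset.prod_eq_single k]
    · simp
    · intro j _ hj
      simp [hj]
    · simp
  · intro j _
    simp only [h]
    split_ifs <;> simp

/-- The chart of the cone `c`: its coordinates are the Laurent monomials dual to the generators. -/
def toricChart [Field K] (c : F.MaxCone) : PartialEquiv (ToricManifold F K) (Fin n → K) where
  toFun q := fun k => (q.laurent (c.1.coord k)).getD 0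
  invFun y := toricPoint F K c y
  source := range (toricPoint F K c)
  target := univ
  map_source' := fun _ _ => mem_univ _
  map_target' := fun y _ => mem_range_self y
  left_inv' := by
    rintro _ ⟨y, rfl⟩
    congr 1
    funext k
    change (laurentValue F K (c, y) (c.1.coord k)).getD 0 = y k
    rw [laurentValue_coord]
    rfl
  right_inv' := by
    intro y _
    funext k
    change (laurentValue F K (c, y) (c.1.coord k)).getD 0 = y k
    rw [laurentValue_coord]
    rfl

theorem laurentValue_ne_none_iff [Field K] (c : F.MaxCone) (y : Fin n → K)
    (m : (Fin n → ℤ) →ₗ[ℤ] ℤ) :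
    laurentValue F K (c, y) m ≠ none ↔ ∀ j, y j = 0 → 0 ≤ m (c.1 j) := by
  unfold laurentValue
  split_ifs with h <;> simpa using h

theorem zpow_finset_sum {ι G : Type*} [Field G] {x : G} (hx : x ≠ 0) (s : Finset ι) (g : ι → ℤ) :
    x ^ (∑ k ∈ s, g k) = ∏ k ∈ s, x ^ g k := by
  classical
  induction s using Finset.induction_on with
  | empty => simp
  | insert a s ha ih => rw [Finset.prod_insert ha, Finset.sum_insert ha, zpow_add₀ hx, ih]

/-- The point `y` of the chart of `c` lies in the chart of `c'` if and only if the generators of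
`c` whose coordinate vanishes at `y` are generators of `c'`. -/
theorem toricPoint_mem_range_iff [Field K] (c c' : F.MaxCone) (y : Fin n → K) :
    toricPoint F K c y ∈ range (toricPoint F K c') ↔ ∀ j, y j = 0 → c.1 j ∈ range c'.1 := by
  classical
  constructor
  · rintro ⟨y', hy'⟩ j hj
    have hv := ((toricPoint_eq_iff F K).1 hy').symm
    have hreg : ∀ m : (Fin n → ℤ) →ₗ[ℤ] ℤ,
        (∀ j, y j = 0 → 0 ≤ m (c.1 j)) ↔ ∀ k, y' k = 0 → 0 ≤ m (c'.1 k) := by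
      intro m
      rw [← laurentValue_ne_none_iff, ← laurentValue_ne_none_iff, hv]
    have hco : ∀ (b : Module.Basis (Fin n) ℤ (Fin n → ℤ)) (i k : Fin n),
        b.coord k (b i) = if i = k then 1 else 0 := by
      intro b i k
      simp [Module.Basis.coord_apply, Finsupp.single_apply]
    -- the coordinates of the generators with vanishing coordinate are nonnegative
    have h1 : ∀ k, 0 ≤ c'.1.coord k (c.1 j) := by
      intro k
      refine (hreg _).2 ?_ j hj
      intro i _
      rw [hco]
      split_ifs <;> simp
    have h1' : ∀ k, y' k ≠ 0 → c'.1.coord k (c.1 j) = 0 := by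
      intro k hk
      refine le_antisymm ?_ (h1 k)
      have := (hreg (-(c'.1.coord k))).2 ?_ j hj
      · simpa using this
      · intro i hi
        have hik : i ≠ k := by rintro rfl; exact hk hi
        rw [LinearMap.neg_apply, hco, if_neg hik]
        simp
    have h2 : ∀ k i, y' k = 0 → 0 ≤ c.1.coord i (c'.1 k) := by
      intro k i hk
      refine (hreg _).1 ?_ k hk
      intro i' _
      rw [hco]
      split_ifs <;> simp
    have hsum : ∀ i, c.1.coord i (c.1 j) =
        ∑ k, c'.1.coord k (c.1 j) * c.1.coord i (c'.1 k) := by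
      intro i
      conv_lhs => rw [← c'.1.sum_repr (c.1 j)]
      rw [map_sum]
      refine Finset.sum_congr rfl fun k _ => ?_
      rw [LinearMap.map_smul_of_tower, smul_eq_mul, Module.Basis.coord_apply c'.1]
    have hterm : ∀ i k, 0 ≤ c'.1.coord k (c.1 j) * c.1.coord i (c'.1 k) := by
      intro i k
      by_cases hk : y' k = 0
      · exact mul_nonneg (h1 k) (h2 k i hk)
      · rw [h1' k hk, zero_mul]
    obtain ⟨k, hk⟩ : ∃ k, c'.1.coord k (c.1 j) * c.1.coord j (c'.1 k) ≠ 0 := by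
      by_contra! hcon
      have := hsum j
      rw [hco, if_pos rfl, Finset.sum_eq_zero (fun k _ => hcon k)] at this
      exact one_ne_zero this
    have hka : c'.1.coord k (c.1 j) ≠ 0 := left_ne_zero_of_mul hk
    have hkb : c.1.coord j (c'.1 k) ≠ 0 := right_ne_zero_of_mul hk
    have hyk : y' k = 0 := by
      by_contra h
      exact hka (h1' k h)
    have hle : c'.1.coord k (c.1 j) * c.1.coord j (c'.1 k) ≤ 1 := by
      have := hsum j
      rw [hco, if_pos rfl] at this
      rw [this]
      exact Finset.single_le_sum (f := fun k => c'.1.coord k (c.1 j) * c.1.coord j (c'.1 k))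
        (fun k _ => hterm j k) (Finset.mem_univ k)
    have hone : c.1.coord j (c'.1 k) = 1 := by
      have ha : 1 ≤ c'.1.coord k (c.1 j) := lt_of_le_of_ne (h1 k) hka.symm
      have hb : 1 ≤ c.1.coord j (c'.1 k) := lt_of_le_of_ne (h2 k j hyk) hkb.symm
      nlinarith
    have hzero : ∀ i, i ≠ j → c.1.coord i (c'.1 k) = 0 := by
      intro i hi
      have h0 := hsum i
      rw [hco, if_neg hi.symm] at h0
      have := (Finset.sum_eq_zero_iff_of_nonneg (fun k _ => hterm i k)).1 h0.symm k
        (Finset.mem_univ k)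
      exact (mul_eq_zero.1 this).resolve_left hka
    refine ⟨k, ?_⟩
    apply c.1.ext_elem
    intro i
    have e1 := hco c.1 j i
    rw [Module.Basis.coord_apply] at e1
    rw [e1]
    by_cases hi : i = j
    · subst hi
      simpa [Module.Basis.coord_apply] using hone
    · rw [if_neg (Ne.symm hi)]
      simpa [Module.Basis.coord_apply] using hzero i hi
  · intro h
    have hco : ∀ i k, c'.1.coord k (c'.1 i) = if i = k then 1 else 0 := by
      intro i k
      simp [Module.Basis.coord_apply, Finsupp.single_apply]
    let y' : Fin n → K := fun k => ∏ j, y j ^ c'.1.coord k (c.1 j)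
    have hy' : ∀ k, y' k = 0 ↔ ∃ j, y j = 0 ∧ c.1 j = c'.1 k := by
      intro k
      constructor
      · intro hk
        obtain ⟨j, -, hj⟩ := Finset.prod_eq_zero_iff.1 hk
        have hyj : y j = 0 := eq_zero_of_zpow_eq_zero hj
        obtain ⟨i, hi⟩ := h j hyj
        refine ⟨j, hyj, ?_⟩
        rw [← hi]
        congr 1
        by_contra hik
        rw [← hi, hco, if_neg hik] at hj
        simp at hj
      · rintro ⟨j, hyj, hj⟩
        refine Finset.prod_eq_zero (Finset.mem_univ j) ?_
        rw [hj, hco, if_pos rfl, hyj]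
        simp
    refine ⟨y', ((toricPoint_eq_iff F K).2 ?_)⟩
    funext m
    have hiff : (∀ k, y' k = 0 → 0 ≤ m (c'.1 k)) ↔ ∀ j, y j = 0 → 0 ≤ m (c.1 j) := by
      constructor
      · intro H j hj
        obtain ⟨k, hk⟩ := h j hj
        rw [← hk]
        exact H k ((hy' k).2 ⟨j, hj, hk.symm⟩)
      · intro H k hk
        obtain ⟨j, hj, hjk⟩ := (hy' k).1 hk
        rw [← hjk]
        exact H j hj
    have hval : ∏ k, y' k ^ m (c'.1 k) = ∏ j, y j ^ m (c.1 j) := by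
      simp only [y', ← Finset.prod_zpow]
      rw [Finset.prod_comm]
      refine Finset.prod_congr rfl fun j _ => ?_
      by_cases hj : y j = 0
      · obtain ⟨k, hk⟩ := h j hj
        rw [Finset.prod_eq_single k]
        · rw [← hk, hco, if_pos rfl, zpow_one]
        · intro i _ hi
          rw [← hk, hco, if_neg (Ne.symm hi)]
          simp
        · simp
      · have : m (c.1 j) = ∑ k, c'.1.coord k (c.1 j) * m (c'.1 k) := by
          conv_lhs => rw [← c'.1.sum_repr (c.1 j)]
          rw [map_sum]
          refine Finset.sum_congr rfl fun k _ => ?_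
          rw [LinearMap.map_smul_of_tower, smul_eq_mul, Module.Basis.coord_apply]
        rw [this]
        simp only [← zpow_mul]
        exact (zpow_finset_sum hj _ _).symm
    unfold laurentValue
    simp only [hiff, hval]

theorem toricChart_trans_source [Field K] (c c' : F.MaxCone) :
    ((toricChart F K c).symm.trans (toricChart F K c')).source =
      {y | ∀ j, y j = 0 → c.1 j ∈ range c'.1} := by
  ext y
  rw [PartialEquiv.trans_source]
  simp only [mem_inter_iff, mem_preimage, mem_ofPred_eq]
  rw [← toricPoint_mem_range_iff]
  exact ⟨fun h => h.2, fun h => ⟨mem_univ _, h⟩⟩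

theorem toricChart_trans_apply [Field K] (c c' : F.MaxCone) {y : Fin n → K}
    (hy : ∀ j, y j = 0 → c.1 j ∈ range c'.1) (k : Fin n) :
    ((toricChart F K c).symm.trans (toricChart F K c')) y k =
      ∏ j, y j ^ c'.1.coord k (c.1 j) := by
  change (laurentValue F K (c, y) (c'.1.coord k)).getD 0 = _
  unfold laurentValue
  rw [if_pos]
  · rfl
  · intro j hj
    obtain ⟨i, hi⟩ := hy j hj
    change 0 ≤ c'.1.coord k (c.1 j)
    rw [← hi, Module.Basis.coord_apply, Module.Basis.repr_self]
    classical
    rw [Finsupp.single_apply]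
    split_ifs <;> simp

theorem toricChart_trans_contDiffOn [NontriviallyNormedField K] (c c' : F.MaxCone) :
    ContDiffOn K ω ((toricChart F K c).symm.trans (toricChart F K c'))
      ((toricChart F K c).symm.trans (toricChart F K c')).source := by
  classical
  rw [toricChart_trans_source]
  rw [contDiffOn_pi]
  intro k
  refine ContDiffOn.congr (f := fun y : Fin n → K => ∏ j, y j ^ c'.1.coord k (c.1 j)) ?_
    (fun y hy => toricChart_trans_apply F K c c' hy k)
  refine contDiffOn_prod fun j _ => ?_
  have hj : ContDiffOn K ω (fun y : Fin n → K => y j)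
      {y | ∀ j, y j = 0 → c.1 j ∈ range c'.1} := (contDiff_apply K K j).contDiffOn
  by_cases h : 0 ≤ c'.1.coord k (c.1 j)
  · obtain ⟨N, hN⟩ := Int.eq_ofNat_of_zero_le h
    rw [hN]
    simpa using hj.pow N
  · have hne : ∀ y ∈ {y : Fin n → K | ∀ j, y j = 0 → c.1 j ∈ range c'.1}, y j ≠ 0 := by
      intro y hy h0
      obtain ⟨i, hi⟩ := hy j h0
      apply h
      rw [← hi, Module.Basis.coord_apply, Module.Basis.repr_self, Finsupp.single_apply]
      split_ifs <;> simp
    obtain ⟨N, hN⟩ := Int.eq_ofNat_of_zero_le (neg_nonneg.2 (not_le.1 h).le)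
    have hN' : c'.1.coord k (c.1 j) = -(N : ℤ) := by omega
    rw [hN']
    have hinv := (hj.pow N).inv (fun y hy => pow_ne_zero N (hne y hy))
    refine hinv.congr fun y _ => ?_
    simp

/-- The toric charts form an atlas. -/
def toricCore [NontriviallyNormedField K] :
    ChartedSpaceCore (Fin n → K) (ToricManifold F K) where
  atlas := range (toricChart F K)
  chartAt q := toricChart F K (Quotient.out q).1
  mem_chart_source q := ⟨(Quotient.out q).2, Quotient.out_eq q⟩
  chart_mem_atlas q := mem_range_self _
  open_source := by
    rintro _ _ ⟨c, rfl⟩ ⟨c', rfl⟩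
    rw [toricChart_trans_source]
    simp only [ofPred_forall]
    refine isOpen_iInter_of_finite fun j => ?_
    by_cases h : c.1 j ∈ range c'.1
    · simp [h]
    · simpa [h] using isOpen_ne_fun (continuous_apply j) continuous_const
  continuousOn_toFun := by
    rintro _ _ ⟨c, rfl⟩ ⟨c', rfl⟩
    exact (toricChart_trans_contDiffOn F K c c').continuousOn

instance [NontriviallyNormedField K] : TopologicalSpace (ToricManifold F K) :=
  (toricCore F K).toTopologicalSpace

instance [NontriviallyNormedField K] : ChartedSpace (Fin n → K) (ToricManifold F K) :=
  (toricCore F K).toChartedSpace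

instance [NontriviallyNormedField K] :
    IsManifold 𝓘(K, Fin n → K) ω (ToricManifold F K) := by
  apply isManifold_of_contDiffOn
  intro e e' he he'
  change e ∈ ⋃ (e : PartialEquiv _ _) (he : e ∈ (toricCore F K).atlas), _ at he
  change e' ∈ ⋃ (e : PartialEquiv _ _) (he : e ∈ (toricCore F K).atlas), _ at he'
  simp only [mem_iUnion, mem_singleton_iff] at he he'
  obtain ⟨_, ⟨c, rfl⟩, rfl⟩ := he
  obtain ⟨_, ⟨c', rfl⟩, rfl⟩ := he'
  have := toricChart_trans_contDiffOn F K c c'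
  simpa using! this

/-- The toric map `Y → Kⁿ`; in the chart of the cone with generators `a₁, …, aₙ` it is
`xᵢ = ∏ⱼ yⱼ ^ (aⱼ)ᵢ`. -/
def toricMap [Field K] (q : ToricManifold F K) : Fin n → K :=
  fun i => (q.laurent (LinearMap.proj i)).getD 0

theorem MaxCone_nonneg (c : F.MaxCone) (i j : Fin n) : 0 ≤ c.1 j i :=
  F.nonneg _ c.2 (c.1 j) (Finset.mem_image_of_mem _ (Finset.mem_univ j)) i

theorem toricMap_toricPoint [Field K] (c : F.MaxCone) (y : Fin n → K) (i : Fin n) :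
    toricMap F K (toricPoint F K c y) i = ∏ j, y j ^ (c.1 j i).toNat := by
  change (laurentValue F K (c, y) (LinearMap.proj i)).getD 0 = _
  unfold laurentValue
  rw [if_pos]
  swap
  · exact fun j _ => MaxCone_nonneg F c i j
  refine Finset.prod_congr rfl fun j _ => ?_
  rw [← zpow_natCast, Int.toNat_of_nonneg (MaxCone_nonneg F c i j)]
  rfl

theorem continuous_toricMap [NontriviallyNormedField K] : Continuous (toricMap F K) := by
  rw [continuous_iff_continuousAt]
  intro q
  let e := chartAt (Fin n → K) q
  have hq : q ∈ e.source := mem_chart_source _ q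
  have h : Continuous (toricMap F K ∘ e.symm) := by
    refine continuous_pi fun i => ?_
    have : (fun y => (toricMap F K ∘ e.symm) y i) =
        fun y => ∏ j, y j ^ ((Quotient.out q).1.1 j i).toNat := by
      funext y
      exact toricMap_toricPoint F K (Quotient.out q).1 y i
    rw [this]
    fun_prop
  have h2 : ContinuousAt ((toricMap F K ∘ e.symm) ∘ e) q :=
    h.continuousAt.comp (e.continuousAt hq)
  refine h2.congr ?_
  filter_upwards [e.open_source.mem_nhds hq] with x hx
  simp [e.left_inv hx]

end Toric

/-- The inverse image of an open set `V ⊆ Kⁿ` in the toric manifold. -/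
def toricOpen {n : ℕ} (F : SimpleFan n) {K : Type*} [NontriviallyNormedField K]
    (V : TopologicalSpace.Opens (Fin n → K)) : TopologicalSpace.Opens (ToricManifold F K) :=
  ⟨toricMap F K ⁻¹' V, V.2.preimage (continuous_toricMap F K)⟩

/-- The map `σ₀`: the toric map restricted to the inverse image of `V`. -/
def sigmaZero {n : ℕ} (F : SimpleFan n) {K : Type*} [NontriviallyNormedField K]
    (V : TopologicalSpace.Opens (Fin n → K)) (q : toricOpen F V) : Fin n → K :=
  toricMap F K q

/-! ### Submanifolds, normal crossings, ideals and blowing-ups on analytic manifolds -/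

section Manifold

variable {n : ℕ} {K : Type*} [NontriviallyNormedField K]
  {M : Type*} [TopologicalSpace M] [ChartedSpace (Fin n → K) M]
  {X : Type*} [TopologicalSpace X] [ChartedSpace (Fin n → K) X]

/-- Analytic local coordinate systems on `M`. -/
def coordinateSystems (n : ℕ) (K : Type*) [NontriviallyNormedField K]
    (M : Type*) [TopologicalSpace M] [ChartedSpace (Fin n → K) M] :
    Set (OpenPartialHomeomorph M (Fin n → K)) :=
  IsManifold.maximalAtlas 𝓘(K, Fin n → K) ω M

/-- In the coordinates `φ` the set `Z` is the coordinate subspace `φᵢ = 0`, `i ∈ S`. -/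
def IsCoordinateSubspace (φ : OpenPartialHomeomorph M (Fin n → K)) (S : Finset (Fin n))
    (Z : Set M) : Prop :=
  ∀ q ∈ φ.source, q ∈ Z ↔ ∀ i ∈ S, φ q i = 0

/-- `Z` is an analytic submanifold of `M` of codimension `l`. -/
def IsSubmanifold (n : ℕ) (K : Type*) [NontriviallyNormedField K]
    {M : Type*} [TopologicalSpace M] [ChartedSpace (Fin n → K) M] (Z : Set M) (l : ℕ) : Prop :=
  ∀ b ∈ Z, ∃ φ ∈ coordinateSystems n K M, b ∈ φ.source ∧
    ∃ S : Finset (Fin n), S.card = l ∧ IsCoordinateSubspace φ S Z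

/-- `Z` has normal crossings with `E`: around every point of `Z` there are coordinates in which `Z`
is a coordinate subspace and `E` is a union of coordinate hyperplanes. -/
def HasNormalCrossings (n : ℕ) (K : Type*) [NontriviallyNormedField K]
    {M : Type*} [TopologicalSpace M] [ChartedSpace (Fin n → K) M] (Z E : Set M) : Prop :=
  ∀ b ∈ Z, ∃ φ ∈ coordinateSystems n K M, b ∈ φ.source ∧
    (∃ S : Finset (Fin n), IsCoordinateSubspace φ S Z) ∧
    ∃ T : Finset (Fin n), ∀ q ∈ φ.source, q ∈ E ↔ ∃ j ∈ T, φ q j = 0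

/-- The exceptional locus of a map between `n`-dimensional manifolds: the points where it is not a
local analytic isomorphism. -/
def exceptionalLocus (n : ℕ) (K : Type*) [NontriviallyNormedField K]
    {M : Type*} [TopologicalSpace M] [ChartedSpace (Fin n → K) M]
    (σ : M → Fin n → K) : Set M :=
  {q | ¬ IsLocalDiffeomorphAt 𝓘(K, Fin n → K) 𝓘(K, Fin n → K) ω σ q}

/-- The local ring of germs of analytic functions at `x`. -/
def localRing (n : ℕ) (K : Type*) [NontriviallyNormedField K]
    {M : Type*} [TopologicalSpace M] [ChartedSpace (Fin n → K) M] (x : M) :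
    Subring (Germ (𝓝 x) K) where
  carrier := {g | ∃ h : M → K, ContMDiffAt 𝓘(K, Fin n → K) 𝓘(K, K) ω h x ∧ g = (h : Germ (𝓝 x) K)}
  mul_mem' := by
    rintro _ _ ⟨g, hg, rfl⟩ ⟨h, hh, rfl⟩
    exact ⟨g * h, ContMDiffAt.mul hg hh, rfl⟩
  one_mem' := ⟨1, contMDiffAt_const, rfl⟩
  add_mem' := by
    rintro _ _ ⟨g, hg, rfl⟩ ⟨h, hh, rfl⟩
    exact ⟨g + h, ContMDiffAt.add hg hh, rfl⟩
  zero_mem' := ⟨0, contMDiffAt_const, rfl⟩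
  neg_mem' := by
    rintro _ ⟨g, hg, rfl⟩
    exact ⟨-g, ContMDiffAt.neg hg, rfl⟩

/-- The ideal of the local ring at `x` generated by the germs of the functions in a family. -/
def idealAt (n : ℕ) {K : Type*} [NontriviallyNormedField K]
    {M : Type*} [TopologicalSpace M] [ChartedSpace (Fin n → K) M] {ι : Type*} (g : ι → M → K)
    (x : M) : Ideal (localRing n K x) :=
  Ideal.span {h | ∃ i, (h : Germ (𝓝 x) K) = (g i : Germ (𝓝 x) K)}

/-- At `x` the ideal generated by the functions `g i` is generated by one monomial in suitable
local coordinates. -/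
def IsPrincipalMonomialAt (n : ℕ) {K : Type*} [NontriviallyNormedField K]
    {M : Type*} [TopologicalSpace M] [ChartedSpace (Fin n → K) M] {ι : Type*} (g : ι → M → K)
    (x : M) : Prop :=
  ∃ φ ∈ coordinateSystems n K M, x ∈ φ.source ∧ ∃ N : Fin n → ℕ,
    idealAt n g x = idealAt n (fun (_ : Unit) q => ∏ j, φ q j ^ N j) x

/-- The ideal `σ^*(f₁, …, f_l)` is principal and monomial in a neighbourhood of `σ⁻¹{0}`. -/
def PrincipalMonomialNearFibre {n l : ℕ} {K : Type*} [NontriviallyNormedField K]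
    {M : Type*} [TopologicalSpace M] [ChartedSpace (Fin n → K) M]
    (f : (Fin n → K) → Fin l → K) (σ : M → Fin n → K) : Prop :=
  ∃ W : Set M, IsOpen W ∧ σ ⁻¹' {0} ⊆ W ∧
    ∀ x ∈ W, IsPrincipalMonomialAt n (fun i q => f (σ q) i) x

/-- The `i`-th standard chart of the blowing-up of `Kⁿ` in the subspace `u_k = 0`, `k ∈ S`:
`u_i = t_i`, `u_k = t_i t_k` for the other `k ∈ S`, and `u_k = t_k` for `k ∉ S`. -/
def blowUpChart (S : Finset (Fin n)) (i : Fin n) (t : Fin n → K) : Fin n → K :=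
  fun k => if k ∈ S ∧ k ≠ i then t i * t k else t k

/-- Over the domain of the coordinates `φ`, the map `π` is the blowing-up of the coordinate
subspace `φ_k = 0`, `k ∈ S`: its source is covered by the standard charts `ψ i`, `i ∈ S`, glued in
the standard way. -/
def IsStandardBlowUp (π : X → M) (φ : OpenPartialHomeomorph M (Fin n → K))
    (S : Finset (Fin n)) : Prop :=
  ∃ ψ : Fin n → OpenPartialHomeomorph X (Fin n → K),
    (∀ i ∈ S, ψ i ∈ coordinateSystems n K X ∧
      (ψ i).source ⊆ π ⁻¹' φ.source ∧ (ψ i).target = blowUpChart S i ⁻¹' φ.target ∧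
      ∀ x ∈ (ψ i).source, φ (π x) = blowUpChart S i (ψ i x)) ∧
    (∀ x, π x ∈ φ.source → ∃ i ∈ S, x ∈ (ψ i).source) ∧
    ∀ i ∈ S, ∀ j ∈ S, i ≠ j → ∀ x ∈ (ψ i).source,
      (x ∈ (ψ j).source ↔ ψ i x j ≠ 0) ∧
      (x ∈ (ψ j).source → ψ j x i = (ψ i x j)⁻¹ ∧
        ∀ k ∈ S, k ≠ i → k ≠ j → ψ j x k = ψ i x k / ψ i x j)

/-- `π : X → M` is the blowing-up of the manifold `M` with centre the submanifold `Z`: an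
isomorphism over the complement of `Z`, and locally over `Z` the blowing-up of a coordinate
subspace. This determines `(X, π)` up to a unique isomorphism over `M`. -/
def IsBlowUp (n : ℕ) (K : Type*) [NontriviallyNormedField K]
    {M : Type*} [TopologicalSpace M] [ChartedSpace (Fin n → K) M]
    {X : Type*} [TopologicalSpace X] [ChartedSpace (Fin n → K) X] (π : X → M) (Z : Set M) : Prop :=
  (∀ b ∉ Z, ∃! x, π x = b) ∧
  (∀ x, π x ∉ Z → IsLocalDiffeomorphAt 𝓘(K, Fin n → K) 𝓘(K, Fin n → K) ω π x) ∧
  ∀ b ∈ Z, ∃ φ ∈ coordinateSystems n K M, b ∈ φ.source ∧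
    ∃ S : Finset (Fin n), IsCoordinateSubspace φ S Z ∧ IsStandardBlowUp π φ S

end Manifold

/-- The common zeros of `f₁, …, f_l` in `V ∩ (Kˣ)ⁿ`. -/
def torusZeros {n l : ℕ} {K : Type*} [NontriviallyNormedField K] (f : (Fin n → K) → Fin l → K)
    (V : TopologicalSpace.Opens (Fin n → K)) : Set (Fin n → K) :=
  {x | x ∈ V ∧ (∀ j, x j ≠ 0) ∧ f x = 0}

/-- The closure in `σ₀⁻¹(V)` of the torus zero set (over the torus `σ₀` is an isomorphism). -/
def strictZeros {n l : ℕ} (F : SimpleFan n) {K : Type*} [NontriviallyNormedField K]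
    (f : (Fin n → K) → Fin l → K) (V : TopologicalSpace.Opens (Fin n → K)) :
    Set (toricOpen F V) :=
  closure (sigmaZero F V ⁻¹' torusZeros f V)

end NewtonPrincipalization

end

open NewtonPrincipalization

universe u

noncomputable section

namespace NewtonPrincipalization

/-! In the chart of a maximal cone with generators a_1, …, a_n the monomial x^m pulls back to ∏
y_j^⟨a_j, m⟩. Since the fan is subordinated to the Newton polyhedron, a single exponent m₀ of the
support minimises all the forms ⟨a_j, ·⟩ at once (`exists_forall_coneDot_le`). At a point b over the
origin let I be the set of j with b_j = 0. Then f_i ∘ σ₀ = (∏_{j ∈ I} y_j^⟨a_j, m₀⟩) g_i with g_i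
analytic, and on y_I = 0 the function g_i is a finite sum which, up to a monomial, is the pull-back
of the face polynomial f_{i,τ} for the face τ cut out by the generators in I. This face is compact
because b lies over 0. If all g_i vanish at b, strong non-degeneracy at the image of a torus point
that projects to b makes the differentials of the g_i independent of each other and of the dy_j, j ∈
I (`exists_local_factorization`).

Hence near b either some g_i is a unit, or the g_i together with the y_j, j ∈ I, are part of a
coordinate system. This dichotomy is `AdaptedChart`. In such a chart the closure of the torus zeros
is the common zero set of the cofactors (`mem_zeroClosure_iff`); smoothness, normal crossings, l < n
and principality off this closure, or everywhere if l = 1, follow at once. The toric map is proper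
over the origin (`exists_norm_toricMap_lt`), so adapted charts cover the inverse image of a whole
ball, and U₀ is the part of that ball inside U. As σ₀ is an isomorphism over the torus, the charts
also descend to Z itself.

The blowing-up is realised as the set of pairs (q, L), where L is a line in K^l containing the
vector of cofactors at q; this makes sense globally because the cofactors of two adapted charts are
proportional. Principality is proved for every blowing-up, whose coordinates φ need not be adapted.
The pulled-back cofactors are divisible by the equation t_i of the exceptional divisor. Comparing
differentials shows that some quotient is a unit, and that t_i is independent of the coordinates in
the monomial (`isPrincipalMonomialAt_of_isStandardBlowUp`).

Divisibility of analytic functions by a coordinate comes from a telescoping identity for power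
series. The orders of vanishing of f_i ∘ σ₀ come from ultrametric estimates of the pulled-back
series, so this series never has to be rearranged into a Taylor series at b. -/

/-! ### Division of analytic functions by a linear form -/

section Division

variable {K : Type*} [NontriviallyNormedField K]
  {E : Type*} [NormedAddCommGroup E] [NormedSpace K E]
  {G : Type*} [NormedAddCommGroup G] [NormedSpace K G]

/-- The quotient of the power series `p` by a linear form `r` with kernel `range P`, where
`x = P x + r x • v`. -/
def divSeries (p : FormalMultilinearSeries K E G) (P : E →L[K] E) (v : E) :
    FormalMultilinearSeries K E G := fun k =>
  ∑ j : Fin (k + 1), ((p (k + 1)).curryMid j v).compContinuousLinearMap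
    (fun m : Fin k => if (m : ℕ) < j then ContinuousLinearMap.id K E else P)

theorem divSeries_apply (p : FormalMultilinearSeries K E G) (P : E →L[K] E) (v x : E) (k : ℕ) :
    divSeries p P v k (fun _ => x) = ∑ j : Fin (k + 1),
      p (k + 1) (j.insertNth v (fun m : Fin k => if (m : ℕ) < j then x else P x)) := by
  unfold divSeries
  rw [sum_apply]
  refine Finset.sum_congr rfl fun j _ => ?_
  rw [ContinuousMultilinearMap.compContinuousLinearMap_apply,
    ContinuousMultilinearMap.curryMid_apply]
  congr 2
  funext m
  split_ifs <;> rfl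

theorem insertNth_ite_lt {α : Type*} (k : ℕ) (j : Fin (k + 1)) (x y z : α) :
    (j.insertNth z (fun m : Fin k => if (m : ℕ) < j then x else y) : Fin (k + 1) → α) =
      fun m : Fin (k + 1) => if (m : ℕ) < j then x else if m = j then z else y := by
  refine (Fin.insertNth_eq_iff).2 ⟨by simp, ?_⟩
  funext m
  simp only [Fin.removeNth, Fin.succAbove_ne, if_false]
  by_cases h : m.castSucc < j
  · rw [Fin.succAbove_of_castSucc_lt _ _ h]
    simp
  · rw [Fin.succAbove_of_le_castSucc _ _ (not_lt.1 h)]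
    have h' : (j : ℕ) ≤ m := not_lt.1 h
    rw [if_neg (by omega), if_neg (by simp; omega)]

/-- Telescoping: the arguments P x are replaced by x one slot at a time. The step at slot j changes
the value by the multilinear map with x - P x = r x • v in that slot, which is r x times the j-th
summand of `divSeries`. -/
theorem smul_divSeries_apply (p : FormalMultilinearSeries K E G) (P : E →L[K] E) (r : E →L[K] K)
    (v : E) (hP : ∀ x, x = P x + r x • v) (x : E) (k : ℕ) :
    r x • divSeries p P v k (fun _ => x) = p (k + 1) (fun _ => x) - p (k + 1) (fun _ => P x) := by
  let a : ℕ → G := fun j => p (k + 1) (fun m => if (m : ℕ) < j then x else P x)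
  have hstep : ∀ j : Fin (k + 1), r x • p (k + 1)
      (j.insertNth v (fun m : Fin k => if (m : ℕ) < j then x else P x)) = a (j + 1) - a j := by
    intro j
    have e : ∀ z, (j.insertNth z (fun m : Fin k => if (m : ℕ) < j then x else P x)
        : Fin (k + 1) → E) = Function.update (j.insertNth (0 : E)
          (fun m : Fin k => if (m : ℕ) < j then x else P x)) j z := by
      intro z
      rw [Fin.update_insertNth]
    rw [e, ← ContinuousMultilinearMap.map_update_smul]
    have hx : r x • v = x - P x := by rw [eq_sub_iff_add_eq, add_comm]; exact (hP x).symm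
    rw [hx, ContinuousMultilinearMap.map_update_sub, ← e, ← e, insertNth_ite_lt, insertNth_ite_lt]
    congr 2
    · funext m
      by_cases h1 : (m : ℕ) < j
      · simp [h1, Nat.lt_succ_of_lt h1]
      · by_cases h2 : m = j
        · simp [h2]
        · have : ¬ (m : ℕ) < j + 1 := by
            have : (m : ℕ) ≠ j := fun h => h2 (Fin.ext h)
            omega
          simp [h1, h2, this]
    · funext m
      by_cases h1 : (m : ℕ) < j
      · simp [h1]
      · simp [h1]
  rw [divSeries_apply, Finset.smul_sum, Finset.sum_congr rfl fun j _ => hstep j,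
    Fin.sum_univ_eq_sum_range (fun j => a (j + 1) - a j), Finset.sum_range_sub]
  congr 1
  simp only [a]
  congr 1
  funext m
  simp [m.2]

theorem divSeries_radius_pos (p : FormalMultilinearSeries K E G) (hp : 0 < p.radius)
    (P : E →L[K] E) (v : E) : 0 < (divSeries p P v).radius := by
  obtain ⟨C, r, hC, hr, hb⟩ := p.le_mul_pow_of_radius_pos hp
  set D : ℝ := max 1 ‖P‖
  have hD : 1 ≤ D := le_max_left _ _
  have hbound : ∀ k, ‖divSeries p P v k‖ ≤ (k + 1) * (C * r ^ (k + 1) * ‖v‖ * D ^ k) := by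
    intro k
    refine (norm_sum_le _ _).trans ?_
    have : ∀ j ∈ (Finset.univ : Finset (Fin (k + 1))),
        ‖((p (k + 1)).curryMid j v).compContinuousLinearMap
          (fun m : Fin k => if (m : ℕ) < j then ContinuousLinearMap.id K E else P)‖ ≤
          C * r ^ (k + 1) * ‖v‖ * D ^ k := by
      intro j _
      refine (ContinuousMultilinearMap.norm_compContinuousLinearMap_le _ _).trans ?_
      gcongr
      · refine (ContinuousLinearMap.le_opNorm _ _).trans ?_
        rw [ContinuousMultilinearMap.norm_curryMid]
        gcongr
        exact hb _
      · refine (Finset.prod_le_prod (fun _ _ => norm_nonneg _) (g := fun _ => D)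
          fun m _ => ?_).trans (by simp)
        split_ifs
        · exact ContinuousLinearMap.norm_id_le.trans hD
        · exact le_max_right _ _
    refine (Finset.sum_le_card_nsmul _ _ _ this).trans ?_
    simp
  -- The factor 2 absorbs the number k + 1 ≤ 2 ^ k of summands; D bounds the norms of both maps,
  -- `id` and P, that fill the slots.
  have hrad : (((2 * r * D)⁻¹).toNNReal : ENNReal) ≤ (divSeries p P v).radius := by
    refine FormalMultilinearSeries.le_radius_of_bound _ (C * r * ‖v‖) fun k => ?_
    rw [Real.coe_toNNReal _ (by positivity)]
    have h2 : ((k : ℝ) + 1) ≤ 2 ^ k := by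
      exact_mod_cast Nat.lt_two_pow_self (n := k)
    calc ‖divSeries p P v k‖ * (2 * r * D)⁻¹ ^ k
        ≤ (2 ^ k * (C * r ^ (k + 1) * ‖v‖ * D ^ k)) * (2 * r * D)⁻¹ ^ k := by
          gcongr
          exact (hbound k).trans (by gcongr)
      _ = C * r * ‖v‖ := by
          have : (0 : ℝ) < D := by linarith
          rw [inv_pow, mul_pow, mul_pow, pow_succ r k]
          field_simp
  refine lt_of_lt_of_le ?_ hrad
  have : (0 : ℝ) < D := by linarith
  simp only [ENNReal.coe_pos, Real.toNNReal_pos]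
  positivity

/-- An analytic function which vanishes on the kernel of a linear form is divisible by it. -/
theorem AnalyticAt.exists_eq_smul [CompleteSpace G] {F : E → G} {b : E} (hF : AnalyticAt K F b)
    (P : E →L[K] E) (r : E →L[K] K) (v : E) (hP : ∀ x, x = P x + r x • v)
    (hz : ∀ᶠ x in 𝓝 (0 : E), F (b + P x) = 0) :
    ∃ w : E → G, AnalyticAt K w b ∧ ∀ᶠ x in 𝓝 b, F x = r (x - b) • w x := by
  obtain ⟨p, hp⟩ := hF
  let q := divSeries p P v
  have hq : HasFPowerSeriesAt q.sum q 0 :=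
    (q.hasFPowerSeriesOnBall (divSeries_radius_pos p hp.radius_pos P v)).hasFPowerSeriesAt
  have h0 := hq.eventually_hasSum
  have h1 := hp.eventually_hasSum
  have hPt : Tendsto P (𝓝 0) (𝓝 0) := by simpa using P.continuous.tendsto 0
  have h2 := hPt.eventually h1
  refine ⟨fun x => q.sum (x - b), ?_, ?_⟩
  · have : AnalyticAt K q.sum (b - b) := by simpa using hq.analyticAt
    exact this.comp (f := fun x => x - b) (analyticAt_id.sub analyticAt_const)
  · have key : ∀ᶠ x in 𝓝 (0 : E), F (b + x) = r x • q.sum x := by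
      filter_upwards [h0, h1, h2, hz] with x h0 h1 h2 hz
      rw [hz] at h2
      -- Subtracting the vanishing series at P x leaves the sum of F (b + x) unchanged. The constant
      -- terms cancel, which gives the shift by one built into `divSeries`.
      have h3 := (h1.sub h2)
      rw [← hasSum_nat_add_iff' 1] at h3
      simp only [Finset.range_one, Finset.sum_singleton, sub_zero] at h3
      have e0 : p 0 (fun _ => x) = p 0 (fun _ => P x) := by
        congr 1
        funext i
        exact i.elim0
      rw [e0, sub_self, sub_zero] at h3
      have h4 := h0.const_smul (r x)
      simp only [smul_divSeries_apply p P r v hP x, q, zero_add] at h4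
      exact h3.unique h4
    have ht : Tendsto (fun x => x - b) (𝓝 b) (𝓝 0) := by
      have : Tendsto (fun x => x - b) (𝓝 b) (𝓝 (b - b)) := tendsto_id.sub tendsto_const_nhds
      simpa using this
    filter_upwards [ht.eventually key] with x hx
    simpa using hx

variable {n : ℕ}

/-- An analytic function of `n` variables which vanishes on a coordinate hyperplane is divisible
by the coordinate. -/
theorem AnalyticAt.exists_eq_coord_mul [CompleteSpace K] {F : (Fin n → K) → K} {b : Fin n → K}
    (hF : AnalyticAt K F b) (i : Fin n) (hb : b i = 0)
    (hz : ∀ᶠ x in 𝓝 b, x i = 0 → F x = 0) :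
    ∃ w : (Fin n → K) → K, AnalyticAt K w b ∧ ∀ᶠ x in 𝓝 b, F x = x i * w x := by
  let r : (Fin n → K) →L[K] K := ContinuousLinearMap.proj i
  let v : Fin n → K := Pi.single i 1
  let P : (Fin n → K) →L[K] (Fin n → K) :=
    ContinuousLinearMap.id K _ - r.smulRight v
  have hP : ∀ x, x = P x + r x • v := by
    intro x
    simp [P]
  obtain ⟨w, hw, hFw⟩ := AnalyticAt.exists_eq_smul hF P r v hP (by
    have ht : Tendsto (fun x => b + P x) (𝓝 0) (𝓝 b) := by
      have : Tendsto (fun x => b + P x) (𝓝 0) (𝓝 (b + P 0)) :=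
        (continuous_const.add P.continuous).tendsto 0
      simpa using this
    filter_upwards [ht.eventually hz] with x hx
    apply hx
    simp [P, r, v, hb])
  refine ⟨w, hw, ?_⟩
  filter_upwards [hFw] with x hx
  rw [hx]
  simp [r, hb]

end Division

/-! ### Linear algebra and the inverse function theorem -/

section Inverse

variable {K : Type*} [NontriviallyNormedField K] {n : ℕ}

/-- The point is that the prescribed vectors keep their indices: after the image of P is extended to
a basis, the injection u on P is extended to a bijection from `Fin n` onto that basis. -/
theorem exists_basis_extending {V : Type*} [AddCommGroup V] [Module K V] [FiniteDimensional K V]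
    (hV : Module.finrank K V = n) (P : Finset (Fin n)) (u : Fin n → V)
    (hu : LinearIndepOn K u (P : Set (Fin n))) :
    ∃ b : Module.Basis (Fin n) K V, ∀ j ∈ P, b j = u j := by
  classical
  have hS : LinearIndepOn K id (u '' P) := hu.id_image
  let B := hS.extend (subset_univ _)
  let bas : Module.Basis B K V := Module.Basis.extend hS
  have : Fintype B := FiniteDimensional.fintypeBasisIndex bas
  have hSB : u '' P ⊆ B := hS.subset_extend _
  have hcard : Fintype.card (Fin n) = (B.toFinset).card := by
    rw [Set.toFinset_card, ← Module.finrank_eq_card_basis bas, hV, Fintype.card_fin]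
  obtain ⟨g, hg⟩ := Set.MapsTo.exists_equiv_extend_of_card_eq (f := u) (s := (P : Set (Fin n)))
    (t := B.toFinset) hcard (fun j hj => by simpa using hSB (mem_image_of_mem u hj)) hu.injOn
  let e : Fin n ≃ B := g.trans (Equiv.subtypeEquivRight fun x => by simp)
  refine ⟨bas.reindex e.symm, fun j hj => ?_⟩
  rw [Module.Basis.reindex_apply, Equiv.symm_symm, Module.Basis.extend_apply_self]
  exact hg j hj

/-- An independent family of linear forms, indexed by a part of `Fin n`, is a part of a system of
linear coordinates. -/
theorem exists_continuousLinearEquiv_extending [CompleteSpace K] (P : Finset (Fin n))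
    (lam : Fin n → ((Fin n → K) →L[K] K)) (h : LinearIndepOn K lam (P : Set (Fin n))) :
    ∃ L : (Fin n → K) ≃L[K] (Fin n → K), ∀ j ∈ P, ∀ x, L x j = lam j x := by
  have hu : LinearIndepOn K (fun j => (lam j : (Fin n → K) →ₗ[K] K)) (P : Set (Fin n)) :=
    LinearIndependent.map' h (ContinuousLinearMap.coeLM K)
      (LinearMap.ker_eq_bot.2 ContinuousLinearMap.coe_injective)
  obtain ⟨b, hb⟩ := exists_basis_extending (V := Module.Dual K (Fin n → K)) (by simp) P _ hu
  let L0 : (Fin n → K) →ₗ[K] (Fin n → K) := LinearMap.pi fun j => b j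
  have hinj : Function.Injective L0 := by
    rw [← LinearMap.ker_eq_bot, LinearMap.ker_eq_bot']
    intro x hx
    have : ∀ ψ : Module.Dual K (Fin n → K), ψ x = 0 := by
      intro ψ
      rw [← b.sum_repr ψ, LinearMap.sum_apply]
      refine Finset.sum_eq_zero fun j _ => ?_
      have : b j x = 0 := congrFun hx j
      simp [this]
    funext j
    exact this (LinearMap.proj j)
  let L1 := LinearEquiv.ofInjectiveEndo L0 hinj
  refine ⟨L1.toContinuousLinearEquiv, fun j hj x => ?_⟩
  change b j x = _
  rw [hb j hj]
  rfl

/-- The inverse function theorem, restricted to an open set where the derivative stays invertible;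
invertibility at every point of the source is what makes the inverse analytic on the whole target.
-/
theorem AnalyticAt.exists_openPartialHomeomorph [CompleteSpace K]
    {θ : (Fin n → K) → (Fin n → K)} {a : Fin n → K} (hθ : AnalyticAt K θ a)
    (L : (Fin n → K) ≃L[K] (Fin n → K)) (hL : fderiv K θ a = L) {O : Set (Fin n → K)}
    (hO : O ∈ 𝓝 a) :
    ∃ ψ : OpenPartialHomeomorph (Fin n → K) (Fin n → K), a ∈ ψ.source ∧ ψ.source ⊆ O ∧
      (∀ x ∈ ψ.source, ψ x = θ x) ∧ AnalyticOnNhd K ψ ψ.source ∧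
      AnalyticOnNhd K ψ.symm ψ.target := by
  have hs : HasStrictFDerivAt θ (L : (Fin n → K) →L[K] (Fin n → K)) a := by
    rw [← hL]
    exact hθ.hasStrictFDerivAt
  let ψ0 := hs.toOpenPartialHomeomorph θ
  have ha : a ∈ ψ0.source := hs.mem_toOpenPartialHomeomorph_source
  -- points near `a` where the derivative is invertible
  have hev : ∀ᶠ x in 𝓝 a, AnalyticAt K θ x ∧ x ∈ O ∧
      fderiv K θ x ∈ range ((↑) : ((Fin n → K) ≃L[K] (Fin n → K)) → _) := by
    refine hθ.eventually_analyticAt.and ((eventually_mem_set.2 hO).and ?_)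
    have hc : ContinuousAt (fderiv K θ) a := hθ.fderiv.continuousAt
    refine hc.eventually (?_ : ∀ᶠ A in 𝓝 (fderiv K θ a), A ∈ _)
    rw [hL]
    exact ContinuousLinearEquiv.nhds L
  obtain ⟨O', hO', hO'open, haO'⟩ := eventually_nhds_iff.1 hev
  let ψ := ψ0.restrOpen O' hO'open
  have hsrc : ∀ x ∈ ψ.source, x ∈ ψ0.source ∧ x ∈ O' := by
    intro x hx
    rwa [OpenPartialHomeomorph.restrOpen_source] at hx
  have hfun : ∀ x, ψ x = θ x := fun x => rfl
  have hfun' : (ψ : (Fin n → K) → (Fin n → K)) = θ := funext hfun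
  refine ⟨ψ, ?_, ?_, fun x _ => hfun x, ?_, ?_⟩
  · rw [OpenPartialHomeomorph.restrOpen_source]
    exact ⟨ha, haO'⟩
  · intro x hx
    exact (hO' x (hsrc x hx).2).2.1
  · intro x hx
    rw [hfun']
    exact (hO' x (hsrc x hx).2).1
  · intro y hy
    have hx := ψ.map_target hy
    obtain ⟨h1, -, ⟨A, hA⟩⟩ := hO' _ (hsrc _ hx).2
    exact ψ.analyticAt_symm (i := A) hy (by rw [hfun']; exact h1) (by rw [hfun']; exact hA.symm)

end Inverse

/-! ### Analytic coordinate systems -/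

section Coordinates

variable {n : ℕ} {K : Type*} [NontriviallyNormedField K]
  {M : Type*} [TopologicalSpace M] [ChartedSpace (Fin n → K) M]
  {X : Type*} [TopologicalSpace X] [ChartedSpace (Fin n → K) X]

theorem mem_coordinateSystems_iff [IsManifold 𝓘(K, Fin n → K) ω M]
    {φ : OpenPartialHomeomorph M (Fin n → K)} :
    φ ∈ coordinateSystems n K M ↔
      ContMDiffOn 𝓘(K, Fin n → K) 𝓘(K, Fin n → K) ω φ φ.source ∧
      ContMDiffOn 𝓘(K, Fin n → K) 𝓘(K, Fin n → K) ω φ.symm φ.target :=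
  IsManifold.mem_maximalAtlas_iff_contMDiffOn φ

theorem trans_mem_coordinateSystems [IsManifold 𝓘(K, Fin n → K) ω M] [CompleteSpace K]
    {φ : OpenPartialHomeomorph M (Fin n → K)} (hφ : φ ∈ coordinateSystems n K M)
    {ψ : OpenPartialHomeomorph (Fin n → K) (Fin n → K)} (h : AnalyticOnNhd K ψ ψ.source)
    (h' : AnalyticOnNhd K ψ.symm ψ.target) : φ.trans ψ ∈ coordinateSystems n K M := by
  rw [mem_coordinateSystems_iff] at hφ ⊢
  have h1 : ContMDiffOn 𝓘(K, Fin n → K) 𝓘(K, Fin n → K) ω ψ ψ.source :=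
    contMDiffOn_iff_contDiffOn.2 (h.contDiffOn ψ.open_source.uniqueDiffOn)
  have h2 : ContMDiffOn 𝓘(K, Fin n → K) 𝓘(K, Fin n → K) ω ψ.symm ψ.target :=
    contMDiffOn_iff_contDiffOn.2 (h'.contDiffOn ψ.open_target.uniqueDiffOn)
  constructor
  · exact h1.comp' (hφ.1) |>.mono (by rw [OpenPartialHomeomorph.trans_source])
  · exact hφ.2.comp' h2 |>.mono (by rw [OpenPartialHomeomorph.trans_target])

theorem restrOpen_mem_coordinateSystems {φ : OpenPartialHomeomorph M (Fin n → K)}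
    (hφ : φ ∈ coordinateSystems n K M) {O : Set M} (hO : IsOpen O) :
    φ.restrOpen O hO ∈ coordinateSystems n K M := by
  have h := restr_mem_maximalAtlas (contDiffGroupoid ω 𝓘(K, Fin n → K)) hφ hO
  have e : φ.restr O = φ.restrOpen O hO := by
    simp only [OpenPartialHomeomorph.restr, hO.interior_eq]
  rw [← e]
  exact h

theorem partialDiffeomorph_trans_mem_coordinateSystems [IsManifold 𝓘(K, Fin n → K) ω M]
    [IsManifold 𝓘(K, Fin n → K) ω X]
    {φ : OpenPartialHomeomorph M (Fin n → K)} (hφ : φ ∈ coordinateSystems n K M)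
    (Φ : PartialDiffeomorph 𝓘(K, Fin n → K) 𝓘(K, Fin n → K) X M ω) :
    Φ.toOpenPartialHomeomorph.trans φ ∈ coordinateSystems n K X := by
  rw [mem_coordinateSystems_iff] at hφ ⊢
  constructor
  · exact hφ.1.comp' Φ.contMDiffOn_toFun |>.mono (by rw [OpenPartialHomeomorph.trans_source]; rfl)
  · exact Φ.contMDiffOn_invFun.comp' hφ.2 |>.mono (by rw [OpenPartialHomeomorph.trans_target]; rfl)

theorem contMDiffAt_iff_analyticAt [CompleteSpace K] {F : Type*} [NormedAddCommGroup F]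
    [NormedSpace K F] [CompleteSpace F] [IsManifold 𝓘(K, Fin n → K) ω M]
    {φ : OpenPartialHomeomorph M (Fin n → K)}
    (hφ : φ ∈ coordinateSystems n K M) {x : M} (hx : x ∈ φ.source) {h : M → F} :
    ContMDiffAt 𝓘(K, Fin n → K) 𝓘(K, F) ω h x ↔ AnalyticAt K (h ∘ φ.symm) (φ x) := by
  have e : AnalyticAt K (h ∘ φ.symm) (φ x) ↔
      ContMDiffAt 𝓘(K, Fin n → K) 𝓘(K, F) ω (h ∘ φ.symm) (φ x) := by
    rw [contMDiffAt_iff_contDiffAt, ← contDiffWithinAt_univ,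
      contDiffWithinAt_omega_iff_analyticWithinAt, analyticWithinAt_univ]
  rw [e]
  constructor
  · intro H
    have hs := contMDiffAt_symm_of_mem_maximalAtlas hφ (φ.map_source hx)
    refine ContMDiffAt.comp (φ x) ?_ hs
    rwa [φ.left_inv hx]
  · intro H
    have hs := contMDiffAt_of_mem_maximalAtlas hφ hx
    refine (ContMDiffAt.comp x H hs).congr_of_eventuallyEq ?_
    filter_upwards [φ.open_source.mem_nhds hx] with y hy
    simp [φ.left_inv hy]

theorem analyticAt_transition [CompleteSpace K] [IsManifold 𝓘(K, Fin n → K) ω M]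
    {φ χ : OpenPartialHomeomorph M (Fin n → K)} (hφ : φ ∈ coordinateSystems n K M)
    (hχ : χ ∈ coordinateSystems n K M) {x : M} (hx : x ∈ φ.source) (hx' : x ∈ χ.source) :
    AnalyticAt K (χ ∘ φ.symm) (φ x) :=
  (contMDiffAt_iff_analyticAt hφ hx).1 (contMDiffAt_of_mem_maximalAtlas hχ hx')

theorem tendsto_symm_of_mem_source {Y Y' : Type*} [TopologicalSpace Y] [TopologicalSpace Y']
    {φ : OpenPartialHomeomorph Y Y'} {x : Y}
    (hx : x ∈ φ.source) : Tendsto φ.symm (𝓝 (φ x)) (𝓝 x) := by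
  simpa [φ.left_inv hx] using (φ.continuousAt_symm (φ.map_source hx)).tendsto

theorem fderiv_transition_fderiv_transition [CompleteSpace K] [IsManifold 𝓘(K, Fin n → K) ω M]
    {φ χ : OpenPartialHomeomorph M (Fin n → K)} (hφ : φ ∈ coordinateSystems n K M)
    (hχ : χ ∈ coordinateSystems n K M) {x : M} (hx : x ∈ φ.source) (hx' : x ∈ χ.source)
    (v : Fin n → K) :
    fderiv K (φ ∘ χ.symm) (χ x) (fderiv K (χ ∘ φ.symm) (φ x) v) = v := by
  have h1 : HasFDerivAt ((φ ∘ χ.symm) ∘ (χ ∘ φ.symm))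
      ((fderiv K (φ ∘ χ.symm) (χ x)).comp (fderiv K (χ ∘ φ.symm) (φ x))) (φ x) := by
    refine HasFDerivAt.comp (φ x) ?_
      (analyticAt_transition hφ hχ hx hx').differentiableAt.hasFDerivAt
    rw [Function.comp_apply, φ.left_inv hx]
    exact (analyticAt_transition hχ hφ hx' hx).differentiableAt.hasFDerivAt
  have h2 : HasFDerivAt ((φ ∘ χ.symm) ∘ (χ ∘ φ.symm))
      (ContinuousLinearMap.id K (Fin n → K)) (φ x) := by
    refine (hasFDerivAt_id (φ x)).congr_of_eventuallyEq ?_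
    filter_upwards [(tendsto_symm_of_mem_source hx).eventually (χ.open_source.mem_nhds hx'),
      φ.open_target.mem_nhds (φ.map_source hx)] with u h1 h2
    simp [χ.left_inv h1, φ.right_inv h2]
  exact DFunLike.congr_fun (h1.unique h2) v

/-- Functions with independent differentials are a part of a coordinate system. -/
theorem exists_coordinateSystem_extending [CompleteSpace K] [IsManifold 𝓘(K, Fin n → K) ω M]
    {φ : OpenPartialHomeomorph M (Fin n → K)} (hφ : φ ∈ coordinateSystems n K M)
    {x : M} (hx : x ∈ φ.source) (P : Finset (Fin n)) (G : Fin n → (Fin n → K) → K)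
    (hG : ∀ j ∈ P, AnalyticAt K (G j) (φ x))
    (hind : LinearIndepOn K (fun j => fderiv K (G j) (φ x)) (P : Set (Fin n)))
    {O : Set M} (hO : O ∈ 𝓝 x) :
    ∃ χ ∈ coordinateSystems n K M, x ∈ χ.source ∧ χ.source ⊆ φ.source ∧ χ.source ⊆ O ∧
      ∀ j ∈ P, ∀ q ∈ χ.source, χ q j = G j (φ q) := by
  classical
  obtain ⟨L, hL⟩ := exists_continuousLinearEquiv_extending P _ hind
  -- The missing coordinates are taken from the linear system L that extends the differentials of
  -- the G j, so that the derivative of θ at φ x is exactly L.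
  let θ : (Fin n → K) → (Fin n → K) := fun y j => if j ∈ P then G j y else L y j
  have hcoord : ∀ j, AnalyticAt K (fun y => θ y j) (φ x) ∧
      fderiv K (fun y => θ y j) (φ x) =
        ((ContinuousLinearMap.proj j).comp
          (L : (Fin n → K) →L[K] (Fin n → K)) : (Fin n → K) →L[K] K) := by
    intro j
    by_cases hj : j ∈ P
    · have e : (fun y => θ y j) = G j := by funext y; simp [θ, hj]
      rw [e]
      refine ⟨hG j hj, ?_⟩
      ext1 y
      simpa using (hL j hj y).symm
    · have e : (fun y => θ y j) = ((ContinuousLinearMap.proj j).comp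
          (L : (Fin n → K) →L[K] (Fin n → K)) : (Fin n → K) →L[K] K) := by
        funext y; simp [θ, hj]
      rw [e]
      exact ⟨ContinuousLinearMap.analyticAt _ _, ContinuousLinearMap.fderiv _⟩
  have hθ : AnalyticAt K θ (φ x) := analyticAt_pi_iff.2 fun j => (hcoord j).1
  have hd : fderiv K θ (φ x) = L := by
    have : HasFDerivAt θ (ContinuousLinearMap.pi fun j =>
        (ContinuousLinearMap.proj j).comp (L : (Fin n → K) →L[K] (Fin n → K))) (φ x) := by
      rw [hasFDerivAt_pi]
      intro j
      rw [← (hcoord j).2]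
      exact (hcoord j).1.differentiableAt.hasFDerivAt
    rw [this.fderiv]
    ext1 y
    rfl
  obtain ⟨ψ, haψ, -, hψθ, h1, h2⟩ := AnalyticAt.exists_openPartialHomeomorph hθ L hd univ_mem
  obtain ⟨O', hO'O, hO', hxO'⟩ := mem_nhds_iff.1 hO
  refine ⟨(φ.trans ψ).restrOpen O' hO',
    restrOpen_mem_coordinateSystems (trans_mem_coordinateSystems hφ h1 h2) hO', ?_, ?_, ?_, ?_⟩
  · rw [OpenPartialHomeomorph.restrOpen_source, OpenPartialHomeomorph.trans_source]
    exact ⟨⟨hx, haψ⟩, hxO'⟩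
  · rw [OpenPartialHomeomorph.restrOpen_source, OpenPartialHomeomorph.trans_source]
    exact fun q hq => hq.1.1
  · rw [OpenPartialHomeomorph.restrOpen_source]
    exact fun q hq => hO'O hq.2
  · intro j hj q hq
    rw [OpenPartialHomeomorph.restrOpen_source, OpenPartialHomeomorph.trans_source] at hq
    change ψ (φ q) j = _
    rw [hψθ _ hq.1.2]
    simp [θ, hj]

/-! ### Ideals of the local rings -/

/-- If `gᵢ = aᵢ h` with analytic `aᵢ` and some `aᵢ` does not vanish at `x`, the ideal of the `gᵢ`
is generated by `h`. -/
theorem idealAt_eq_of_factor [CompleteSpace K] {ι : Type*} {g a : ι → M → K} {h : M → K} {x : M}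
    (hh : ContMDiffAt 𝓘(K, Fin n → K) 𝓘(K, K) ω h x)
    (ha : ∀ i, ContMDiffAt 𝓘(K, Fin n → K) 𝓘(K, K) ω (a i) x)
    (hg : ∀ i, g i =ᶠ[𝓝 x] a i * h) (i₀ : ι) (hi₀ : a i₀ x ≠ 0) :
    idealAt n g x = idealAt n (fun _ : Unit => h) x := by
  have hga : ∀ i, ContMDiffAt 𝓘(K, Fin n → K) 𝓘(K, K) ω (g i) x := fun i =>
    ((ha i).mul hh).congr_of_eventuallyEq (hg i)
  have hinv : ContMDiffAt 𝓘(K, Fin n → K) 𝓘(K, K) ω (fun y => (a i₀ y)⁻¹) x := by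
    have h1 : ContMDiffAt 𝓘(K, K) 𝓘(K, K) ω (fun z : K => z⁻¹) (a i₀ x) :=
      contMDiffAt_iff_contDiffAt.2 (contDiffAt_inv K hi₀)
    exact h1.comp x (ha i₀)
  apply le_antisymm
  · refine Ideal.span_le.2 ?_
    rintro k ⟨i, hk⟩
    let A : localRing n K x := ⟨(a i : Germ (𝓝 x) K), a i, ha i, rfl⟩
    let H : localRing n K x := ⟨(h : Germ (𝓝 x) K), h, hh, rfl⟩
    have : k = A * H := by
      apply Subtype.ext
      rw [hk]
      exact Germ.coe_eq.2 (hg i)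
    rw [this]
    exact Ideal.mul_mem_left _ _ (Ideal.subset_span ⟨(), rfl⟩)
  · refine Ideal.span_le.2 ?_
    rintro k ⟨_, hk⟩
    let A : localRing n K x := ⟨((fun y => (a i₀ y)⁻¹ : M → K) : Germ (𝓝 x) K), _, hinv, rfl⟩
    let H : localRing n K x := ⟨(g i₀ : Germ (𝓝 x) K), g i₀, hga i₀, rfl⟩
    have : k = A * H := by
      apply Subtype.ext
      rw [hk]
      refine Germ.coe_eq.2 ?_
      filter_upwards [hg i₀, (ha i₀).continuousAt.eventually_ne hi₀] with y hy hne
      simp only [Pi.mul_apply] at hy ⊢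
      rw [hy, inv_mul_cancel_left₀ hne]
    rw [this]
    exact Ideal.mul_mem_left _ _ (Ideal.subset_span ⟨i₀, rfl⟩)

theorem contMDiffAt_monomial [CompleteSpace K] [IsManifold 𝓘(K, Fin n → K) ω M]
    {φ : OpenPartialHomeomorph M (Fin n → K)} (hφ : φ ∈ coordinateSystems n K M)
    {x : M} (hx : x ∈ φ.source) (N : Fin n → ℕ) :
    ContMDiffAt 𝓘(K, Fin n → K) 𝓘(K, K) ω (fun q => ∏ j, φ q j ^ N j) x := by
  have h1 := contMDiffAt_of_mem_maximalAtlas hφ hx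
  have h2 : ContMDiffAt 𝓘(K, Fin n → K) 𝓘(K, K) ω (fun y : Fin n → K => ∏ j, y j ^ N j) (φ x) := by
    refine contMDiffAt_iff_contDiffAt.2 (ContDiff.contDiffAt ?_)
    fun_prop
  exact h2.comp x h1

theorem isPrincipalMonomialAt_of_factor [CompleteSpace K] [IsManifold 𝓘(K, Fin n → K) ω M]
    {φ : OpenPartialHomeomorph M (Fin n → K)} (hφ : φ ∈ coordinateSystems n K M)
    {x : M} (hx : x ∈ φ.source) (N : Fin n → ℕ) {ι : Type*} {g a : ι → M → K}
    (ha : ∀ i, ContMDiffAt 𝓘(K, Fin n → K) 𝓘(K, K) ω (a i) x)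
    (hg : ∀ i, ∀ᶠ q in 𝓝 x, g i q = a i q * ∏ j, φ q j ^ N j) (i₀ : ι) (hi₀ : a i₀ x ≠ 0) :
    IsPrincipalMonomialAt n g x :=
  ⟨φ, hφ, hx, N, idealAt_eq_of_factor (contMDiffAt_monomial hφ hx N) ha hg i₀ hi₀⟩

end Coordinates

/-! ### Charts adapted to a family of functions -/

/-- A chart in which the functions `Φ₁, …, Φ_l` are a common monomial times functions `hᵢ` which
either have no common zero or are independent coordinates that do not occur in the monomial. The
set `Θ` plays the role of the torus and `E` that of the exceptional divisor. -/
structure AdaptedChart (n : ℕ) {l : ℕ} {K : Type*} [NontriviallyNormedField K]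
    {M : Type*} [TopologicalSpace M] [ChartedSpace (Fin n → K) M]
    (Φ : M → Fin l → K) (Θ E : Set M) where
  chart : OpenPartialHomeomorph M (Fin n → K)
  mem : chart ∈ coordinateSystems n K M
  T : Finset (Fin n)
  N : Fin n → ℕ
  N_eq_zero : ∀ j ∉ T, N j = 0
  h : M → Fin l → K
  analytic : ∀ x ∈ chart.source,
    ContMDiffAt 𝓘(K, Fin n → K) 𝓘(K, Fin l → K) ω h x
  mem_torus_iff : ∀ q ∈ chart.source, q ∈ Θ ↔ ∀ j ∈ T, chart q j ≠ 0
  exc : ∃ T' : Finset (Fin n), ∀ q ∈ chart.source, q ∈ E ↔ ∃ j ∈ T', chart q j = 0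
  factor : ∀ q ∈ chart.source, ∀ i, Φ q i = h q i * ∏ j, chart q j ^ N j
  alt : (∃ i, ∀ q ∈ chart.source, h q i ≠ 0) ∨
    ∃ s : Fin l ↪ Fin n, T.Nonempty ∧ (∀ k, s k ∉ T) ∧
      ∀ q ∈ chart.source, ∀ k, h q k = chart q (s k)

/-! ### Differentials of maps between coordinate subspaces and of the blow-up charts. -/

section Tangent

variable {K : Type*} [NontriviallyNormedField K] {n : ℕ}

/-- A differentiable map between coordinate subspaces maps tangent vectors to tangent vectors. -/
theorem fderiv_apply_eq_zero_of_mapsTo {ξ : (Fin n → K) → (Fin n → K)} {u : Fin n → K}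
    (hξ : DifferentiableAt K ξ u) {A B : Set (Fin n)} (hu : ∀ i ∈ A, u i = 0)
    (h : ∀ᶠ y in 𝓝 u, (∀ i ∈ A, y i = 0) → ∀ j ∈ B, ξ y j = 0) {v : Fin n → K}
    (hv : ∀ i ∈ A, v i = 0) {j : Fin n} (hj : j ∈ B) : fderiv K ξ u v j = 0 := by
  -- The line u + c • v stays in the first coordinate subspace, so the j-th component of ξ vanishes
  -- along it near c = 0.
  have hline : HasDerivAt (fun c : K => u + c • v) v 0 := by
    have := ((hasDerivAt_id (0 : K)).smul_const v).const_add u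
    simpa using this
  have h1 : HasFDerivAt ξ (fderiv K ξ u) (u + (0 : K) • v) := by simpa using hξ.hasFDerivAt
  have h2 := h1.comp_hasDerivAt (0 : K) hline
  have h3 := (hasDerivAt_pi.1 h2) j
  have h4 : (fun c : K => (ξ ∘ fun c : K => u + c • v) c j) =ᶠ[𝓝 0] fun _ => 0 := by
    have ht : Tendsto (fun c : K => u + c • v) (𝓝 0) (𝓝 u) := by
      simpa using hline.continuousAt.tendsto
    filter_upwards [ht.eventually h] with c hc
    exact hc (fun i hi => by simp [hu i hi, hv i hi]) j hj
  exact (h3.congr_of_eventuallyEq h4.symm).unique (hasDerivAt_const 0 0)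

theorem hasFDerivAt_blowUpChart (S : Finset (Fin n)) (i : Fin n) (t : Fin n → K) :
    HasFDerivAt (blowUpChart S i : (Fin n → K) → (Fin n → K))
      (ContinuousLinearMap.pi fun k => if k ∈ S ∧ k ≠ i then
        t i • (ContinuousLinearMap.proj k : (Fin n → K) →L[K] K) +
          t k • (ContinuousLinearMap.proj i : (Fin n → K) →L[K] K)
        else (ContinuousLinearMap.proj k : (Fin n → K) →L[K] K)) t := by
  rw [hasFDerivAt_pi]
  intro k
  unfold blowUpChart
  by_cases hk : k ∈ S ∧ k ≠ i
  · simp only [hk, and_self, if_true, ne_eq, not_false_eq_true]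
    exact (hasFDerivAt_apply i t).mul (hasFDerivAt_apply k t)
  · simp only [hk, if_false]
    exact hasFDerivAt_apply k t

theorem analyticAt_blowUpChart [CompleteSpace K] (S : Finset (Fin n)) (i : Fin n) (t : Fin n → K) :
    AnalyticAt K (blowUpChart S i : (Fin n → K) → (Fin n → K)) t := by
  rw [analyticAt_pi_iff]
  intro k
  have hp : ∀ j, AnalyticAt K (fun t : Fin n → K => t j) t := fun j =>
    (ContinuousLinearMap.proj j : (Fin n → K) →L[K] K).analyticAt t
  unfold blowUpChart
  by_cases hk : k ∈ S ∧ k ≠ i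
  · simp only [hk, and_self, if_true, ne_eq, not_false_eq_true]
    exact (hp i).mul (hp k)
  · simp only [hk, if_false]
    exact hp k

end Tangent

/-! ### The closure of the torus zeros in adapted charts. -/

namespace AdaptedChart

variable {n l : ℕ} {K : Type*} [NontriviallyNormedField K]
  {M : Type*} [TopologicalSpace M] [ChartedSpace (Fin n → K) M]
  {Φ : M → Fin l → K} {Θ E : Set M}

theorem monomial_ne_zero (C : AdaptedChart n Φ Θ E) {q : M} (hq : q ∈ C.chart.source)
    (hΘ : q ∈ Θ) : ∏ j, C.chart q j ^ C.N j ≠ 0 := by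
  refine Finset.prod_ne_zero_iff.2 fun j _ => ?_
  by_cases hj : j ∈ C.T
  · exact pow_ne_zero _ ((C.mem_torus_iff q hq).1 hΘ j hj)
  · simp [C.N_eq_zero j hj]

theorem eq_zero_iff (C : AdaptedChart n Φ Θ E) {q : M} (hq : q ∈ C.chart.source) (hΘ : q ∈ Θ) :
    Φ q = 0 ↔ C.h q = 0 := by
  have h0 := C.monomial_ne_zero hq hΘ
  constructor
  · intro h
    funext i
    have := congrFun h i
    rw [C.factor q hq i] at this
    exact (mul_eq_zero.1 this).resolve_right h0
  · intro h
    funext i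
    rw [C.factor q hq i, h]
    simp

/-- Every point of an adapted chart is a limit of points of the torus with the same coordinates
outside of `T`. -/
theorem exists_curve (C : AdaptedChart n Φ Θ E) {q : M} (hq : q ∈ C.chart.source) :
    ∃ γ : K → M, Tendsto γ (𝓝[≠] 0) (𝓝 q) ∧ ∀ᶠ c in 𝓝[≠] (0 : K),
      γ c ∈ C.chart.source ∧ γ c ∈ Θ ∧ ∀ j ∉ C.T, C.chart (γ c) j = C.chart q j := by
  classical
  -- Only the vanishing coordinates with index in T are moved, to the value c; since c ≠ 0, this
  -- enters the torus.
  let v : Fin n → K := fun j => if j ∈ C.T ∧ C.chart q j = 0 then 1 else 0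
  let g : K → Fin n → K := fun c => C.chart q + c • v
  have hg : Tendsto g (𝓝 0) (𝓝 (C.chart q)) := by
    have : Continuous g := by fun_prop
    simpa [g] using this.tendsto 0
  have hsymm : Tendsto C.chart.symm (𝓝 (C.chart q)) (𝓝 q) := by
    simpa [C.chart.left_inv hq] using
      (C.chart.continuousAt_symm (C.chart.map_source hq)).tendsto
  have hg' := hg.mono_left (nhdsWithin_le_nhds (s := {0}ᶜ))
  refine ⟨fun c => C.chart.symm (g c), hsymm.comp hg', ?_⟩
  have hne : ∀ᶠ c in 𝓝 (0 : K), ∀ j, C.chart q j ≠ 0 → g c j ≠ 0 := by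
    rw [eventually_all]
    intro j
    by_cases hj : C.chart q j = 0
    · simp [hj]
    · have : Tendsto (fun c => g c j) (𝓝 0) (𝓝 (C.chart q j)) := (tendsto_pi_nhds.1 hg) j
      filter_upwards [this.eventually_ne hj] with c hc _ using hc
  filter_upwards [hg'.eventually (C.chart.open_target.mem_nhds (C.chart.map_source hq)),
    nhdsWithin_le_nhds hne, self_mem_nhdsWithin] with c hc hne hc0
  have hsrc := C.chart.map_target hc
  have hc0 : c ≠ 0 := hc0
  refine ⟨hsrc, ?_, ?_⟩
  · rw [C.mem_torus_iff _ hsrc, C.chart.right_inv hc]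
    intro j hj
    by_cases h0 : C.chart q j = 0
    · simp [g, v, hj, h0, hc0]
    · exact hne j h0
  · intro j hj
    rw [C.chart.right_inv hc]
    simp [g, v, hj]

variable (Φ Θ) in
/-- The closure of the common zeros in the torus. -/
abbrev zeroClosure : Set M := closure {q | q ∈ Θ ∧ Φ q = 0}

theorem continuousAt_h (C : AdaptedChart n Φ Θ E) {q : M} (hq : q ∈ C.chart.source) :
    ContinuousAt C.h q := (C.analytic q hq).continuousAt

/-- On the torus the monomial is nonzero, so Φ and h have the same zeros there, and h is continuous.
Conversely a zero of h can only occur in the second alternative of `alt`. There the components of h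
are coordinates outside T, which the curve of `exists_curve` leaves at zero. -/
theorem mem_zeroClosure_iff (C : AdaptedChart n Φ Θ E) {q : M} (hq : q ∈ C.chart.source) :
    q ∈ zeroClosure Φ Θ ↔ C.h q = 0 := by
  constructor
  · intro h
    by_contra h0
    rw [mem_closure_iff_frequently] at h
    obtain ⟨y, ⟨hyΘ, hy0⟩, hy1, hy2⟩ := (h.and_eventually
      (((C.continuousAt_h hq).eventually_ne h0).and
        (C.chart.open_source.mem_nhds hq))).exists
    exact hy1 ((C.eq_zero_iff hy2 hyΘ).1 hy0)
  · intro h0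
    obtain ⟨i, hi⟩ | ⟨s, -, hsT, hs⟩ := C.alt
    · exact absurd (congrFun h0 i) (hi q hq)
    · obtain ⟨γ, hγ, hev⟩ := C.exists_curve hq
      refine mem_closure_of_tendsto hγ ?_
      filter_upwards [hev] with c hc
      refine ⟨hc.2.1, (C.eq_zero_iff hc.1 hc.2.1).2 ?_⟩
      funext k
      rw [hs _ hc.1, hc.2.2 _ (hsT k), ← hs q hq, h0]

theorem exists_embedding (C : AdaptedChart n Φ Θ E) {q : M} (hq : q ∈ C.chart.source)
    (hZ : q ∈ zeroClosure Φ Θ) : ∃ s : Fin l ↪ Fin n, C.T.Nonempty ∧ (∀ k, s k ∉ C.T) ∧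
      ∀ q ∈ C.chart.source, ∀ k, C.h q k = C.chart q (s k) := by
  obtain ⟨i, hi⟩ | h := C.alt
  · exact absurd (congrFun ((C.mem_zeroClosure_iff hq).1 hZ) i) (hi q hq)
  · exact h

theorem isCoordinateSubspace (C : AdaptedChart n Φ Θ E) (s : Fin l ↪ Fin n)
    (hs : ∀ q ∈ C.chart.source, ∀ k, C.h q k = C.chart q (s k)) :
    IsCoordinateSubspace C.chart (Finset.univ.map s) (zeroClosure Φ Θ) := by
  intro q hq
  rw [C.mem_zeroClosure_iff hq]
  simp only [Finset.mem_map, Finset.mem_univ, true_and, forall_exists_index,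
    forall_apply_eq_imp_iff]
  simp only [← hs q hq, funext_iff, Pi.zero_apply]

theorem isSubmanifold (hgood : ∀ q : M, ∃ C : AdaptedChart n Φ Θ E, q ∈ C.chart.source) :
    IsSubmanifold n K (zeroClosure Φ Θ) l := by
  intro q hq
  obtain ⟨C, hC⟩ := hgood q
  obtain ⟨s, -, -, hs⟩ := C.exists_embedding hC hq
  exact ⟨C.chart, C.mem, hC, Finset.univ.map s, by simp, C.isCoordinateSubspace s hs⟩

theorem hasNormalCrossings (hgood : ∀ q : M, ∃ C : AdaptedChart n Φ Θ E, q ∈ C.chart.source) :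
    HasNormalCrossings n K (zeroClosure Φ Θ) E := by
  intro q hq
  obtain ⟨C, hC⟩ := hgood q
  obtain ⟨s, -, -, hs⟩ := C.exists_embedding hC hq
  exact ⟨C.chart, C.mem, hC, ⟨Finset.univ.map s, C.isCoordinateSubspace s hs⟩, C.exc⟩

/-- The l coordinates given by s avoid the nonempty set T. -/
theorem lt_of_mem_zeroClosure (C : AdaptedChart n Φ Θ E) {q : M} (hq : q ∈ C.chart.source)
    (hZ : q ∈ zeroClosure Φ Θ) : l < n := by
  obtain ⟨s, ⟨j, hj⟩, hsT, -⟩ := C.exists_embedding hq hZ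
  have hle : Fintype.card (Fin l) < Fintype.card (Fin n) :=
    Fintype.card_lt_of_injective_of_notMem s s.injective (b := j) (by
      rintro ⟨k, rfl⟩
      exact hsT k hj)
  simpa using hle

theorem analytic_coord (C : AdaptedChart n Φ Θ E) {q : M} (hq : q ∈ C.chart.source) (i : Fin l) :
    ContMDiffAt 𝓘(K, Fin n → K) 𝓘(K, K) ω (fun y => C.h y i) q := by
  have h2 : ContMDiffAt 𝓘(K, Fin l → K) 𝓘(K, K) ω (fun y : Fin l → K => y i) (C.h q) :=
    contMDiffAt_iff_contDiffAt.2 (contDiffAt_apply K K i _)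
  exact h2.comp q (C.analytic q hq)

variable [CompleteSpace K] [IsManifold 𝓘(K, Fin n → K) ω M]

/-- Off the closure some cofactor is a unit at q, so the common monomial generates the ideal. -/
theorem isPrincipalMonomialAt_of_notMem (C : AdaptedChart n Φ Θ E) {q : M}
    (hq : q ∈ C.chart.source) (hZ : q ∉ zeroClosure Φ Θ) :
    IsPrincipalMonomialAt n (fun i q => Φ q i) q := by
  rw [C.mem_zeroClosure_iff hq] at hZ
  obtain ⟨i, hi⟩ := Function.ne_iff.1 hZ
  refine isPrincipalMonomialAt_of_factor C.mem hq C.N (a := fun i q => C.h q i)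
    (fun i => C.analytic_coord hq i) (fun i => ?_) i hi
  filter_upwards [C.chart.open_source.mem_nhds hq] with y hy
  exact C.factor y hy i

/-- For l = 1 the only cofactor is a unit or a coordinate; in the second case it is absorbed into
the monomial. -/
theorem isPrincipalMonomialAt_of_eq_one (hl : l = 1) (C : AdaptedChart n Φ Θ E) {q : M}
    (hq : q ∈ C.chart.source) : IsPrincipalMonomialAt n (fun i q => Φ q i) q := by
  classical
  by_cases hZ : q ∈ zeroClosure Φ Θ
  · subst hl
    obtain ⟨s, -, hsT, hs⟩ := C.exists_embedding hq hZ
    refine isPrincipalMonomialAt_of_factor C.mem hq (C.N + Pi.single (s 0) 1)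
      (a := fun _ _ => 1) (fun i => contMDiffAt_const) (fun i => ?_) 0 one_ne_zero
    filter_upwards [C.chart.open_source.mem_nhds hq] with y hy
    rw [C.factor y hy i, hs y hy, Subsingleton.elim i 0]
    simp only [Pi.add_apply, pow_add, Finset.prod_mul_distrib, one_mul]
    rw [mul_comm]
    congr 1
    rw [Finset.prod_eq_single (s 0)] <;> simp +contextual
  · exact C.isPrincipalMonomialAt_of_notMem hq hZ

section BlowUp

variable {X : Type*} [TopologicalSpace X] [ChartedSpace (Fin n → K) X]
  [IsManifold 𝓘(K, Fin n → K) ω X]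

theorem isPrincipalMonomialAt_of_isLocalDiffeomorphAt (C : AdaptedChart n Φ Θ E) {π : X → M}
    {x : X} (hπ : IsLocalDiffeomorphAt 𝓘(K, Fin n → K) 𝓘(K, Fin n → K) ω π x)
    (hq : π x ∈ C.chart.source) (hZ : π x ∉ zeroClosure Φ Θ) :
    IsPrincipalMonomialAt n (fun i y => Φ (π y) i) x := by
  have hπa := hπ.contMDiffAt
  obtain ⟨Ψ, hx, heq⟩ := hπ
  rw [C.mem_zeroClosure_iff hq] at hZ
  obtain ⟨i, hi⟩ := Function.ne_iff.1 hZ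
  have hmem := partialDiffeomorph_trans_mem_coordinateSystems C.mem Ψ
  have hx' : x ∈ (Ψ.toOpenPartialHomeomorph.trans C.chart).source := by
    rw [OpenPartialHomeomorph.trans_source]
    refine ⟨hx, ?_⟩
    change Ψ x ∈ C.chart.source
    rwa [← heq hx]
  refine isPrincipalMonomialAt_of_factor hmem hx' C.N (a := fun i y => C.h (π y) i)
    (fun i => (C.analytic_coord hq i).comp x hπa) (fun i => ?_) i hi
  filter_upwards [Ψ.open_source.mem_nhds hx,
    hπa.continuousAt.eventually (C.chart.open_source.mem_nhds hq)] with y hy hy2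
  rw [C.factor _ hy2 i]
  congr 1
  refine Finset.prod_congr rfl fun j _ => ?_
  change _ = C.chart (Ψ y) j ^ _
  rw [heq hy]

end BlowUp

end AdaptedChart

/-! ### Principality after an arbitrary blowing-up. -/

namespace AdaptedChart

variable {n l : ℕ} {K : Type*} [NontriviallyNormedField K]
  {M : Type*} [TopologicalSpace M] [ChartedSpace (Fin n → K) M]
  {Φ : M → Fin l → K} {Θ E : Set M} [CompleteSpace K] [IsManifold 𝓘(K, Fin n → K) ω M]
  {X : Type*} [TopologicalSpace X] [ChartedSpace (Fin n → K) X]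
  [IsManifold 𝓘(K, Fin n → K) ω X]

/-- On the exceptional divisor of a blowing-up of the closure of the torus zeros, the pulled back
ideal is principal and monomial. -/
theorem isPrincipalMonomialAt_of_isStandardBlowUp (C : AdaptedChart n Φ Θ E) {π : X → M}
    {x : X} (hq : π x ∈ C.chart.source) (hZ : π x ∈ zeroClosure Φ Θ)
    {φ : OpenPartialHomeomorph M (Fin n → K)} (hφ : φ ∈ coordinateSystems n K M)
    (hxφ : π x ∈ φ.source) {S : Finset (Fin n)} (hS : IsCoordinateSubspace φ S (zeroClosure Φ Θ))
    (hbl : IsStandardBlowUp π φ S) :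
    IsPrincipalMonomialAt n (fun i y => Φ (π y) i) x := by
  classical
  obtain ⟨s, -, hsT, hs⟩ := C.exists_embedding hq hZ
  obtain ⟨ψ', hψ', hcov, -⟩ := hbl
  obtain ⟨i, hiS, hx⟩ := hcov x hxφ
  obtain ⟨hψ, hsrc, htgt, hπ⟩ := hψ' i hiS
  set ψ := ψ' i
  set χ := C.chart
  have hχ : χ ∈ coordinateSystems n K M := C.mem
  have hCS := C.isCoordinateSubspace s hs
  let B : (Fin n → K) → (Fin n → K) := blowUpChart S i
  set t₀ := ψ x with ht₀
  set u₀ := φ (π x) with hu₀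
  set w₀ := χ (π x) with hw₀
  have hB₀ : u₀ = B t₀ := hπ x hx
  have hu₀S : ∀ j ∈ S, u₀ j = 0 := (hS _ hxφ).1 hZ
  have hw₀s : ∀ k, w₀ (s k) = 0 := fun k => (hCS _ hq).1 hZ _ (by simp)
  have ht₀i : t₀ i = 0 := by
    have := hu₀S i hiS
    rw [hB₀] at this
    simpa [B, blowUpChart] using this
  -- the coordinate changes
  let ξ : (Fin n → K) → (Fin n → K) := χ ∘ φ.symm
  let ξ' : (Fin n → K) → (Fin n → K) := φ ∘ χ.symm
  have hξ : AnalyticAt K ξ u₀ := analyticAt_transition hφ hχ hxφ hq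
  have hξ' : AnalyticAt K ξ' w₀ := analyticAt_transition hχ hφ hq hxφ
  have hφs : Tendsto φ.symm (𝓝 u₀) (𝓝 (π x)) := tendsto_symm_of_mem_source hxφ
  have hχs : Tendsto χ.symm (𝓝 w₀) (𝓝 (π x)) := tendsto_symm_of_mem_source hq
  have hvan1 : ∀ᶠ u in 𝓝 u₀, (∀ j ∈ S, u j = 0) → ∀ k, ξ u (s k) = 0 := by
    filter_upwards [hφs.eventually (χ.open_source.mem_nhds hq),
      φ.open_target.mem_nhds (φ.map_source hxφ)] with u h1 h2 hu k
    have : φ.symm u ∈ zeroClosure Φ Θ := by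
      rw [hS _ (φ.map_target h2), φ.right_inv h2]
      exact hu
    exact (hCS _ h1).1 this _ (by simp)
  have hvan2 : ∀ᶠ w in 𝓝 w₀, (∀ j ∈ range s, w j = 0) → ∀ j ∈ (S : Set (Fin n)), ξ' w j = 0 := by
    filter_upwards [hχs.eventually (φ.open_source.mem_nhds hxφ),
      χ.open_target.mem_nhds (χ.map_source hq)] with w h1 h2 hw j hj
    have : χ.symm w ∈ zeroClosure Φ Θ := by
      rw [hCS _ (χ.map_target h2), χ.right_inv h2]
      intro j hj
      simp only [Finset.mem_map, Finset.mem_univ, true_and] at hj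
      exact hw j hj
    exact (hS _ h1).1 this _ hj
  set D := fderiv K ξ u₀ with hD
  set D' := fderiv K ξ' w₀ with hD'
  have hDD1 : ∀ v, D' (D v) = v := fderiv_transition_fderiv_transition hφ hχ hxφ hq
  have hDD2 : ∀ v, D (D' v) = v := fderiv_transition_fderiv_transition hχ hφ hq hxφ
  -- Both coordinate systems describe the same submanifold, so a vector tangent to it in the
  -- coordinates χ is tangent to it in the coordinates φ.
  have htan : ∀ v : Fin n → K, (∀ k, v (s k) = 0) → ∀ j ∈ S, D' v j = 0 := by
    intro v hv j hj
    refine fderiv_apply_eq_zero_of_mapsTo hξ'.differentiableAt (A := range s) (B := S) ?_ hvan2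
      ?_ hj
    · rintro _ ⟨k, rfl⟩
      exact hw₀s k
    · rintro _ ⟨k, rfl⟩
      exact hv k
  -- the functions `χ ∘ π` in the chart `ψ`
  let θ : (Fin n → K) → (Fin n → K) := ξ ∘ B
  have hBa : AnalyticAt K B t₀ := analyticAt_blowUpChart S i t₀
  have hθ : AnalyticAt K θ t₀ := by
    refine AnalyticAt.comp ?_ hBa
    rw [← hB₀]
    exact hξ
  have hθj : ∀ j, AnalyticAt K (fun t => θ t j) t₀ := analyticAt_pi_iff.1 hθ
  obtain ⟨DB, hDB, hDBv⟩ : ∃ DB : (Fin n → K) →L[K] (Fin n → K), HasFDerivAt B DB t₀ ∧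
      ∀ v k, DB v k = if k ∈ S ∧ k ≠ i then t₀ i * v k + t₀ k * v i else v k := by
    refine ⟨_, hasFDerivAt_blowUpChart S i t₀, fun v k => ?_⟩
    rw [ContinuousLinearMap.coe_pi']
    beta_reduce
    by_cases hk : k ∈ S ∧ k ≠ i
    · rw [if_pos hk, if_pos hk]; simp
    · rw [if_neg hk, if_neg hk]; simp
  have hθd : ∀ j v, fderiv K (fun t => θ t j) t₀ v = D (DB v) j := by
    intro j v
    have h1 : HasFDerivAt θ (D.comp DB) t₀ := by
      refine HasFDerivAt.comp t₀ ?_ hDB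
      rw [← hB₀]
      exact hξ.differentiableAt.hasFDerivAt
    rw [((hasFDerivAt_pi'.1 h1) j).fderiv]
    rfl
  -- The blow-up chart sends t i = 0 into the centre, where the functions χ (s k) vanish; hence
  -- their pull-backs are divisible by t i.
  have hfac : ∀ k, ∃ w : (Fin n → K) → K, AnalyticAt K w t₀ ∧
      ∀ᶠ t in 𝓝 t₀, θ t (s k) = t i * w t := by
    intro k
    refine AnalyticAt.exists_eq_coord_mul (hθj (s k)) i ht₀i ?_
    have hBt : Tendsto B (𝓝 t₀) (𝓝 u₀) := by
      rw [hB₀]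
      exact hBa.continuousAt.tendsto
    filter_upwards [hBt.eventually hvan1] with t ht hti
    refine ht (fun j hj => ?_) k
    by_cases hji : j = i
    · simp [B, blowUpChart, hji, hti]
    · simp [B, blowUpChart, hj, hji, hti]
  choose w hwa hw using hfac
  let ei : Fin n → K := Pi.single i 1
  have hwd : ∀ k, D (DB ei) (s k) = w k t₀ := by
    intro k
    rw [← hθd]
    have h1 : HasFDerivAt (fun t : Fin n → K => t i * w k t)
        (t₀ i • fderiv K (w k) t₀ + w k t₀ • (ContinuousLinearMap.proj i : (Fin n → K) →L[K] K))
        t₀ := (hasFDerivAt_apply i t₀).mul (hwa k).differentiableAt.hasFDerivAt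
    rw [(h1.congr_of_eventuallyEq (hw k)).fderiv]
    simp [ht₀i, ei]
  -- By the previous formula, if all quotients vanished at t₀, then `DB ei` would be tangent to the
  -- centre; but its component at i ∈ S is 1.
  obtain ⟨k₀, hk₀⟩ : ∃ k, w k t₀ ≠ 0 := by
    by_contra! hcon
    have h1 := htan (D (DB ei)) (fun k => by rw [hwd, hcon]) i hiS
    rw [hDD1, hDBv] at h1
    simp [ei] at h1
  -- the new coordinates
  let P : Finset (Fin n) := insert (s k₀) C.T
  -- The exceptional equation t i takes over the free index s k₀, while the coordinates in T, which
  -- carry the monomial, keep their indices.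
  let G : Fin n → (Fin n → K) → K := fun j t => if j = s k₀ then t i else θ t j
  have hG₀ : G (s k₀) = fun t => t i := by funext t; simp [G]
  have hGT : ∀ j ∈ C.T, G j = fun t => θ t j := by
    intro j hj
    have : j ≠ s k₀ := by rintro rfl; exact hsT k₀ hj
    funext t
    simp [G, this]
  have hproj : AnalyticAt K (fun t : Fin n → K => t i) t₀ :=
    (ContinuousLinearMap.proj i : (Fin n → K) →L[K] K).analyticAt t₀
  have hGa : ∀ j ∈ P, AnalyticAt K (G j) t₀ := by
    intro j hj
    rcases Finset.mem_insert.1 hj with rfl | hj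
    · rw [hG₀]; exact hproj
    · rw [hGT j hj]; exact hθj j
  have hind : LinearIndepOn K (fun j => fderiv K (G j) t₀) (P : Set (Fin n)) := by
    rw [linearIndepOn_finset_iff]
    intro c hc
    rw [Finset.sum_insert (hsT k₀)] at hc
    have hdi : fderiv K (G (s k₀)) t₀ = ContinuousLinearMap.proj i := by
      rw [hG₀]
      exact (hasFDerivAt_apply i t₀).fderiv
    have happ : ∀ v, c (s k₀) * v i + ∑ j ∈ C.T, c j * D (DB v) j = 0 := by
      intro v
      have := DFunLike.congr_fun hc v
      rw [hdi] at this
      simp only [add_apply, smul_apply, smul_eq_mul,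
        ContinuousLinearMap.proj_apply, sum_apply,
        zero_apply] at this
      rw [← this]
      congr 1
      refine Finset.sum_congr rfl fun j hj => ?_
      rw [hGT j hj, hθd]
    -- The test vector D' (e_j) is tangent to the centre. Its components in S vanish and t₀ i = 0,
    -- so DB fixes it; its i-th component is zero, and D returns e_j, which isolates c j.
    have hT : ∀ j ∈ C.T, c j = 0 := by
      intro j hj
      let z : Fin n → K := Pi.single j 1
      have hz : ∀ k, z (s k) = 0 := by
        intro k
        have : s k ≠ j := by rintro rfl; exact hsT k hj
        simp [z, this]
      have hvS := htan z hz
      have hDBz : DB (D' z) = D' z := by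
        funext k
        rw [hDBv]
        split_ifs with h
        · rw [ht₀i, hvS i hiS, hvS k h.1]; simp
        · rfl
      have := happ (D' z)
      rw [hDBz, hDD2, hvS i hiS, mul_zero, zero_add, Finset.sum_eq_single j] at this
      · simpa [z] using this
      · intro j' _ hj'
        simp [z, hj']
      · exact fun h => absurd hj h
    intro j hj
    rcases Finset.mem_insert.1 hj with rfl | hj
    · have := happ ei
      rw [Finset.sum_eq_zero (fun j hj => by rw [hT j hj, zero_mul]), add_zero] at this
      simpa [ei] using this
    · exact hT j hj
  -- Continuity of π is not part of `IsStandardBlowUp`; it is recovered from the coordinate formula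
  -- φ⁻¹ ∘ B ∘ ψ.
  have hπc : ContinuousAt π x := by
    have hBt : Tendsto (fun y => φ.symm (B (ψ y))) (𝓝 x) (𝓝 (π x)) := by
      refine hφs.comp ?_
      rw [hB₀]
      exact hBa.continuousAt.tendsto.comp (ψ.continuousAt hx).tendsto
    refine hBt.congr' ?_
    filter_upwards [ψ.open_source.mem_nhds hx] with y hy
    change φ.symm (blowUpChart S i (ψ y)) = π y
    rw [← hπ y hy, φ.left_inv (hsrc hy)]
  have hOmem : ∀ᶠ y in 𝓝 x, π y ∈ χ.source ∧ ∀ k, θ (ψ y) (s k) = ψ y i * w k (ψ y) := by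
    refine (hπc.eventually (χ.open_source.mem_nhds hq)).and ?_
    exact (ψ.continuousAt hx).eventually (eventually_all.2 hw)
  obtain ⟨χ', hχ', hxχ', hχψ, hχO, hχG⟩ :=
    exists_coordinateSystem_extending hψ hx P G hGa hind hOmem
  refine isPrincipalMonomialAt_of_factor hχ' hxχ'
    (fun j => if j = s k₀ then 1 else C.N j) (a := fun k y => w k (ψ y)) (fun k => ?_)
    (fun k => ?_) k₀ hk₀
  · rw [contMDiffAt_iff_analyticAt hψ hx]
    refine (hwa k).congr ?_
    filter_upwards [ψ.open_target.mem_nhds (ψ.map_source hx)] with t ht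
    simp [ψ.right_inv ht]
  · filter_upwards [χ'.open_source.mem_nhds hxχ'] with y hy
    have hyψ := hχψ hy
    obtain ⟨hyχ, hyw⟩ := hχO hy
    have hθy : θ (ψ y) = χ (π y) := by
      simp only [θ, ξ, Function.comp_apply]
      change χ (φ.symm (blowUpChart S i (ψ y))) = _
      rw [← hπ y hyψ, φ.left_inv (hsrc hyψ)]
    have e1 : ∏ j, χ' y j ^ (if j = s k₀ then 1 else C.N j) =
        ψ y i * ∏ j, χ (π y) j ^ C.N j := by
      have hsub : ∀ j ∉ P, (if j = s k₀ then 1 else C.N j) = 0 := by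
        intro j hj
        simp only [P, Finset.mem_insert, not_or] at hj
        rw [if_neg hj.1, C.N_eq_zero j hj.2]
      rw [← Finset.prod_subset (Finset.subset_univ P)
        (fun j _ hj => by rw [hsub j hj, pow_zero]), Finset.prod_insert (hsT k₀),
        if_pos rfl, pow_one, hχG _ (Finset.mem_insert_self _ _) y hy, hG₀]
      congr 1
      rw [← Finset.prod_subset (Finset.subset_univ C.T)
        (fun j _ hj => by rw [C.N_eq_zero j hj, pow_zero])]
      refine Finset.prod_congr rfl fun j hj => ?_
      have hne : j ≠ s k₀ := by rintro rfl; exact hsT k₀ hj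
      rw [if_neg hne, hχG j (Finset.mem_insert_of_mem hj) y hy, hGT j hj]
      beta_reduce
      rw [hθy]
    rw [e1, C.factor _ hyχ k, hs _ hyχ k]
    change χ (π y) (s k) * _ = _
    rw [← hθy, hyw k, hθy]
    ring

theorem isPrincipalMonomialAt_of_isBlowUp
    (hgood : ∀ q : M, ∃ C : AdaptedChart n Φ Θ E, q ∈ C.chart.source) {π : X → M}
    (hπ : IsBlowUp n K π (zeroClosure Φ Θ)) (x : X) :
    IsPrincipalMonomialAt n (fun i y => Φ (π y) i) x := by
  obtain ⟨C, hC⟩ := hgood (π x)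
  by_cases hZ : π x ∈ zeroClosure Φ Θ
  · obtain ⟨φ, hφ, hxφ, S, hS, hbl⟩ := hπ.2.2 _ hZ
    exact C.isPrincipalMonomialAt_of_isStandardBlowUp hC hZ hφ hxφ hS hbl
  · exact C.isPrincipalMonomialAt_of_isLocalDiffeomorphAt (hπ.2.1 x hZ) hC hZ

end AdaptedChart

/-! ### Construction of the blowing-up -/

section Projective

variable {l : ℕ} {K : Type*} [Field K]

/-- The affine coordinates of a point of projective space. -/
def affineCoord (L : Projectivization K (Fin l → K)) (i k : Fin l) : K := L.rep k / L.rep i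

theorem rep_mk_ne_zero_iff {v : Fin l → K} (hv : v ≠ 0) (i : Fin l) :
    (Projectivization.mk K v hv).rep i ≠ 0 ↔ v i ≠ 0 := by
  obtain ⟨a, ha⟩ := Projectivization.exists_smul_eq_mk_rep K v hv
  rw [← ha]
  simp [Units.smul_def]

theorem affineCoord_mk {v : Fin l → K} (hv : v ≠ 0) (i k : Fin l) :
    affineCoord (Projectivization.mk K v hv) i k = v k / v i := by
  obtain ⟨a, ha⟩ := Projectivization.exists_smul_eq_mk_rep K v hv
  unfold affineCoord
  rw [← ha]
  simp only [Units.smul_def, Pi.smul_apply, smul_eq_mul]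
  exact mul_div_mul_left _ _ a.ne_zero

theorem affineCoord_self {L : Projectivization K (Fin l → K)} {i : Fin l} (hi : L.rep i ≠ 0) :
    affineCoord L i i = 1 := div_self hi

theorem affineCoord_ne_zero {L : Projectivization K (Fin l → K)} {i : Fin l} (hi : L.rep i ≠ 0) :
    affineCoord L i ≠ 0 := fun h => one_ne_zero ((affineCoord_self hi).symm.trans (congrFun h i))

theorem mk_affineCoord {L : Projectivization K (Fin l → K)} {i : Fin l} (hi : L.rep i ≠ 0) :
    Projectivization.mk K (affineCoord L i) (affineCoord_ne_zero hi) = L := by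
  conv_rhs => rw [← L.mk_rep]
  rw [Projectivization.mk_eq_mk_iff']
  refine ⟨(L.rep i)⁻¹, ?_⟩
  funext k
  simp [affineCoord, div_eq_inv_mul]

theorem mem_submodule_iff_affineCoord {L : Projectivization K (Fin l → K)} {i : Fin l}
    (hi : L.rep i ≠ 0) {g : Fin l → K} : g ∈ L.submodule ↔ ∃ c : K, g = c • affineCoord L i := by
  conv_lhs => rw [← mk_affineCoord hi, Projectivization.submodule_mk, Submodule.mem_span_singleton]
  simp only [eq_comm]

end Projective

/-- The pairs of a point of `M` and a line containing the vector `d q`. -/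
@[ext]
structure IncidenceSpace {M K : Type*} {l : ℕ} [Field K] (d : M → Fin l → K) where
  pt : M
  line : Projectivization K (Fin l → K)
  mem : d pt ∈ line.submodule

/-! ### Charts of the incidence space. -/

section Cells

variable {n l : ℕ} {K : Type*} [NontriviallyNormedField K]
  {M : Type*} [TopologicalSpace M] [ChartedSpace (Fin n → K) M]

/-- A chart of the incidence space: the point with coordinates `t` lies over the point of `M` with
coordinates `R t` and is the line spanned by `v t`. -/
structure IncidenceCell (n : ℕ) {l : ℕ} {K : Type*} [NontriviallyNormedField K]
    {M : Type*} [TopologicalSpace M] [ChartedSpace (Fin n → K) M] (d : M → Fin l → K) where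
  base : IncidenceSpace d
  φ : OpenPartialHomeomorph M (Fin n → K)
  mem : φ ∈ coordinateSystems n K M
  h : M → Fin l → K
  h_eq : ∀ q ∈ φ.source, ∃ u : K, u ≠ 0 ∧ h q = u • d q
  i : Fin l
  enc : (Fin n → K) → (Fin l → K) → (Fin n → K)
  R : (Fin n → K) → (Fin n → K)
  v : (Fin n → K) → (Fin l → K)
  analyticAt_R : ∀ t, AnalyticAt K R t
  analyticAt_v : ∀ t, R t ∈ φ.target → AnalyticAt K v t
  analyticAt_enc : ∀ p, AnalyticAt K (fun p : (Fin n → K) × (Fin l → K) => enc p.1 p.2) p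
  v_i : ∀ t, R t ∈ φ.target → v t i = 1
  enc_R_v : ∀ t, R t ∈ φ.target → enc (R t) (v t) = t
  dir : ∀ t, R t ∈ φ.target → ∃ c : K, h (φ.symm (R t)) = c • v t
  R_enc : ∀ q ∈ φ.source, ∀ lam : Fin l → K, lam i = 1 → (∃ c : K, h q = c • lam) →
    R (enc (φ q) lam) = φ q ∧ v (enc (φ q) lam) = lam

namespace IncidenceCell

variable {d : M → Fin l → K}

theorem v_ne_zero (c : IncidenceCell n d) {t : Fin n → K} (ht : c.R t ∈ c.φ.target) :
    c.v t ≠ 0 := fun h => one_ne_zero ((c.v_i t ht).symm.trans (congrFun h c.i))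

theorem d_mem (c : IncidenceCell n d) {t : Fin n → K} (ht : c.R t ∈ c.φ.target) :
    d (c.φ.symm (c.R t)) ∈ (Projectivization.mk K (c.v t) (c.v_ne_zero ht)).submodule := by
  rw [Projectivization.submodule_mk, Submodule.mem_span_singleton]
  obtain ⟨u, hu, hu'⟩ := c.h_eq _ (c.φ.map_target ht)
  obtain ⟨a, ha⟩ := c.dir t ht
  refine ⟨u⁻¹ * a, ?_⟩
  rw [mul_smul, ← ha, hu', smul_smul, inv_mul_cancel₀ hu, one_smul]

theorem h_eq_smul (c : IncidenceCell n d) (x : IncidenceSpace d) (hx : x.pt ∈ c.φ.source)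
    (hi : x.line.rep c.i ≠ 0) : ∃ a : K, c.h x.pt = a • affineCoord x.line c.i := by
  obtain ⟨u, -, hu'⟩ := c.h_eq _ hx
  obtain ⟨a, ha⟩ := (mem_submodule_iff_affineCoord hi).1 x.mem
  exact ⟨u * a, by rw [hu', ha, smul_smul]⟩

open Classical in
/-- The point with coordinates `t`. -/
def point (c : IncidenceCell n d) (t : Fin n → K) : IncidenceSpace d :=
  -- Outside the target the value is irrelevant; `base` only makes the function total.
  if ht : c.R t ∈ c.φ.target then
    ⟨c.φ.symm (c.R t), Projectivization.mk K (c.v t) (c.v_ne_zero ht), c.d_mem ht⟩ else c.base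

theorem point_eq (c : IncidenceCell n d) {t : Fin n → K} (ht : c.R t ∈ c.φ.target) :
    c.point t = ⟨c.φ.symm (c.R t), Projectivization.mk K (c.v t) (c.v_ne_zero ht),
      c.d_mem ht⟩ := dif_pos ht

/-- The chart of a cell. -/
def equiv (c : IncidenceCell n d) : PartialEquiv (IncidenceSpace d) (Fin n → K) where
  toFun x := c.enc (c.φ x.pt) (affineCoord x.line c.i)
  invFun t := c.point t
  source := {x | x.pt ∈ c.φ.source ∧ x.line.rep c.i ≠ 0}
  target := {t | c.R t ∈ c.φ.target}
  map_source' := by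
    rintro x ⟨hx, hi⟩
    change c.R _ ∈ c.φ.target
    rw [(c.R_enc _ hx _ (affineCoord_self hi) (c.h_eq_smul x hx hi)).1]
    exact c.φ.map_source hx
  map_target' := by
    intro t ht
    rw [c.point_eq ht]
    refine ⟨c.φ.map_target ht, ?_⟩
    rw [rep_mk_ne_zero_iff, c.v_i t ht]
    exact one_ne_zero
  left_inv' := by
    rintro x ⟨hx, hi⟩
    obtain ⟨h1, h2⟩ := c.R_enc _ hx _ (affineCoord_self hi) (c.h_eq_smul x hx hi)
    have ht : c.R (c.enc (c.φ x.pt) (affineCoord x.line c.i)) ∈ c.φ.target := by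
      rw [h1]
      exact c.φ.map_source hx
    rw [c.point_eq ht]
    ext1
    · simp only [h1, c.φ.left_inv hx]
    · simp only [h2, mk_affineCoord hi]
  right_inv' := by
    intro t ht
    rw [c.point_eq ht]
    have ht' : c.R t ∈ c.φ.target := ht
    have e : affineCoord (Projectivization.mk K (c.v t) (c.v_ne_zero ht)) c.i = c.v t := by
      funext k
      rw [affineCoord_mk, c.v_i t ht, div_one]
    simp only [c.φ.right_inv ht', e, c.enc_R_v t ht]

theorem equiv_symm_apply (c : IncidenceCell n d) {t : Fin n → K} (ht : c.R t ∈ c.φ.target) :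
    c.equiv.symm t = ⟨c.φ.symm (c.R t), Projectivization.mk K (c.v t) (c.v_ne_zero ht),
      c.d_mem ht⟩ := c.point_eq ht

theorem transition_source (c c' : IncidenceCell n d) :
    (c.equiv.symm.trans c'.equiv).source =
      {t | c.R t ∈ c.φ.target ∧ c.φ.symm (c.R t) ∈ c'.φ.source ∧ c.v t c'.i ≠ 0} := by
  ext t
  rw [PartialEquiv.trans_source]
  constructor
  · rintro ⟨h1, h2⟩
    have h1 : c.R t ∈ c.φ.target := h1
    have h2 : c.equiv.symm t ∈ c'.equiv.source := h2
    rw [c.equiv_symm_apply h1] at h2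
    exact ⟨h1, h2.1, (rep_mk_ne_zero_iff _ _).1 h2.2⟩
  · rintro ⟨h1, h2, h3⟩
    refine ⟨h1, ?_⟩
    change c.equiv.symm t ∈ c'.equiv.source
    rw [c.equiv_symm_apply h1]
    exact ⟨h2, (rep_mk_ne_zero_iff _ _).2 h3⟩

variable [CompleteSpace K] [IsManifold 𝓘(K, Fin n → K) ω M]

/-- The transition is t ↦ enc' (φ' (φ⁻¹ (R t)), v t / v t i'): the point is expressed in the new
coordinates and the spanning vector is renormalised at the new index. The conditions defining its
source are open. -/
theorem transition_analyticAt (c c' : IncidenceCell n d) {t : Fin n → K}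
    (ht : t ∈ (c.equiv.symm.trans c'.equiv).source) :
    (c.equiv.symm.trans c'.equiv).source ∈ 𝓝 t ∧
      AnalyticAt K (c.equiv.symm.trans c'.equiv) t := by
  rw [transition_source] at ht ⊢
  obtain ⟨h1, h2, h3⟩ := ht
  have hR := (c.analyticAt_R t)
  have hv := c.analyticAt_v t h1
  have hvi : ∀ k, AnalyticAt K (fun t => c.v t k) t := analyticAt_pi_iff.1 hv
  have hsymm : ContinuousAt (fun t => c.φ.symm (c.R t)) t :=
    ContinuousAt.comp (f := c.R) (c.φ.continuousAt_symm h1) hR.continuousAt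
  have hnhds : ∀ᶠ s in 𝓝 t,
      c.R s ∈ c.φ.target ∧ c.φ.symm (c.R s) ∈ c'.φ.source ∧ c.v s c'.i ≠ 0 :=
    (hR.continuousAt.eventually (c.φ.open_target.mem_nhds h1)).and
      ((hsymm.eventually (c'.φ.open_source.mem_nhds h2)).and
        ((hvi c'.i).continuousAt.eventually_ne h3))
  refine ⟨hnhds, ?_⟩
  have hfirst : AnalyticAt K (fun t => c'.φ (c.φ.symm (c.R t))) t := by
    have := analyticAt_transition c.mem c'.mem (c.φ.map_target h1) h2
    rw [c.φ.right_inv h1] at this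
    exact AnalyticAt.comp (f := c.R) this hR
  have hsecond : AnalyticAt K (fun t => fun k => c.v t k / c.v t c'.i) t :=
    analyticAt_pi_iff.2 fun k => (hvi k).div (hvi c'.i) h3
  have hcomp := AnalyticAt.comp (f := fun t => (c'.φ (c.φ.symm (c.R t)),
    fun k => c.v t k / c.v t c'.i)) (c'.analyticAt_enc _) (hfirst.prod hsecond)
  refine hcomp.congr ?_
  filter_upwards [hnhds] with s hs
  change _ = c'.equiv (c.equiv.symm s)
  rw [c.equiv_symm_apply hs.1]
  change _ = c'.enc _ (affineCoord (Projectivization.mk K (c.v s) _) c'.i)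
  simp only [Function.comp_apply]
  congr 1
  funext k
  rw [affineCoord_mk]

/-- The cells of the incidence space form an atlas, if they cover it. -/
def core (hcov : ∀ x : IncidenceSpace d, ∃ c : IncidenceCell n d, x ∈ c.equiv.source) :
    ChartedSpaceCore (Fin n → K) (IncidenceSpace d) where
  atlas := range equiv
  chartAt x := (Classical.choose (hcov x)).equiv
  mem_chart_source x := Classical.choose_spec (hcov x)
  chart_mem_atlas x := mem_range_self _
  open_source := by
    rintro _ _ ⟨c, rfl⟩ ⟨c', rfl⟩
    exact isOpen_iff_mem_nhds.2 fun t ht => (transition_analyticAt c c' ht).1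
  continuousOn_toFun := by
    rintro _ _ ⟨c, rfl⟩ ⟨c', rfl⟩
    exact fun t ht => (transition_analyticAt c c' ht).2.continuousAt.continuousWithinAt

theorem core_isManifold
    (hcov : ∀ x : IncidenceSpace d, ∃ c : IncidenceCell n d, x ∈ c.equiv.source) :
    @IsManifold K _ (Fin n → K) _ _ (Fin n → K) _ 𝓘(K, Fin n → K) ω (IncidenceSpace d)
      (core hcov).toTopologicalSpace (core hcov).toChartedSpace := by
  let _ := (core hcov).toTopologicalSpace
  let _ := (core hcov).toChartedSpace
  apply isManifold_of_contDiffOn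
  intro e e' he he'
  change e ∈ ⋃ (e : PartialEquiv _ _) (he : e ∈ (core hcov).atlas), _ at he
  change e' ∈ ⋃ (e : PartialEquiv _ _) (he : e ∈ (core hcov).atlas), _ at he'
  simp only [mem_iUnion, mem_singleton_iff] at he he'
  obtain ⟨_, ⟨c, rfl⟩, rfl⟩ := he
  obtain ⟨_, ⟨c', rfl⟩, rfl⟩ := he'
  have : ContDiffOn K ω (c.equiv.symm.trans c'.equiv) (c.equiv.symm.trans c'.equiv).source :=
    fun t ht => (transition_analyticAt c c' ht).2.contDiffAt.contDiffWithinAt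
  simpa using! this

end IncidenceCell

end Cells

/-! ### Comparison of adapted charts, and the cells they provide. -/

namespace AdaptedChart

variable {n l : ℕ} {K : Type*} [NontriviallyNormedField K]
  {M : Type*} [TopologicalSpace M] [ChartedSpace (Fin n → K) M]
  {Φ : M → Fin l → K} {Θ E : Set M}

/-- The cofactors of two adapted charts differ by a nonzero factor. -/
theorem exists_h_eq_smul (C C' : AdaptedChart n Φ Θ E) {q : M} (hq : q ∈ C.chart.source)
    (hq' : q ∈ C'.chart.source) : ∃ u : K, u ≠ 0 ∧ C'.h q = u • C.h q := by
  have hiff : C.h q = 0 ↔ C'.h q = 0 := by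
    rw [← C.mem_zeroClosure_iff hq, ← C'.mem_zeroClosure_iff hq']
  by_cases h0 : C.h q = 0
  · exact ⟨1, one_ne_zero, by rw [h0, hiff.1 h0, smul_zero]⟩
  obtain ⟨i, hi⟩ := Function.ne_iff.1 h0
  -- On the torus both cofactor vectors are multiples of Φ by nonzero scalars, so the minors vanish;
  -- continuity along a curve from the torus carries this to q.
  have hcross : ∀ k, C.h q i * C'.h q k = C.h q k * C'.h q i := by
    intro k
    obtain ⟨γ, hγ, hev⟩ := C.exists_curve hq
    have hc := fun j => ((continuousAt_apply j _).comp (C.continuousAt_h hq)).tendsto.comp hγ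
    have hc' := fun j => ((continuousAt_apply j _).comp (C'.continuousAt_h hq')).tendsto.comp hγ
    refine tendsto_nhds_unique ((hc i).mul (hc' k)) (((hc k).mul (hc' i)).congr' ?_)
    filter_upwards [hev, hγ.eventually (C'.chart.open_source.mem_nhds hq')] with c hc hc2
    have m1 := C.monomial_ne_zero hc.1 hc.2.1
    have m2 := C'.monomial_ne_zero hc2 hc.2.1
    have e1 := C.factor _ hc.1
    have e2 := C'.factor _ hc2
    simp only [Function.comp_apply]
    apply mul_right_cancel₀ (mul_ne_zero m1 m2)
    calc C.h (γ c) k * C'.h (γ c) i * ((∏ j, C.chart (γ c) j ^ C.N j) *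
          ∏ j, C'.chart (γ c) j ^ C'.N j) = Φ (γ c) k * Φ (γ c) i := by
          rw [e1 k, e2 i]; ring
      _ = Φ (γ c) i * Φ (γ c) k := mul_comm _ _
      _ = _ := by rw [e1 i, e2 k]; ring
  have hi : C.h q i ≠ 0 := hi
  have heq : C'.h q = (C'.h q i / C.h q i) • C.h q := by
    funext k
    rw [Pi.smul_apply, smul_eq_mul, div_mul_eq_mul_div, eq_div_iff hi, mul_comm, hcross k, mul_comm]
  refine ⟨C'.h q i / C.h q i, ?_, heq⟩
  intro hz
  rw [hz, zero_smul] at heq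
  exact h0 (hiff.2 heq)

/-- The vector d q is chosen point by point, without continuity. Only the line it spans and its
vanishing matter, and these are the same for all adapted charts. -/
theorem exists_direction (hgood : ∀ q : M, ∃ C : AdaptedChart n Φ Θ E, q ∈ C.chart.source) :
    ∃ d : M → Fin l → K, ∀ (C : AdaptedChart n Φ Θ E), ∀ q ∈ C.chart.source,
      ∃ u : K, u ≠ 0 ∧ C.h q = u • d q := by
  choose C hC using hgood
  exact ⟨fun q => (C q).h q, fun C' q hq => (C q).exists_h_eq_smul C' (hC q) hq⟩

variable [CompleteSpace K] {d : M → Fin l → K}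

/-- The cells of the incidence space over a chart in which the zero set is a coordinate
subspace. -/
def coordCell (C : AdaptedChart n Φ Θ E) (s : Fin l ↪ Fin n)
    (hs : ∀ q ∈ C.chart.source, ∀ k, C.h q k = C.chart q (s k))
    (hd : ∀ q ∈ C.chart.source, ∃ u : K, u ≠ 0 ∧ C.h q = u • d q)
    (i : Fin l) (base : IncidenceSpace d) : IncidenceCell n d where
  base := base
  φ := C.chart
  mem := C.mem
  h := C.h
  h_eq := hd
  i := i
  -- This inverts the standard blow-up chart: u (s i) is kept, the other u (s k) are replaced by the
  -- slopes lam k, and the coordinates along the centre are kept.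
  enc u lam j := if j = s i then u j else Function.extend s lam u j
  R := blowUpChart (Finset.univ.map s) (s i)
  v t k := if k = i then 1 else t (s k)
  analyticAt_R t := analyticAt_blowUpChart _ _ t
  analyticAt_v t _ := by
    rw [analyticAt_pi_iff]
    intro k
    by_cases hk : k = i
    · simp only [hk, if_true]
      exact analyticAt_const
    · simp only [hk, if_false]
      exact (ContinuousLinearMap.proj (s k) : (Fin n → K) →L[K] K).analyticAt t
  analyticAt_enc p := by
    rw [analyticAt_pi_iff]
    intro j
    have h1 : AnalyticAt K (fun p : (Fin n → K) × (Fin l → K) => p.1 j) p :=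
      ((ContinuousLinearMap.proj j : (Fin n → K) →L[K] K).comp
        (ContinuousLinearMap.fst K _ _)).analyticAt p
    by_cases hj : j = s i
    · simp only [hj, if_true]
      rwa [hj] at h1
    · simp only [hj, if_false]
      by_cases hjs : ∃ k, s k = j
      · obtain ⟨k, rfl⟩ := hjs
        simp only [s.injective.extend_apply]
        exact ((ContinuousLinearMap.proj k : (Fin l → K) →L[K] K).comp
          (ContinuousLinearMap.snd K _ _)).analyticAt p
      · simp only [Function.extend_apply' _ _ _ hjs]
        exact h1
  v_i t _ := if_pos rfl
  enc_R_v t _ := by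
    funext j
    by_cases hj : j = s i
    · simp [hj, blowUpChart]
    · simp only [hj, if_false]
      by_cases hjs : ∃ k, s k = j
      · obtain ⟨k, rfl⟩ := hjs
        have : k ≠ i := by rintro rfl; exact hj rfl
        simp [s.injective.extend_apply, this]
      · rw [Function.extend_apply' _ _ _ hjs]
        have : j ∉ Finset.univ.map s := by simpa using hjs
        simp [blowUpChart, this]
  dir t ht := by
    refine ⟨t (s i), ?_⟩
    funext k
    rw [hs _ (C.chart.map_target ht), C.chart.right_inv ht]
    by_cases hk : k = i
    · simp [hk, blowUpChart]
    · simp [hk, blowUpChart]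
  R_enc q hq lam hlam hc := by
    obtain ⟨c, hc⟩ := hc
    have hcs : ∀ k, C.chart q (s k) = c * lam k := by
      intro k
      rw [← hs q hq k, hc]
      rfl
    constructor
    · funext j
      by_cases hjs : ∃ k, s k = j
      · obtain ⟨k, rfl⟩ := hjs
        by_cases hk : k = i
        · simp [hk, blowUpChart]
        · simp [hk, blowUpChart, s.injective.extend_apply, hcs, hlam]
      · have h1 : j ∉ Finset.univ.map s := by simpa using hjs
        have h2 : j ≠ s i := fun h => hjs ⟨i, h.symm⟩
        simp [blowUpChart, h1, h2, Function.extend_apply' _ _ _ hjs]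
    · funext k
      by_cases hk : k = i
      · simp [hk, hlam]
      · simp [hk, s.injective.extend_apply]

variable [IsManifold 𝓘(K, Fin n → K) ω M]

/-- The cell of the incidence space over an open set where a cofactor does not vanish. -/
def openCell (C : AdaptedChart n Φ Θ E)
    (hd : ∀ q ∈ C.chart.source, ∃ u : K, u ≠ 0 ∧ C.h q = u • d q)
    (i : Fin l) {O : Set M} (hO : IsOpen O) (hi : ∀ q ∈ O, C.h q i ≠ 0)
    (base : IncidenceSpace d) : IncidenceCell n d where
  base := base
  φ := C.chart.restrOpen O hO
  mem := restrOpen_mem_coordinateSystems C.mem hO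
  h := C.h
  h_eq q hq := hd q (by rw [OpenPartialHomeomorph.restrOpen_source] at hq; exact hq.1)
  i := i
  enc u _ := u
  R t := t
  v t k := C.h (C.chart.symm t) k / C.h (C.chart.symm t) i
  analyticAt_R t := analyticAt_id
  analyticAt_v t ht := by
    have hq := (C.chart.restrOpen O hO).map_target ht
    rw [OpenPartialHomeomorph.restrOpen_source] at hq
    have ht' : t ∈ C.chart.target := by
      have := (C.chart.restrOpen O hO).right_inv ht
      rw [← this]
      exact C.chart.map_source hq.1
    have hk : ∀ k, AnalyticAt K (fun t => C.h (C.chart.symm t) k) t := by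
      intro k
      have := (contMDiffAt_iff_analyticAt C.mem hq.1).1 (C.analytic_coord hq.1 k)
      change AnalyticAt K _ (C.chart (C.chart.symm t)) at this
      rw [C.chart.right_inv ht'] at this
      exact this
    exact analyticAt_pi_iff.2 fun k => (hk k).div (hk i) (hi _ hq.2)
  analyticAt_enc p := analyticAt_fst
  v_i t ht := by
    have hq := (C.chart.restrOpen O hO).map_target ht
    rw [OpenPartialHomeomorph.restrOpen_source] at hq
    exact div_self (hi _ hq.2)
  enc_R_v _ _ := rfl
  dir t ht := by
    have hq := (C.chart.restrOpen O hO).map_target ht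
    rw [OpenPartialHomeomorph.restrOpen_source] at hq
    refine ⟨C.h (C.chart.symm t) i, ?_⟩
    funext k
    exact (mul_div_cancel₀ _ (hi _ hq.2)).symm
  R_enc q hq lam hlam hc := by
    refine ⟨rfl, ?_⟩
    rw [OpenPartialHomeomorph.restrOpen_source] at hq
    obtain ⟨c, hc⟩ := hc
    funext k
    change C.h (C.chart.symm (C.chart q)) k / C.h (C.chart.symm (C.chart q)) i = _
    have h0 := hi _ hq.2
    rw [C.chart.left_inv hq.1]
    rw [hc] at h0 ⊢
    simp only [Pi.smul_apply, smul_eq_mul, hlam, mul_one] at h0 ⊢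
    field_simp

end AdaptedChart

/-! ### Existence of the blowing-up. -/

namespace AdaptedChart

variable {n l : ℕ} {K : Type u} [NontriviallyNormedField K] [CompleteSpace K]
  {M : Type u} [TopologicalSpace M] [ChartedSpace (Fin n → K) M]
  [IsManifold 𝓘(K, Fin n → K) ω M] {Φ : M → Fin l → K} {Θ E : Set M}

/-- Around a point outside of the zero set there is a cell which is isomorphic to an open subset
of `M`. -/
theorem exists_openCell (C : AdaptedChart n Φ Θ E) {d : M → Fin l → K}
    (hd : ∀ q ∈ C.chart.source, ∃ u : K, u ≠ 0 ∧ C.h q = u • d q)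
    {x : IncidenceSpace d} (hx : x.pt ∈ C.chart.source) (h0 : C.h x.pt ≠ 0) :
    ∃ c : IncidenceCell n d, x ∈ c.equiv.source ∧ c.equiv.target = c.φ.target ∧
      ∀ y ∈ c.equiv.source, y.pt ∈ c.φ.source ∧ c.equiv y = c.φ y.pt := by
  obtain ⟨i, hi⟩ := Function.ne_iff.1 h0
  have hev : ∀ᶠ q in 𝓝 x.pt, C.h q i ≠ 0 :=
    (C.analytic_coord hx i).continuousAt.eventually_ne hi
  obtain ⟨O, hO, hOo, hxO⟩ := eventually_nhds_iff.1 hev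
  let c := C.openCell hd i hOo hO x
  have hxφ : x.pt ∈ c.φ.source := by
    change x.pt ∈ (C.chart.restrOpen O hOo).source
    rw [OpenPartialHomeomorph.restrOpen_source]
    exact ⟨hx, hxO⟩
  refine ⟨c, ⟨hxφ, ?_⟩, rfl, fun y hy => ⟨hy.1, rfl⟩⟩
  have hmem := x.mem
  rw [Projectivization.submodule_eq, Submodule.mem_span_singleton] at hmem
  obtain ⟨a, ha⟩ := hmem
  obtain ⟨u, -, hu⟩ := hd _ hx
  intro hz
  have hz : x.line.rep i = 0 := hz
  apply hi
  rw [hu, ← ha]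
  simp [hz]

/-- Over the zero set a line is covered by the blow-up cell of any index where its representative is
nonzero. Elsewhere the line is determined by the point, and a chart of M serves as a cell. -/
theorem exists_cell (hgood : ∀ q : M, ∃ C : AdaptedChart n Φ Θ E, q ∈ C.chart.source)
    {d : M → Fin l → K} (hd : ∀ (C : AdaptedChart n Φ Θ E), ∀ q ∈ C.chart.source,
      ∃ u : K, u ≠ 0 ∧ C.h q = u • d q) (x : IncidenceSpace d) :
    ∃ c : IncidenceCell n d, x ∈ c.equiv.source := by
  obtain ⟨C, hC⟩ := hgood x.pt
  by_cases h0 : C.h x.pt = 0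
  · obtain ⟨s, -, -, hs⟩ := C.exists_embedding hC ((C.mem_zeroClosure_iff hC).2 h0)
    obtain ⟨i, hi⟩ := Function.ne_iff.1 x.line.rep_nonzero
    exact ⟨C.coordCell s hs (hd C) i x, hC, hi⟩
  · obtain ⟨c, hc, -⟩ := C.exists_openCell (hd C) hC h0
    exact ⟨c, hc⟩

/-- The blowing-up of the closure of the torus zeros exists. -/
theorem exists_isBlowUp (hl : 0 < l)
    (hgood : ∀ q : M, ∃ C : AdaptedChart n Φ Θ E, q ∈ C.chart.source) :
    ∃ (X : Type u) (_ : TopologicalSpace X) (_ : ChartedSpace (Fin n → K) X)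
      (_ : IsManifold 𝓘(K, Fin n → K) ω X) (π : X → M),
      IsBlowUp n K π (zeroClosure Φ Θ) := by
  obtain ⟨d, hd⟩ := exists_direction hgood
  have hcov := exists_cell hgood hd
  let core := IncidenceCell.core hcov
  let _ : TopologicalSpace (IncidenceSpace d) := core.toTopologicalSpace
  let _ : ChartedSpace (Fin n → K) (IncidenceSpace d) := core.toChartedSpace
  have hman : IsManifold 𝓘(K, Fin n → K) ω (IncidenceSpace d) :=
    IncidenceCell.core_isManifold hcov
  -- the cells as coordinate systems
  let oph : IncidenceCell n d → OpenPartialHomeomorph (IncidenceSpace d) (Fin n → K) :=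
    fun c => core.openPartialHomeomorph c.equiv (mem_range_self c)
  have hoph : ∀ c, oph c ∈ coordinateSystems n K (IncidenceSpace d) := by
    intro c
    refine IsManifold.subset_maximalAtlas ?_
    change oph c ∈ ⋃ (e : PartialEquiv _ _) (he : e ∈ core.atlas), _
    simp only [mem_iUnion, mem_singleton_iff]
    exact ⟨c.equiv, mem_range_self c, rfl⟩
  have hdzero : ∀ q, q ∉ zeroClosure Φ Θ → d q ≠ 0 := by
    intro q hq h0
    obtain ⟨C, hC⟩ := hgood q
    rw [C.mem_zeroClosure_iff hC] at hq
    obtain ⟨u, -, hu⟩ := hd C q hC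
    rw [h0, smul_zero] at hu
    exact hq hu
  refine ⟨IncidenceSpace d, core.toTopologicalSpace, core.toChartedSpace, hman,
    IncidenceSpace.pt, ?_, ?_, ?_⟩
  · intro b hb
    -- Off the centre d b ≠ 0, and only one line contains it.
    have hdb := hdzero b hb
    refine ⟨⟨b, Projectivization.mk K (d b) hdb, ?_⟩, rfl, ?_⟩
    · rw [Projectivization.submodule_mk]
      exact Submodule.mem_span_singleton_self _
    · rintro ⟨b', L, hL⟩ rfl
      ext1
      · rfl
      · change L = _
        change d b' ∈ L.submodule at hL
        rw [Projectivization.submodule_eq, Submodule.mem_span_singleton] at hL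
        obtain ⟨a, ha⟩ := hL
        conv_lhs => rw [← L.mk_rep]
        exact ((Projectivization.mk_eq_mk_iff' K _ _ _ _).2 ⟨a, ha⟩).symm
  · intro x hx
    obtain ⟨C, hC⟩ := hgood x.pt
    rw [C.mem_zeroClosure_iff hC] at hx
    obtain ⟨c, hxc, htgt, hc⟩ := C.exists_openCell (hd C) hC hx
    have h1 := (mem_coordinateSystems_iff.1 (hoph c))
    have h2 := (mem_coordinateSystems_iff.1 c.mem)
    let e := (oph c).trans c.φ.symm
    have hesrc : ∀ y ∈ c.equiv.source, y ∈ e.source ∧ e y = y.pt := by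
      intro y hy
      obtain ⟨hy1, hy2⟩ := hc y hy
      constructor
      · rw [OpenPartialHomeomorph.trans_source]
        refine ⟨hy, ?_⟩
        change c.equiv y ∈ c.φ.target
        rw [hy2]
        exact c.φ.map_source hy1
      · change c.φ.symm (c.equiv y) = y.pt
        rw [hy2, c.φ.left_inv hy1]
    let Ψ : PartialDiffeomorph 𝓘(K, Fin n → K) 𝓘(K, Fin n → K) (IncidenceSpace d) M ω :=
      { toPartialEquiv := e.toPartialEquiv
        open_source := e.open_source
        open_target := e.open_target
        contMDiffOn_toFun := (h2.2.comp' h1.1).mono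
          (by rw [OpenPartialHomeomorph.trans_source]; rfl)
        contMDiffOn_invFun := (h1.2.comp' h2.1).mono
          (by rw [OpenPartialHomeomorph.trans_target]; rfl) }
    refine ⟨Ψ, (hesrc x hxc).1, fun y hy => ?_⟩
    have hy : y ∈ e.source := hy
    rw [OpenPartialHomeomorph.trans_source] at hy
    exact (hesrc y hy.1).2.symm
  · intro b hb
    obtain ⟨C, hC⟩ := hgood b
    obtain ⟨s, -, -, hs⟩ := C.exists_embedding hC hb
    refine ⟨C.chart, C.mem, hC, Finset.univ.map s, C.isCoordinateSubspace s hs, ?_⟩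
    have hdb : d b = 0 := by
      obtain ⟨u, hu0, hu⟩ := hd C b hC
      rw [(C.mem_zeroClosure_iff hC).1 hb] at hu
      exact (smul_eq_zero.1 hu.symm).resolve_left hu0
    let i₀ : Fin l := ⟨0, hl⟩
    -- Over b any line is allowed since d b = 0; this one supplies the default value of the cells.
    let v₀ : Fin l → K := Pi.single i₀ 1
    have hv₀ : v₀ ≠ 0 := by simp [v₀]
    let base : IncidenceSpace d := ⟨b, Projectivization.mk K v₀ hv₀, by rw [hdb]; exact zero_mem _⟩
    have : Nonempty (Fin l) := ⟨i₀⟩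
    let cell : Fin l → IncidenceCell n d := fun i => C.coordCell s hs (hd C) i base
    -- The standard charts are indexed by `Fin n`, but only the indices in the image of s count;
    -- elsewhere `Function.invFun` gives an arbitrary cell.
    let ψ : Fin n → OpenPartialHomeomorph (IncidenceSpace d) (Fin n → K) :=
      fun j => oph (cell (Function.invFun s j))
    have hψ : ∀ k, ψ (s k) = oph (cell k) := by
      intro k
      simp only [ψ, Function.leftInverse_invFun s.injective k]
    have hsrc : ∀ k x, x ∈ (oph (cell k)).source ↔
        x.pt ∈ C.chart.source ∧ x.line.rep k ≠ 0 := fun k x => Iff.rfl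
    have hval : ∀ k m x, k ≠ m → oph (cell k) x (s m) = x.line.rep m / x.line.rep k := by
      intro k m x hkm
      change (if s m = s k then _ else Function.extend s (affineCoord x.line k) _ (s m)) = _
      have : s m ≠ s k := fun h => hkm (s.injective h).symm
      rw [if_neg this, s.injective.extend_apply]
      rfl
    refine ⟨ψ, ?_, ?_, ?_⟩
    · intro i hi
      obtain ⟨k, -, rfl⟩ := Finset.mem_map.1 hi
      rw [hψ]
      refine ⟨hoph _, fun x hx => hx.1, rfl, fun x hx => ?_⟩
      exact ((cell k).R_enc _ hx.1 _ (affineCoord_self hx.2)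
        ((cell k).h_eq_smul x hx.1 hx.2)).1.symm
    · intro x hx
      obtain ⟨k, hk⟩ := Function.ne_iff.1 x.line.rep_nonzero
      refine ⟨s k, by simp, ?_⟩
      rw [hψ]
      exact ⟨hx, hk⟩
    · intro i hi j hj hij x hx
      obtain ⟨k, -, rfl⟩ := Finset.mem_map.1 hi
      obtain ⟨m, -, rfl⟩ := Finset.mem_map.1 hj
      have hkm : k ≠ m := fun h => hij (by rw [h])
      rw [hψ] at hx
      rw [hψ, hψ, hval k m x hkm]
      have hxk := hx.2
      have hxk : x.line.rep k ≠ 0 := hxk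
      refine ⟨?_, ?_⟩
      · rw [hsrc]
        simp only [ne_eq, div_eq_zero_iff, hxk, or_false]
        exact ⟨fun h => h.2, fun h => ⟨hx.1, h⟩⟩
      · intro hx2
        have hxm : x.line.rep m ≠ 0 := hx2.2
        refine ⟨?_, ?_⟩
        · rw [hval m k x hkm.symm, inv_div]
        · intro a ha hak ham
          obtain ⟨a, -, rfl⟩ := Finset.mem_map.1 ha
          rw [hval m a x (fun h => ham (by rw [h])), hval k a x (fun h => hak (by rw [h]))]
          field_simp

end AdaptedChart

/-! ### Simple fans -/

section Fan

variable {n : ℕ}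

/-- The real vector of an integral vector. -/
abbrev realVec (a : Fin n → ℤ) : Fin n → ℝ := fun i => (a i : ℝ)

/-- The real extension of the coordinates with respect to a basis of the lattice. -/
def realCoord (b : Module.Basis (Fin n) ℤ (Fin n → ℤ)) (k : Fin n) : (Fin n → ℝ) →ₗ[ℝ] ℝ :=
  ∑ i, ((b.coord k (Pi.single i 1) : ℤ) : ℝ) • (LinearMap.proj i : (Fin n → ℝ) →ₗ[ℝ] ℝ)

theorem realCoord_apply (b : Module.Basis (Fin n) ℤ (Fin n → ℤ)) (k : Fin n) (a : Fin n → ℝ) :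
    realCoord b k a = ∑ i, ((b.coord k (Pi.single i 1) : ℤ) : ℝ) * a i := by
  simp [realCoord, LinearMap.sum_apply]

theorem realCoord_realVec (b : Module.Basis (Fin n) ℤ (Fin n → ℤ)) (k : Fin n) (z : Fin n → ℤ) :
    realCoord b k (realVec z) = (b.coord k z : ℤ) := by
  rw [realCoord_apply]
  have hz : z = ∑ i, z i • (Pi.single i 1 : Fin n → ℤ) := by
    funext j
    simp [Finset.sum_apply, Pi.single_apply]
  conv_rhs => rw [hz, map_sum]
  push_cast
  refine Finset.sum_congr rfl fun i _ => ?_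
  rw [map_zsmul, smul_eq_mul]
  push_cast
  ring

theorem coord_basis (b : Module.Basis (Fin n) ℤ (Fin n → ℤ)) (k j : Fin n) :
    b.coord k (b j) = if j = k then 1 else 0 := by
  classical
  simp [Module.Basis.coord_apply, Finsupp.single_apply]

theorem realCoord_basis (b : Module.Basis (Fin n) ℤ (Fin n → ℤ)) (k j : Fin n) :
    realCoord b k (realVec (b j)) = if j = k then 1 else 0 := by
  rw [realCoord_realVec, coord_basis]
  split_ifs <;> simp

theorem sum_realCoord (b : Module.Basis (Fin n) ℤ (Fin n → ℤ)) (a : Fin n → ℝ) :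
    ∑ k, realCoord b k a • realVec (b k) = a := by
  have key : ∀ i i', ∑ k, ((b.coord k (Pi.single i 1) : ℤ) : ℝ) * (b k i' : ℝ) =
      if i' = i then 1 else 0 := by
    intro i i'
    have h := congrFun (b.sum_repr (Pi.single i 1)) i'
    rw [Finset.sum_apply] at h
    simp only [Pi.smul_apply, smul_eq_mul, Pi.single_apply] at h
    have h' := congrArg (Int.cast : ℤ → ℝ) h
    push_cast at h'
    exact h'
  funext i'
  rw [Finset.sum_apply]
  simp only [Pi.smul_apply, smul_eq_mul, realCoord_apply, Finset.sum_mul]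
  rw [Finset.sum_comm]
  calc ∑ i, ∑ k, ((b.coord k (Pi.single i 1) : ℤ) : ℝ) * a i * (b k i' : ℝ)
      = ∑ i, a i * ∑ k, ((b.coord k (Pi.single i 1) : ℤ) : ℝ) * (b k i' : ℝ) := by
        refine Finset.sum_congr rfl fun i _ => ?_
        rw [Finset.mul_sum]
        refine Finset.sum_congr rfl fun k _ => ?_
        ring
    _ = a i' := by simp only [key]; simp

theorem continuous_realCoord (b : Module.Basis (Fin n) ℤ (Fin n → ℤ)) (k : Fin n) :
    Continuous (realCoord b k) := LinearMap.continuous_of_finiteDimensional _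

instance (F : SimpleFan n) : Finite F.MaxCone := by
  classical
  let S : Finset (Fin n → ℤ) := F.cones.biUnion id
  let g : F.MaxCone → (Fin n → S) := fun c j => ⟨c.1 j, Finset.mem_biUnion.2
    ⟨_, c.2, Finset.mem_image_of_mem _ (Finset.mem_univ j)⟩⟩
  refine Finite.of_injective g fun c c' h => ?_
  apply Subtype.ext
  apply Module.Basis.eq_of_apply_eq
  intro j
  exact congrArg Subtype.val (congrFun h j)

theorem realCoord_pos_of_mem_openCone {b : Module.Basis (Fin n) ℤ (Fin n → ℤ)} {x : Fin n → ℝ}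
    (hx : x ∈ openCone (Finset.univ.image b)) (k : Fin n) : 0 < realCoord b k x := by
  classical
  obtain ⟨c, hc, rfl⟩ := hx
  rw [Finset.sum_image (fun _ _ _ _ h => b.injective h), map_sum]
  simp only [map_smul, smul_eq_mul]
  rw [Finset.sum_eq_single k]
  · have := realCoord_basis b k k
    rw [if_pos rfl] at this
    change 0 < c (b k) * realCoord b k (realVec (b k))
    rw [this, mul_one]
    exact hc _ (Finset.mem_image_of_mem _ (Finset.mem_univ k))
  · intro j _ hj
    change c (b j) * realCoord b k (realVec (b j)) = 0
    rw [realCoord_basis, if_neg hj, mul_zero]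
  · simp

/-- The closed `n`-dimensional cones of the fan cover the orthant. -/
theorem exists_maxCone (F : SimpleFan n) {a : Fin n → ℝ} (ha : 0 ≤ a) :
    ∃ c : F.MaxCone, ∀ k, 0 ≤ realCoord c.1 k a := by
  classical
  -- A measure argument. The union D of the closed maximal cones is closed, so a point outside it
  -- gives a nonempty open set in the positive orthant that misses D. The partition would cover this
  -- set by the finitely many cones with fewer than n generators, which lie in proper subspaces and
  -- are null sets.
  let D : Set (Fin n → ℝ) := ⋃ c : F.MaxCone, {x | ∀ k, 0 ≤ realCoord c.1 k x}
  have hD : IsClosed D := by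
    refine isClosed_iUnion_of_finite fun c => ?_
    simp only [ofPred_forall]
    exact isClosed_iInter fun k => isClosed_le continuous_const (continuous_realCoord _ _)
  by_contra hcon
  have haD : a ∈ Dᶜ := by
    simpa [D] using hcon
  let O : Set (Fin n → ℝ) := Dᶜ ∩ {x | ∀ i, 0 < x i}
  have hO : IsOpen O := by
    refine hD.isOpen_compl.inter ?_
    simp only [ofPred_forall]
    exact isOpen_iInter_of_finite fun i => isOpen_lt continuous_const (continuous_apply i)
  have hOne : O.Nonempty := by
    have ht : Tendsto (fun ε : ℝ => a + ε • (1 : Fin n → ℝ)) (𝓝[>] 0) (𝓝 a) := by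
      have : Continuous (fun ε : ℝ => a + ε • (1 : Fin n → ℝ)) := by fun_prop
      have h := this.tendsto 0
      simp only [zero_smul, add_zero] at h
      exact h.mono_left nhdsWithin_le_nhds
    obtain ⟨ε, hε, hε0⟩ := ((ht.eventually (hD.isOpen_compl.mem_nhds haD)).and
      self_mem_nhdsWithin).exists
    refine ⟨_, hε, fun i => ?_⟩
    have h1 := ha i
    have h2 : (0 : ℝ) < ε := hε0
    simp only [Pi.add_apply, Pi.smul_apply, Pi.one_apply, smul_eq_mul, mul_one, Pi.zero_apply] at h1 ⊢
    linarith
  let S : Finset (Finset (Fin n → ℤ)) := F.cones.filter fun s => s.card < n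
  let V : Finset (Fin n → ℤ) → Submodule ℝ (Fin n → ℝ) := fun s =>
    Submodule.span ℝ ((s.image realVec : Finset (Fin n → ℝ)) : Set (Fin n → ℝ))
  have hsub : O ⊆ ⋃ s ∈ S, (V s : Set (Fin n → ℝ)) := by
    rintro x ⟨hxD, hx0⟩
    obtain ⟨s, ⟨hs, hxs⟩, -⟩ := F.partition x (fun i => (hx0 i).le)
    refine mem_iUnion₂.2 ⟨s, Finset.mem_filter.2 ⟨hs, ?_⟩, ?_⟩
    · by_contra hcard
      obtain ⟨b, hb⟩ := F.simple s hs
      have hsb : s = Finset.univ.image b := by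
        apply Finset.eq_of_subset_of_card_le
        · intro z hz
          obtain ⟨j, rfl⟩ := hb hz
          exact Finset.mem_image_of_mem _ (Finset.mem_univ j)
        · refine (Finset.card_image_le).trans ?_
          simpa using hcard
      rw [hsb] at hs hxs
      exact hxD (mem_iUnion.2 ⟨⟨b, hs⟩, fun k => (realCoord_pos_of_mem_openCone hxs k).le⟩)
    · obtain ⟨c, -, rfl⟩ := hxs
      refine Submodule.sum_mem _ fun z hz => Submodule.smul_mem _ _ (Submodule.subset_span ?_)
      exact Finset.mem_coe.2 (Finset.mem_image_of_mem _ hz)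
  have hnull : MeasureTheory.volume (⋃ s ∈ S, (V s : Set (Fin n → ℝ))) = 0 := by
    refine (MeasureTheory.measure_biUnion_null_iff S.countable_toSet).2 fun s hs => ?_
    apply MeasureTheory.Measure.addHaar_submodule
    intro htop
    have h1 := finrank_span_finset_le_card (R := ℝ) (s.image (realVec (n := n)))
    change Module.finrank ℝ (V s) ≤ _ at h1
    rw [htop, finrank_top, Module.finrank_fin_fun] at h1
    have h2 := (Finset.mem_filter.1 hs).2
    have h3 := Finset.card_image_le (s := s) (f := realVec (n := n))
    omega
  exact absurd (MeasureTheory.measure_mono_null hsub hnull)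
    (hO.measure_pos MeasureTheory.volume hOne).ne'

theorem sum_mem_openCone (b : Module.Basis (Fin n) ℤ (Fin n → ℤ)) (I : Finset (Fin n))
    {r : Fin n → ℝ} (hr : ∀ j ∈ I, 0 < r j) :
    ∑ j ∈ I, r j • realVec (b j) ∈ openCone (I.image b) := by
  classical
  have key : ∀ j ∈ I, (∑ k ∈ I, if b k = b j then r k else 0) = r j := by
    intro j hj
    simp only [b.injective.eq_iff]
    simp [hj]
  refine ⟨fun z => ∑ k ∈ I, if b k = z then r k else 0, ?_, ?_⟩
  · intro z hz
    obtain ⟨j, hj, rfl⟩ := Finset.mem_image.1 hz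
    beta_reduce
    rw [key j hj]
    exact hr j hj
  · rw [Finset.sum_image (fun _ _ _ _ h => b.injective h)]
    exact Finset.sum_congr rfl fun j hj => by beta_reduce; rw [key j hj]

/-- If the sum of some generators of a cone lies in another closed cone, they are generators of
that cone. -/
theorem mem_range_of_realCoord_nonneg (F : SimpleFan n) (c c' : F.MaxCone) (I : Finset (Fin n))
    (h : ∀ k, 0 ≤ realCoord c'.1 k (∑ j ∈ I, realVec (c.1 j))) {j : Fin n} (hj : j ∈ I) :
    c.1 j ∈ range c'.1 := by
  classical
  set w := ∑ j ∈ I, realVec (c.1 j) with hw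
  -- The vector w lies in the open cone of the generators in I, and also in the open cone of those
  -- generators of c' on which its coordinates are positive; uniqueness in the partition identifies
  -- the two faces.
  let J : Finset (Fin n) := Finset.univ.filter fun k => 0 < realCoord c'.1 k w
  have h1 : w ∈ openCone (I.image c.1) := by
    have := sum_mem_openCone c.1 I (r := fun _ => 1) (fun _ _ => one_pos)
    simpa [hw] using this
  have h2 : w ∈ openCone (J.image c'.1) := by
    have := sum_mem_openCone c'.1 J (r := fun k => realCoord c'.1 k w)
      (fun k hk => (Finset.mem_filter.1 hk).2)
    rw [Finset.sum_subset (Finset.subset_univ J), sum_realCoord] at this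
    · exact this
    · intro k _ hk
      have : ¬ 0 < realCoord c'.1 k w := by simpa [J] using hk
      rw [le_antisymm (not_lt.1 this) (h k), zero_smul]
  have hw0 : 0 ≤ w := by
    intro i
    rw [hw, Finset.sum_apply]
    refine Finset.sum_nonneg fun j _ => ?_
    exact Int.cast_nonneg (MaxCone_nonneg F c i j)
  have e := (F.partition w hw0).unique
    ⟨F.faces _ c.2 _ (Finset.image_subset_image (Finset.subset_univ I)), h1⟩
    ⟨F.faces _ c'.2 _ (Finset.image_subset_image (Finset.subset_univ J)), h2⟩
  have : c.1 j ∈ J.image c'.1 := by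
    rw [← e]
    exact Finset.mem_image_of_mem _ hj
  obtain ⟨k, -, hk⟩ := Finset.mem_image.1 this
  exact ⟨k, hk⟩

end Fan

/-! ### Properness of the toric map over the origin. -/

section Proper

variable {n : ℕ} (F : SimpleFan n) {K : Type*} [NontriviallyNormedField K]

/-- The toric charts as open partial homeomorphisms. -/
def toricHomeo (K : Type*) [NontriviallyNormedField K] (c : F.MaxCone) :
    OpenPartialHomeomorph (ToricManifold F K) (Fin n → K) :=
  (toricCore F K).openPartialHomeomorph (toricChart F K c) (mem_range_self c)

theorem toricHomeo_mem_atlas (c : F.MaxCone) :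
    toricHomeo F K c ∈ atlas (Fin n → K) (ToricManifold F K) := by
  change toricHomeo F K c ∈ ⋃ (e : PartialEquiv _ _) (he : e ∈ (toricCore F K).atlas), _
  simp only [mem_iUnion, mem_singleton_iff]
  exact ⟨_, mem_range_self c, rfl⟩

theorem toricHomeo_target (c : F.MaxCone) : (toricHomeo F K c).target = univ := rfl

theorem toricHomeo_toricPoint (c : F.MaxCone) (y : Fin n → K) :
    toricHomeo F K c (toricPoint F K c y) = y :=
  (toricHomeo F K c).right_inv (mem_univ y)

theorem continuous_toricPoint (c : F.MaxCone) : Continuous (toricPoint F K c) := by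
  have := (toricHomeo F K c).continuousOn_symm
  rw [toricHomeo_target] at this
  exact continuousOn_univ.1 this

theorem exists_toricPoint_eq (q : ToricManifold F K) : ∃ c y, q = toricPoint F K c y := by
  obtain ⟨⟨c, y⟩, rfl⟩ := Quotient.exists_rep q
  exact ⟨c, y, rfl⟩

/-- The coordinate change between two charts. -/
theorem toricPoint_coord {c c' : F.MaxCone} {y y' : Fin n → K}
    (h : toricPoint F K c' y' = toricPoint F K c y) (k : Fin n) :
    y' k = ∏ j, y j ^ c'.1.coord k (c.1 j) := by
  have hr : ∀ j, y j = 0 → c.1 j ∈ range c'.1 :=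
    (toricPoint_mem_range_iff F K c c' y).1 ⟨y', h⟩
  rw [← toricChart_trans_apply F K c c' hr k]
  change _ = (toricHomeo F K c') (toricPoint F K c y) k
  rw [← h, toricHomeo_toricPoint]

/-- A vanishing coordinate only occurs with exponent zero, so its factor is 1 and the convention
`Real.log 0 = 0` does no harm. -/
theorem log_norm_prod_zpow (y : Fin n → K) (e : Fin n → ℤ) (he : ∀ j, y j = 0 → e j = 0) :
    ∏ j, y j ^ e j ≠ 0 ∧ Real.log ‖∏ j, y j ^ e j‖ = ∑ j, (e j : ℝ) * Real.log ‖y j‖ := by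
  have hne : ∀ j, y j ^ e j ≠ 0 := by
    intro j
    by_cases hj : y j = 0
    · simp [he j hj]
    · exact zpow_ne_zero _ hj
  refine ⟨Finset.prod_ne_zero_iff.2 fun j _ => hne j, ?_⟩
  rw [norm_prod, Real.log_prod (fun j _ => norm_ne_zero_iff.2 (hne j))]
  simp only [norm_zpow, Real.log_zpow]

/-- Every point over the unit polydisc lies in the unit polydisc of some chart. -/
theorem exists_toricPoint_norm_le (q : ToricManifold F K) (hq : ‖toricMap F K q‖ ≤ 1) :
    ∃ c y, q = toricPoint F K c y ∧ ‖y‖ ≤ 1 := by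
  classical
  obtain ⟨c₀, y, rfl⟩ := exists_toricPoint_eq F q
  let I : Finset (Fin n) := Finset.univ.filter fun j => y j = 0
  have hI : ∀ j, j ∈ I ↔ y j = 0 := by simp [I]
  -- The vectors t w + r stand for -log |x_i|, with the parameter t → ∞ in place of -log 0 for the
  -- vanishing coordinates; in r these contribute 0 since `Real.log 0 = 0`. The bound |x_i| ≤ 1 puts
  -- t w + r into the orthant for large t.
  let w : Fin n → ℝ := ∑ j ∈ I, realVec (c₀.1 j)
  let r : Fin n → ℝ := ∑ j, (-Real.log ‖y j‖) • realVec (c₀.1 j)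
  have hwi : ∀ i, w i = ∑ j ∈ I, (c₀.1 j i : ℝ) := fun i => Finset.sum_apply _ _ _
  have hri : ∀ i, r i = ∑ j, -Real.log ‖y j‖ * (c₀.1 j i : ℝ) := fun i => Finset.sum_apply _ _ _
  have hc0 : ∀ i j, (0 : ℝ) ≤ c₀.1 j i := fun i j => Int.cast_nonneg (MaxCone_nonneg F c₀ i j)
  have hnonneg : ∀ᶠ t : ℕ in atTop, 0 ≤ (t : ℝ) • w + r := by
    simp only [Pi.le_def]
    rw [eventually_all]
    intro i
    have hw0 : 0 ≤ w i := by rw [hwi]; exact Finset.sum_nonneg fun j _ => hc0 i j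
    rcases hw0.eq_or_lt with h0 | hpos
    · refine Eventually.of_forall fun t => ?_
      have hz : ∀ j, y j = 0 → c₀.1 j i = 0 := by
        intro j hj
        rw [hwi] at h0
        have := (Finset.sum_eq_zero_iff_of_nonneg (fun j _ => hc0 i j)).1 h0.symm j ((hI j).2 hj)
        exact_mod_cast this
      obtain ⟨hne, hlog⟩ := log_norm_prod_zpow y (fun j => c₀.1 j i) hz
      have hx : toricMap F K (toricPoint F K c₀ y) i = ∏ j, y j ^ c₀.1 j i := by
        rw [toricMap_toricPoint]
        refine Finset.prod_congr rfl fun j _ => ?_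
        rw [← zpow_natCast, Int.toNat_of_nonneg (MaxCone_nonneg F c₀ i j)]
      have hle : ‖∏ j, y j ^ c₀.1 j i‖ ≤ 1 := by
        rw [← hx]
        exact (norm_le_pi_norm _ i).trans hq
      have hlog0 : Real.log ‖∏ j, y j ^ c₀.1 j i‖ ≤ 0 := Real.log_nonpos (norm_nonneg _) hle
      rw [hlog] at hlog0
      simp only [Pi.zero_apply, Pi.add_apply, Pi.smul_apply, smul_eq_mul, ← h0, mul_zero, zero_add,
        hri, neg_mul, Finset.sum_neg_distrib]
      rw [Left.nonneg_neg_iff]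
      refine le_trans (le_of_eq (Finset.sum_congr rfl fun j _ => ?_)) hlog0
      ring
    · have ht : Tendsto (fun t : ℕ => (t : ℝ) * w i + r i) atTop atTop :=
        tendsto_atTop_add_const_right _ _
          (tendsto_natCast_atTop_atTop.atTop_mul_const hpos)
      filter_upwards [ht.eventually_ge_atTop 0] with t ht
      simpa using ht
  -- There are only finitely many maximal cones, so one closed cone contains t w + r for arbitrarily
  -- large t. It then contains w as well, so the point lies in its chart.
  obtain ⟨c, hc⟩ : ∃ c : F.MaxCone, ∃ᶠ t : ℕ in atTop,
      ∀ k, 0 ≤ realCoord c.1 k ((t : ℝ) • w + r) := by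
    by_contra! hcon
    obtain ⟨t, ht1, ht2⟩ := ((eventually_all.2 hcon).and hnonneg).exists
    obtain ⟨c, hc⟩ := exists_maxCone F ht2
    obtain ⟨k, hk⟩ := ht1 c
    exact hk.not_ge (hc k)
  have hp : ∀ k, 0 ≤ realCoord c.1 k w := by
    intro k
    by_contra hneg
    have ht : Tendsto (fun t : ℕ => (t : ℝ) * realCoord c.1 k w + realCoord c.1 k r) atTop atBot :=
      tendsto_atBot_add_const_right _ _
        (tendsto_natCast_atTop_atTop.atTop_mul_const_of_neg (not_le.1 hneg))
    obtain ⟨t, ht1, ht2⟩ := (hc.and_eventually (ht.eventually_lt_atBot 0)).exists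
    have := ht1 k
    rw [map_add, map_smul, smul_eq_mul] at this
    linarith
  obtain ⟨y', hy'⟩ := (toricPoint_mem_range_iff F K c₀ c y).2 fun j hj =>
    mem_range_of_realCoord_nonneg F c₀ c I hp ((hI j).2 hj)
  refine ⟨c, y', hy'.symm, ?_⟩
  rw [pi_norm_le_iff_of_nonneg zero_le_one]
  intro k
  rw [toricPoint_coord F hy' k]
  -- If no vanishing y j enters the k-th new coordinate, minus its log-norm is the k-th cone
  -- coordinate of t w + r, which is nonnegative. Otherwise the new coordinate is zero.
  by_cases hz : ∀ j, y j = 0 → c.1.coord k (c₀.1 j) = 0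
  · obtain ⟨hne, hlog⟩ := log_norm_prod_zpow y (fun j => c.1.coord k (c₀.1 j)) hz
    have hwk : realCoord c.1 k w = 0 := by
      simp only [w, map_sum, realCoord_realVec]
      exact Finset.sum_eq_zero fun j hj => by rw [hz j ((hI j).1 hj)]; simp
    obtain ⟨t, ht⟩ := hc.exists
    have h1 := ht k
    rw [map_add, map_smul, hwk, smul_zero, zero_add] at h1
    have h2 : realCoord c.1 k r =
        -∑ j, ((c.1.coord k (c₀.1 j) : ℤ) : ℝ) * Real.log ‖y j‖ := by
      simp only [r, map_sum, map_smul, realCoord_realVec, smul_eq_mul, neg_mul,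
        Finset.sum_neg_distrib]
      congr 1
      exact Finset.sum_congr rfl fun j _ => mul_comm _ _
    rw [h2, ← hlog, Left.nonneg_neg_iff] at h1
    exact (Real.log_nonpos_iff (norm_nonneg _)).1 h1
  · push Not at hz
    obtain ⟨j, hj, hj'⟩ := hz
    rw [Finset.prod_eq_zero (Finset.mem_univ j) (by rw [hj, zero_zpow _ hj'])]
    simp

/-- The toric map is proper over the origin. -/
theorem exists_norm_toricMap_lt [ProperSpace K] {W : Set (ToricManifold F K)} (hW : IsOpen W)
    (h0 : toricMap F K ⁻¹' {0} ⊆ W) :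
    ∃ ε : ℝ, 0 < ε ∧ ∀ q, ‖toricMap F K q‖ < ε → q ∈ W := by
  have hc : ∀ c : F.MaxCone, ∀ᶠ ε in 𝓝[>] (0 : ℝ), ∀ y : Fin n → K, ‖y‖ ≤ 1 →
      ‖toricMap F K (toricPoint F K c y)‖ < ε → toricPoint F K c y ∈ W := by
    intro c
    -- On this compact part of the unit polydisc outside W the norm of the toric map has a positive
    -- minimum. The finitely many unit polydiscs cover everything over the unit polydisc.
    let S : Set (Fin n → K) := Metric.closedBall 0 1 ∩ toricPoint F K c ⁻¹' Wᶜ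
    have hS : IsCompact S := (isCompact_closedBall 0 1).inter_right
      (hW.isClosed_compl.preimage (continuous_toricPoint F c))
    have hcont : Continuous fun y => ‖toricMap F K (toricPoint F K c y)‖ :=
      ((continuous_toricMap F K).comp (continuous_toricPoint F c)).norm
    rcases S.eq_empty_or_nonempty with he | hne
    · refine Eventually.of_forall fun ε y hy _ => ?_
      by_contra hyW
      have : y ∈ S := ⟨by simpa using hy, hyW⟩
      rw [he] at this
      exact this
    · obtain ⟨y₀, hy₀, hmin⟩ := hS.exists_isMinOn hne hcont.continuousOn
      have hpos : 0 < ‖toricMap F K (toricPoint F K c y₀)‖ := by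
        rw [norm_pos_iff]
        intro hz
        exact hy₀.2 (h0 hz)
      filter_upwards [Ioo_mem_nhdsGT hpos] with ε hε y hy hlt
      by_contra hyW
      have : y ∈ S := ⟨by simpa using hy, hyW⟩
      have h1 : ‖toricMap F K (toricPoint F K c y₀)‖ ≤ ‖toricMap F K (toricPoint F K c y)‖ :=
        hmin this
      linarith [hε.2]
  obtain ⟨ε, ⟨h1, h2⟩, h3⟩ := ((eventually_all.2 hc).and (Ioc_mem_nhdsGT one_pos)).and
    self_mem_nhdsWithin |>.exists
  refine ⟨ε, h3, fun q hq => ?_⟩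
  obtain ⟨c, y, rfl, hy⟩ := exists_toricPoint_norm_le F q (hq.le.trans h2.2)
  exact h1 c y hy hq

end Proper

/-! ### The toric map in a chart -/

section ToricLocal

variable {n : ℕ} {F : SimpleFan n} {K : Type*} [NontriviallyNormedField K]

/-- The toric map in the chart of the cone `c`. -/
def monomialMap (K : Type*) [Field K] (c : F.MaxCone) (y : Fin n → K) : Fin n → K :=
  fun i => ∏ j, y j ^ (c.1 j i).toNat

theorem toricMap_toricPoint_eq (c : F.MaxCone) (y : Fin n → K) :
    toricMap F K (toricPoint F K c y) = monomialMap K c y :=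
  funext fun i => toricMap_toricPoint F K c y i

theorem contDiff_monomialMap (c : F.MaxCone) : ContDiff K ω (monomialMap K c) := by
  rw [contDiff_pi]
  intro i
  unfold monomialMap
  fun_prop

theorem analyticAt_monomialMap [CompleteSpace K] (c : F.MaxCone) (y : Fin n → K) :
    AnalyticAt K (monomialMap K c) y :=
  (contDiff_monomialMap c).contDiffAt.analyticAt

/-- The matrix of the generators of a cone. -/
def coneMatrix (K : Type*) [Field K] (c : F.MaxCone) : Matrix (Fin n) (Fin n) K :=
  Matrix.of fun i j => (((c.1 j i).toNat : ℕ) : K)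

/-- The integral determinant is a unit because the generators form a basis of the lattice, so its
image in K is nonzero. -/
theorem det_coneMatrix_ne_zero (c : F.MaxCone) : (coneMatrix K c).det ≠ 0 := by
  have h1 : coneMatrix K c =
      (Int.castRingHom K).mapMatrix ((Pi.basisFun ℤ (Fin n)).toMatrix c.1) := by
    ext i j
    simp only [coneMatrix, Matrix.of_apply, RingHom.mapMatrix_apply, Matrix.map_apply,
      Module.Basis.toMatrix_apply, Pi.basisFun_repr, eq_intCast]
    rw [← Int.cast_natCast, Int.toNat_of_nonneg (MaxCone_nonneg F c i j)]
  rw [h1, ← RingHom.map_det]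
  have h2 : IsUnit ((Pi.basisFun ℤ (Fin n)).toMatrix c.1).det := by
    rw [← Module.Basis.det_apply]
    exact Module.Basis.isUnit_det _ _
  exact (h2.map (Int.castRingHom K)).ne_zero

/-- The logarithmic derivative of a monomial, multiplied out so that it needs no nonvanishing. -/
theorem fderiv_monomialMap_mul [CompleteSpace K] (c : F.MaxCone) (y : Fin n → K) (i j : Fin n) :
    fderiv K (monomialMap K c) y (Pi.single j 1) i * y j =
      monomialMap K c y i * ((c.1 j i).toNat : K) := by
  classical
  have hd : HasFDerivAt (fun y : Fin n → K => ∏ j, y j ^ (c.1 j i).toNat)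
      (∑ j, (∏ k ∈ Finset.univ.erase j, y k ^ (c.1 k i).toNat) •
        (((c.1 j i).toNat : K) * y j ^ ((c.1 j i).toNat - 1)) •
          (ContinuousLinearMap.proj j : (Fin n → K) →L[K] K)) y := by
    refine HasFDerivAt.finsetProd fun j _ => ?_
    have := (hasFDerivAt_apply (𝕜 := K) (F' := fun _ : Fin n => K) j y).pow (c.1 j i).toNat
    simpa [nsmul_eq_mul] using this
  have h1 : HasFDerivAt (monomialMap K c) (fderiv K (monomialMap K c) y) y :=
    (analyticAt_monomialMap c y).differentiableAt.hasFDerivAt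
  have h2 := ((hasFDerivAt_pi'.1 h1) i).unique hd
  have h3 := DFunLike.congr_fun h2 (Pi.single j 1)
  change fderiv K (monomialMap K c) y (Pi.single j 1) i = _ at h3
  rw [h3]
  simp only [sum_apply, smul_apply, ContinuousLinearMap.proj_apply, smul_eq_mul,
    Pi.single_apply, mul_ite, mul_one, mul_zero, Finset.sum_ite_eq',
    Finset.mem_univ, if_true]
  unfold monomialMap
  rw [← Finset.mul_prod_erase _ _ (Finset.mem_univ j)]
  rcases Nat.eq_zero_or_pos (c.1 j i).toNat with h0 | hpos
  · rw [h0]; simp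
  · obtain ⟨m, hm⟩ := Nat.exists_eq_succ_of_ne_zero hpos.ne'
    rw [hm]
    simp only [Nat.succ_eq_add_one, Nat.add_sub_cancel, pow_succ]
    ring

/-- The sum of the entries of a generator. -/
def coneWeight (c : F.MaxCone) (j : Fin n) : ℕ := ∑ i, (c.1 j i).toNat

theorem coneWeight_pos (c : F.MaxCone) (j : Fin n) : 0 < coneWeight c j := by
  rw [Nat.pos_iff_ne_zero]
  intro h
  apply c.1.ne_zero j
  funext i
  have := Finset.sum_eq_zero_iff.1 h i (Finset.mem_univ i)
  have h2 := MaxCone_nonneg F c i j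
  simp only [Pi.zero_apply]
  omega

theorem prod_monomialMap (c : F.MaxCone) (y : Fin n → K) :
    ∏ i, monomialMap K c y i = ∏ j, y j ^ coneWeight c j := by
  unfold monomialMap coneWeight
  rw [Finset.prod_comm]
  exact Finset.prod_congr rfl fun j _ => Finset.prod_pow_eq_pow_sum _ _ _

theorem dense_torus : Dense {y : Fin n → K | ∀ j, y j ≠ 0} := by
  have h := dense_pi (α := fun _ : Fin n => K) univ (s := fun _ => {0}ᶜ)
    fun i _ => dense_compl_singleton (0 : K)
  convert h using 1
  ext y
  simp

/-- The Jacobian determinant of the toric map. -/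
theorem det_fderiv_monomialMap [CompleteSpace K] (c : F.MaxCone) (y : Fin n → K) :
    (fderiv K (monomialMap K c) y).det =
      (coneMatrix K c).det * ∏ j, y j ^ (coneWeight c j - 1) := by
  have hcont : Continuous fun y => (fderiv K (monomialMap K c) y).det :=
    ContinuousLinearMap.continuous_det.comp
      ((contDiff_monomialMap c).continuous_fderiv (by simp))
  have hcont' : Continuous fun y : Fin n → K =>
      (coneMatrix K c).det * ∏ j, y j ^ (coneWeight c j - 1) := by fun_prop
  -- Both sides are continuous and the torus is dense, so y may be taken in the torus; there the
  -- columns of the Jacobian can be multiplied by the y j.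
  refine congrFun (hcont.ext_on dense_torus hcont' fun y hy => ?_) y
  have hy : ∀ j, y j ≠ 0 := hy
  have hprod : ∏ j, y j ≠ 0 := Finset.prod_ne_zero_iff.2 fun j _ => hy j
  apply mul_left_cancel₀ hprod
  let J : Matrix (Fin n) (Fin n) K :=
    LinearMap.toMatrix' (fderiv K (monomialMap K c) y : (Fin n → K) →ₗ[K] (Fin n → K))
  have hJ : ∀ i j, J i j = fderiv K (monomialMap K c) y (Pi.single j 1) i := by
    intro i j
    simp [J, LinearMap.toMatrix'_apply]
  have h1 : (fderiv K (monomialMap K c) y).det = J.det := (LinearMap.det_toMatrix' _).symm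
  beta_reduce
  rw [h1, ← Matrix.det_mul_row]
  have h2 : (Matrix.of fun i j => y j * J i j) =
      Matrix.of fun i j => monomialMap K c y i * coneMatrix K c i j := by
    ext i j
    simp only [Matrix.of_apply, hJ, coneMatrix]
    rw [mul_comm, fderiv_monomialMap_mul]
  rw [h2, Matrix.det_mul_column, prod_monomialMap, mul_left_comm, mul_comm, ← Finset.prod_mul_distrib]
  congr 1
  refine Finset.prod_congr rfl fun j _ => ?_
  rw [← pow_succ', Nat.sub_add_cancel (coneWeight_pos c j)]

/-- A generator has weight 1 exactly when it is a unit vector, so the critical divisors are the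
hyperplanes y j = 0 of the generators that subdivide the orthant. -/
theorem det_fderiv_monomialMap_ne_zero_iff [CompleteSpace K] (c : F.MaxCone) (y : Fin n → K) :
    (fderiv K (monomialMap K c) y).det ≠ 0 ↔ ∀ j, coneWeight c j ≠ 1 → y j ≠ 0 := by
  rw [det_fderiv_monomialMap, mul_ne_zero_iff, Finset.prod_ne_zero_iff]
  simp only [det_coneMatrix_ne_zero, ne_eq, not_false_eq_true, Finset.mem_univ, true_and,
    forall_const]
  refine forall_congr' fun j => ?_
  have := coneWeight_pos c j
  rw [pow_eq_zero_iff']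
  have : coneWeight c j - 1 ≠ 0 ↔ coneWeight c j ≠ 1 := by omega
  rw [this]
  tauto

end ToricLocal

/-! ### The exceptional locus of the toric map -/

section Exceptional

variable {n : ℕ} {F : SimpleFan n} {K : Type*} [NontriviallyNormedField K]

/-- The toric chart of the cone `c` on the inverse image of `V`. -/
def toricOpenChart {V : TopologicalSpace.Opens (Fin n → K)} (h : Nonempty (toricOpen F V))
    (c : F.MaxCone) : OpenPartialHomeomorph (toricOpen F V) (Fin n → K) :=
  (toricHomeo F K c).subtypeRestr h

variable {V : TopologicalSpace.Opens (Fin n → K)} (h : Nonempty (toricOpen F V)) (c : F.MaxCone)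

theorem toricOpenChart_mem : toricOpenChart h c ∈ coordinateSystems n K (toricOpen F V) :=
  StructureGroupoid.subtypeRestr_mem_maximalAtlas (toricHomeo_mem_atlas F c) h

theorem mem_toricOpenChart_source (q : toricOpen F V) :
    q ∈ (toricOpenChart h c).source ↔ q.1 ∈ range (toricPoint F K c) := by
  unfold toricOpenChart
  rw [OpenPartialHomeomorph.subtypeRestr_source]
  rfl

theorem toricOpenChart_apply (q : toricOpen F V) :
    toricOpenChart h c q = toricHomeo F K c q.1 := rfl

theorem toricPoint_toricOpenChart {q : toricOpen F V} (hq : q ∈ (toricOpenChart h c).source) :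
    toricPoint F K c (toricOpenChart h c q) = q.1 :=
  (toricHomeo F K c).left_inv ((mem_toricOpenChart_source h c q).1 hq)

theorem sigmaZero_eq_monomialMap {q : toricOpen F V} (hq : q ∈ (toricOpenChart h c).source) :
    sigmaZero F V q = monomialMap K c (toricOpenChart h c q) := by
  rw [← toricMap_toricPoint_eq, toricPoint_toricOpenChart h c hq]
  rfl

/-- Where its Jacobian determinant does not vanish, the toric map is a coordinate system. -/
theorem exists_coordinateSystem_eq_sigmaZero [CompleteSpace K] {q : toricOpen F V}
    (hq : q ∈ (toricOpenChart h c).source)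
    (hdet : (fderiv K (monomialMap K c) (toricOpenChart h c q)).det ≠ 0) :
    ∃ χ ∈ coordinateSystems n K (toricOpen F V), q ∈ χ.source ∧
      ∀ q' ∈ χ.source, χ q' = sigmaZero F V q' := by
  obtain ⟨ψ, hψ, -, hψθ, h1, h2⟩ := AnalyticAt.exists_openPartialHomeomorph
    (analyticAt_monomialMap c (toricOpenChart h c q))
    ((fderiv K (monomialMap K c) (toricOpenChart h c q)).toContinuousLinearEquivOfDetNeZero hdet)
    (ContinuousLinearMap.coe_toContinuousLinearEquivOfDetNeZero _ _).symm univ_mem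
  refine ⟨(toricOpenChart h c).trans ψ,
    trans_mem_coordinateSystems (toricOpenChart_mem h c) h1 h2, ?_, ?_⟩
  · rw [OpenPartialHomeomorph.trans_source]
    exact ⟨hq, hψ⟩
  · intro q' hq'
    rw [OpenPartialHomeomorph.trans_source] at hq'
    rw [sigmaZero_eq_monomialMap h c hq'.1]
    exact hψθ _ hq'.2

/-- A local isomorphism is itself a coordinate system, and its transition from the toric chart is
the monomial map, whose differential is therefore invertible. The converse is the inverse function
theorem. -/
theorem isLocalDiffeomorphAt_sigmaZero_iff [CompleteSpace K] {q : toricOpen F V}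
    (hq : q ∈ (toricOpenChart h c).source) :
    IsLocalDiffeomorphAt 𝓘(K, Fin n → K) 𝓘(K, Fin n → K) ω (sigmaZero F V) q ↔
      (fderiv K (monomialMap K c) (toricOpenChart h c q)).det ≠ 0 := by
  constructor
  · rintro ⟨Ψ, hqΨ, heq⟩
    let χ := Ψ.toOpenPartialHomeomorph
    have hχ : χ ∈ coordinateSystems n K (toricOpen F V) :=
      mem_coordinateSystems_iff.2 ⟨Ψ.contMDiffOn_toFun, Ψ.contMDiffOn_invFun⟩
    have hφ := toricOpenChart_mem h c
    have hinv := fderiv_transition_fderiv_transition hφ hχ hq hqΨ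
    have heq' : (χ ∘ (toricOpenChart h c).symm) =ᶠ[𝓝 (toricOpenChart h c q)]
        monomialMap K c := by
      filter_upwards [(tendsto_symm_of_mem_source hq).eventually (χ.open_source.mem_nhds hqΨ),
        (toricOpenChart h c).open_target.mem_nhds ((toricOpenChart h c).map_source hq)] with y h1 h2
      change Ψ ((toricOpenChart h c).symm y) = _
      rw [← heq h1, sigmaZero_eq_monomialMap h c ((toricOpenChart h c).map_target h2),
        (toricOpenChart h c).right_inv h2]
    rw [heq'.fderiv_eq] at hinv
    have hcomp : (fderiv K ((toricOpenChart h c) ∘ χ.symm) (χ q) : (Fin n → K) →ₗ[K] _) ∘ₗ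
        (fderiv K (monomialMap K c) (toricOpenChart h c q) : (Fin n → K) →ₗ[K] _) =
        LinearMap.id := LinearMap.ext hinv
    have hdet := congrArg LinearMap.det hcomp
    rw [LinearMap.det_comp, LinearMap.det_id] at hdet
    exact right_ne_zero_of_mul (hdet.trans_ne one_ne_zero)
  · intro hdet
    obtain ⟨χ, hχ, hqχ, hχσ⟩ := exists_coordinateSystem_eq_sigmaZero h c hq hdet
    have hχ' := mem_coordinateSystems_iff.1 hχ
    exact ⟨{ toPartialEquiv := χ.toPartialEquiv
             open_source := χ.open_source
             open_target := χ.open_target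
             contMDiffOn_toFun := hχ'.1
             contMDiffOn_invFun := hχ'.2 }, hqχ, fun y hy => (hχσ y hy).symm⟩

theorem mem_exceptionalLocus_iff [CompleteSpace K] {q : toricOpen F V}
    (hq : q ∈ (toricOpenChart h c).source) :
    q ∈ exceptionalLocus n K (sigmaZero F V) ↔
      ∃ j, coneWeight c j ≠ 1 ∧ toricOpenChart h c q j = 0 := by
  change ¬ _ ↔ _
  rw [isLocalDiffeomorphAt_sigmaZero_iff h c hq, det_fderiv_monomialMap_ne_zero_iff]
  push Not
  rfl

/-- The torus is covered by the charts of every cone. -/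
theorem exists_monomialMap_eq (c : F.MaxCone) {x : Fin n → K} (hx : ∀ i, x i ≠ 0) :
    ∃ y : Fin n → K, monomialMap K c y = x := by
  refine ⟨fun j => ∏ i, x i ^ c.1.coord j (Pi.single i 1), ?_⟩
  funext i'
  unfold monomialMap
  have h1 : ∀ j, (∏ i, x i ^ c.1.coord j (Pi.single i 1)) ^ (c.1 j i').toNat =
      ∏ i, x i ^ (c.1.coord j (Pi.single i 1) * c.1 j i') := by
    intro j
    rw [← zpow_natCast, Int.toNat_of_nonneg (MaxCone_nonneg F c i' j), ← Finset.prod_zpow]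
    exact Finset.prod_congr rfl fun i _ => (zpow_mul _ _ _).symm
  simp only [h1]
  rw [Finset.prod_comm]
  have h2 : ∀ i, ∏ j, x i ^ (c.1.coord j (Pi.single i 1) * c.1 j i') =
      x i ^ (if i' = i then (1 : ℤ) else 0) := by
    intro i
    rw [← zpow_finset_sum (hx i)]
    congr 1
    have h := congrFun (c.1.sum_repr (Pi.single i 1)) i'
    rw [Finset.sum_apply] at h
    simp only [Pi.smul_apply, smul_eq_mul, Pi.single_apply] at h
    exact h
  simp only [h2]
  rw [Finset.prod_eq_single i']
  · simp
  · intro i _ hi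
    rw [if_neg (Ne.symm hi), zpow_zero]
  · simp

end Exceptional

/-! ### Faces of the Newton polyhedron -/

section Newton

variable {n : ℕ}

theorem expVec_mem_newtonPolyhedron {G : Set (Fin n →₀ ℕ)} {m : Fin n →₀ ℕ} (hm : m ∈ G) :
    expVec m ∈ newtonPolyhedron G :=
  subset_convexHull ℝ _ (mem_iUnion₂.2 ⟨m, hm, le_refl (expVec m)⟩)

theorem dotProduct_le_of_le {a x y : Fin n → ℝ} (ha : 0 ≤ a) (h : x ≤ y) : a ⬝ᵥ x ≤ a ⬝ᵥ y :=
  Finset.sum_le_sum fun i _ => mul_le_mul_of_nonneg_left (h i) (ha i)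

theorem convex_dotProduct_ge (a : Fin n → ℝ) (r : ℝ) : Convex ℝ {x | r ≤ a ⬝ᵥ x} := by
  intro x hx y hy s t hs ht hst
  simp only [mem_ofPred_eq, dotProduct_add, dotProduct_smul, smul_eq_mul] at *
  have h1 := mul_le_mul_of_nonneg_left hx hs
  have h2 := mul_le_mul_of_nonneg_left hy ht
  have h3 : s * r + t * r = r := by rw [← add_mul, hst, one_mul]
  linarith

theorem le_dotProduct_of_mem_newtonPolyhedron {G : Set (Fin n →₀ ℕ)} {a : Fin n → ℝ} (ha : 0 ≤ a)
    {r : ℝ} (h : ∀ m ∈ G, r ≤ a ⬝ᵥ expVec m) {x : Fin n → ℝ} (hx : x ∈ newtonPolyhedron G) :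
    r ≤ a ⬝ᵥ x := by
  refine convexHull_min (iUnion₂_subset fun m hm => ?_) (convex_dotProduct_ge a r) hx
  intro y hy
  exact (h m hm).trans (dotProduct_le_of_le ha hy)

theorem expVec_mem_firstMeet_iff {G : Set (Fin n →₀ ℕ)} {a : Fin n → ℝ} (ha : 0 ≤ a)
    {m : Fin n →₀ ℕ} (hm : m ∈ G) :
    expVec m ∈ firstMeet (newtonPolyhedron G) a ↔
      ∀ m' ∈ G, a ⬝ᵥ expVec m ≤ a ⬝ᵥ expVec m' :=
  ⟨fun h _ hm' => h.2 _ (expVec_mem_newtonPolyhedron hm'), fun h =>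
    ⟨expVec_mem_newtonPolyhedron hm, fun _ hy => le_dotProduct_of_mem_newtonPolyhedron ha h hy⟩⟩

theorem isFace_firstMeet {Γ : Set (Fin n → ℝ)} {a : Fin n → ℝ} (h : (firstMeet Γ a).Nonempty) :
    IsFace Γ (firstMeet Γ a) := by
  refine ⟨h, fun _ => ⟨-(LinearMap.toContinuousLinearMap
    (dotProductBilin ℝ ℝ a : (Fin n → ℝ) →ₗ[ℝ] ℝ)), ?_⟩⟩
  ext x
  simp [firstMeet]

theorem finite_dotProduct_eq {a : Fin n → ℝ} (ha : ∀ i, 0 < a i) (d : ℝ) :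
    {m : Fin n →₀ ℕ | a ⬝ᵥ expVec m = d}.Finite := by
  refine (Set.finite_Iic (Finsupp.equivFunOnFinite.symm fun i => ⌊d / a i⌋₊)).subset ?_
  intro m hm i
  simp only [Finsupp.equivFunOnFinite_symm_apply_apply]
  apply Nat.le_floor
  rw [le_div_iff₀ (ha i), ← hm, mul_comm]
  exact Finset.single_le_sum (f := fun i => a i * expVec m i)
    (fun j _ => mul_nonneg (ha j).le (Nat.cast_nonneg _)) (Finset.mem_univ i)

/-- The first meet locus of a strictly positive functional is compact. -/
theorem isCompact_firstMeet {G : Set (Fin n →₀ ℕ)} {a : Fin n → ℝ} (ha : ∀ i, 0 < a i)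
    {m₀ : Fin n →₀ ℕ} (hm₀ : m₀ ∈ G) (hmin : ∀ m ∈ G, a ⬝ᵥ expVec m₀ ≤ a ⬝ᵥ expVec m) :
    IsCompact (firstMeet (newtonPolyhedron G) a) := by
  have ha0 : 0 ≤ a := fun i => (ha i).le
  set d := a ⬝ᵥ expVec m₀ with hd
  let H : Set (Fin n → ℝ) := expVec '' {m | m ∈ G ∧ a ⬝ᵥ expVec m = d}
  have hH : H.Finite := ((finite_dotProduct_eq ha d).subset fun m hm => hm.2).image _
  have hle : ∀ x ∈ newtonPolyhedron G, d ≤ a ⬝ᵥ x := fun x hx =>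
    le_dotProduct_of_mem_newtonPolyhedron ha0 hmin hx
  -- This set is convex: equality a ⬝ᵥ x = d at a proper convex combination forces equality at both
  -- ends. It contains every translated orthant, because positivity of a leaves only the vertex on
  -- the level d. So it contains the polyhedron, and the first meet locus is the hull of the finite
  -- set H.
  let C : Set (Fin n → ℝ) := {x | d ≤ a ⬝ᵥ x ∧ (a ⬝ᵥ x = d → x ∈ convexHull ℝ H)}
  have hC : Convex ℝ C := by
    rintro x ⟨hx, hx'⟩ y ⟨hy, hy'⟩ s t hs ht hst
    refine ⟨convex_dotProduct_ge a d hx hy hs ht hst, fun h => ?_⟩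
    rcases hs.eq_or_lt with rfl | hs'
    · have : t = 1 := by linarith
      subst this
      simp only [zero_smul, one_smul, zero_add] at h ⊢
      exact hy' h
    rcases ht.eq_or_lt with rfl | ht'
    · have : s = 1 := by linarith
      subst this
      simp only [zero_smul, one_smul, add_zero] at h ⊢
      exact hx' h
    rw [dotProduct_add, dotProduct_smul, dotProduct_smul, smul_eq_mul, smul_eq_mul] at h
    have h3 : s * d + t * d = d := by rw [← add_mul, hst, one_mul]
    have hx1 := mul_le_mul_of_nonneg_left hx hs
    have hy1 := mul_le_mul_of_nonneg_left hy ht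
    have h1 : a ⬝ᵥ x = d := by
      apply mul_left_cancel₀ hs'.ne'
      linarith
    have h2 : a ⬝ᵥ y = d := by
      apply mul_left_cancel₀ ht'.ne'
      linarith
    exact convex_convexHull ℝ H (hx' h1) (hy' h2) hs ht hst
  have hΓC : newtonPolyhedron G ⊆ C := by
    refine convexHull_min (iUnion₂_subset fun m hm x hx => ?_) hC
    have h1 : a ⬝ᵥ expVec m ≤ a ⬝ᵥ x := dotProduct_le_of_le ha0 hx
    refine ⟨(hmin m hm).trans h1, fun h => ?_⟩
    have h2 : a ⬝ᵥ expVec m = d := le_antisymm (h1.trans_eq h) (hmin m hm)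
    have h3 : ∑ i, a i * (x i - expVec m i) = 0 := by
      simp only [mul_sub, Finset.sum_sub_distrib]
      exact sub_eq_zero.2 (h.trans h2.symm)
    have h4 := (Finset.sum_eq_zero_iff_of_nonneg
      (fun i _ => mul_nonneg (ha i).le (sub_nonneg.2 (hx i)))).1 h3
    have h5 : x = expVec m := by
      funext i
      have := (mul_eq_zero.1 (h4 i (Finset.mem_univ i))).resolve_left (ha i).ne'
      linarith
    exact subset_convexHull ℝ _ ⟨m, ⟨hm, h2⟩, h5.symm⟩
  have heq : firstMeet (newtonPolyhedron G) a = convexHull ℝ H := by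
    apply Subset.antisymm
    · rintro x ⟨hx, hx'⟩
      exact (hΓC hx).2 (le_antisymm (hx' _ (expVec_mem_newtonPolyhedron hm₀)) (hle x hx))
    · intro x hx
      have h1 : x ∈ newtonPolyhedron G :=
        convexHull_min (image_subset_iff.2 fun m hm => expVec_mem_newtonPolyhedron hm.1)
          (convex_convexHull ℝ _) hx
      have h2 : -d ≤ (-a) ⬝ᵥ x := by
        refine convexHull_min (image_subset_iff.2 fun m hm => ?_) (convex_dotProduct_ge (-a) (-d)) hx
        simp only [mem_preimage, mem_ofPred_eq, neg_dotProduct, hm.2, le_refl]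
      rw [neg_dotProduct] at h2
      exact ⟨h1, fun y hy => (neg_le_neg_iff.1 h2).trans (hle y hy)⟩
  rw [heq]
  exact hH.isCompact_convexHull (𝕜 := ℝ)

/-! ### Weights of exponents -/

variable {F : SimpleFan n}

/-- The pairing of a generator of a cone with an exponent. -/
def coneDot (c : F.MaxCone) (j : Fin n) (m : Fin n →₀ ℕ) : ℕ := ∑ i, (c.1 j i).toNat * m i

theorem realVec_dotProduct_expVec (c : F.MaxCone) (j : Fin n) (m : Fin n →₀ ℕ) :
    realVec (c.1 j) ⬝ᵥ expVec m = coneDot c j m := by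
  unfold coneDot
  push_cast
  refine Finset.sum_congr rfl fun i _ => ?_
  have : ((c.1 j i : ℤ) : ℝ) = ((c.1 j i).toNat : ℝ) := by
    rw [← Int.cast_natCast, Int.toNat_of_nonneg (MaxCone_nonneg F c i j)]
  change ((c.1 j i : ℤ) : ℝ) * _ = _
  rw [this]
  rfl

theorem realVec_nonneg (c : F.MaxCone) (j : Fin n) : 0 ≤ realVec (c.1 j) := fun i =>
  Int.cast_nonneg (MaxCone_nonneg F c i j)

theorem sum_smul_dotProduct_expVec (c : F.MaxCone) (I : Finset (Fin n)) (r : Fin n → ℝ)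
    (m : Fin n →₀ ℕ) :
    (∑ j ∈ I, r j • realVec (c.1 j)) ⬝ᵥ expVec m = ∑ j ∈ I, r j * coneDot c j m := by
  rw [sum_dotProduct]
  exact Finset.sum_congr rfl fun j _ => by
    rw [smul_dotProduct, realVec_dotProduct_expVec, smul_eq_mul]

/-- If the fan is subordinated to the Newton polyhedron, some exponent minimizes all generators of
a cone at once. -/
theorem exists_forall_coneDot_le {G : Set (Fin n →₀ ℕ)} (hG : G.Nonempty)
    (hF : F.Subordinated (newtonPolyhedron G)) (c : F.MaxCone) :
    ∃ m₀ ∈ G, ∀ m ∈ G, ∀ j, coneDot c j m₀ ≤ coneDot c j m := by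
  classical
  obtain ⟨m₀, hm₀, hmin⟩ : ∃ m₀ ∈ G, ∀ m ∈ G, ∑ j, coneDot c j m₀ ≤ ∑ j, coneDot c j m := by
    let w : (Fin n →₀ ℕ) → ℕ := fun m => ∑ j, coneDot c j m
    exact ⟨Function.argminOn w G hG, Function.argminOn_mem w G hG,
      fun m hm => Function.argminOn_le w G hm⟩
  have hnn : ∀ r : Fin n → ℝ, (∀ j, 0 < r j) → 0 ≤ ∑ j, r j • realVec (c.1 j) := fun r hr =>
    Finset.sum_nonneg fun j _ => smul_nonneg (hr j).le (realVec_nonneg c j)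
  have h1 : expVec m₀ ∈ firstMeet (newtonPolyhedron G)
      (∑ j, (fun _ => (1 : ℝ)) j • realVec (c.1 j)) := by
    rw [expVec_mem_firstMeet_iff (hnn _ fun _ => one_pos) hm₀]
    intro m hm
    rw [sum_smul_dotProduct_expVec, sum_smul_dotProduct_expVec]
    simp only [one_mul]
    exact_mod_cast hmin m hm
  refine ⟨m₀, hm₀, fun m hm j₀ => ?_⟩
  by_contra! hlt
  -- The exponent m₀ minimises the sum of all generators, hence every positive combination, since
  -- the first meet locus is constant on the open cone. With weight 1 on j₀ and 1 / (B + 1)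
  -- elsewhere, the other generators give m less than 1 in total and cannot make up for an integral
  -- deficit in j₀.
  let B : ℝ := ∑ j ∈ Finset.univ.erase j₀, (coneDot c j m : ℝ)
  have hB : 0 ≤ B := Finset.sum_nonneg fun _ _ => Nat.cast_nonneg _
  let r : Fin n → ℝ := fun j => if j = j₀ then 1 else 1 / (B + 1)
  have hr : ∀ j, 0 < r j := by
    intro j
    simp only [r]
    split_ifs <;> positivity
  rw [hF _ c.2 _ (sum_mem_openCone c.1 Finset.univ fun _ _ => one_pos) _
    (sum_mem_openCone c.1 Finset.univ (r := r) fun j _ => hr j),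
    expVec_mem_firstMeet_iff (hnn _ hr) hm₀] at h1
  have h2 := h1 m hm
  rw [sum_smul_dotProduct_expVec, sum_smul_dotProduct_expVec,
    ← Finset.add_sum_erase _ _ (Finset.mem_univ j₀),
    ← Finset.add_sum_erase _ _ (Finset.mem_univ j₀)] at h2
  have h3 : ∀ m', ∑ j ∈ Finset.univ.erase j₀, r j * (coneDot c j m' : ℝ) =
      1 / (B + 1) * ∑ j ∈ Finset.univ.erase j₀, (coneDot c j m' : ℝ) := by
    intro m'
    rw [Finset.mul_sum]
    refine Finset.sum_congr rfl fun j hj => ?_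
    simp only [r, if_neg (Finset.ne_of_mem_erase hj)]
  rw [h3, h3] at h2
  have h4 : r j₀ = 1 := if_pos rfl
  have h5 : (0 : ℝ) ≤ 1 / (B + 1) * ∑ j ∈ Finset.univ.erase j₀, (coneDot c j m₀ : ℝ) := by
    have : (0 : ℝ) ≤ ∑ j ∈ Finset.univ.erase j₀, (coneDot c j m₀ : ℝ) :=
      Finset.sum_nonneg fun _ _ => Nat.cast_nonneg _
    positivity
  have h6 : 1 / (B + 1) * B < 1 := by
    rw [one_div_mul_eq_div, div_lt_one (by positivity)]
    linarith
  have h7 : (coneDot c j₀ m : ℝ) + 1 ≤ coneDot c j₀ m₀ := by exact_mod_cast hlt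
  rw [h4, one_mul, one_mul] at h2
  change _ ≤ (coneDot c j₀ m : ℝ) + 1 / (B + 1) * B at h2
  linarith

/-- The face cut out by some generators of a cone. -/
def coneFace (G : Set (Fin n →₀ ℕ)) (c : F.MaxCone) (I : Finset (Fin n)) : Set (Fin n → ℝ) :=
  firstMeet (newtonPolyhedron G) (∑ j ∈ I, realVec (c.1 j))

/-- As m₀ minimises each generator separately, a sum of generators is minimal at m exactly when
every summand is. -/
theorem expVec_mem_coneFace_iff {G : Set (Fin n →₀ ℕ)} {c : F.MaxCone} (I : Finset (Fin n))
    {m₀ : Fin n →₀ ℕ} (hm₀ : m₀ ∈ G) (hmin : ∀ m ∈ G, ∀ j, coneDot c j m₀ ≤ coneDot c j m)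
    {m : Fin n →₀ ℕ} (hm : m ∈ G) :
    expVec m ∈ coneFace G c I ↔ ∀ j ∈ I, coneDot c j m = coneDot c j m₀ := by
  have hnn : 0 ≤ ∑ j ∈ I, realVec (c.1 j) := Finset.sum_nonneg fun j _ => realVec_nonneg c j
  have hval : ∀ m', (∑ j ∈ I, realVec (c.1 j)) ⬝ᵥ expVec m' = ((∑ j ∈ I, coneDot c j m' : ℕ) : ℝ) := by
    intro m'
    simpa using sum_smul_dotProduct_expVec c I (fun _ => 1) m'
  unfold coneFace
  rw [expVec_mem_firstMeet_iff hnn hm]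
  simp only [hval, Nat.cast_le]
  constructor
  · intro h j hj
    have h1 := h m₀ hm₀
    exact (((Finset.sum_eq_sum_iff_of_le fun j _ => hmin m hm j).1
      (le_antisymm (Finset.sum_le_sum fun j _ => hmin m hm j) h1)) j hj).symm
  · intro h m' hm'
    rw [Finset.sum_congr rfl h]
    exact Finset.sum_le_sum fun j _ => hmin m' hm' j

theorem isFace_coneFace {G : Set (Fin n →₀ ℕ)} {c : F.MaxCone} (I : Finset (Fin n))
    {m₀ : Fin n →₀ ℕ} (hm₀ : m₀ ∈ G) (hmin : ∀ m ∈ G, ∀ j, coneDot c j m₀ ≤ coneDot c j m) :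
    IsFace (newtonPolyhedron G) (coneFace G c I) :=
  isFace_firstMeet ⟨expVec m₀, (expVec_mem_coneFace_iff I hm₀ hmin hm₀).2 fun _ _ => rfl⟩

/-- The condition `hI` says that the sum of the generators in I has positive entries only. -/
theorem isCompact_coneFace {G : Set (Fin n →₀ ℕ)} {c : F.MaxCone} {I : Finset (Fin n)}
    (hI : ∀ i, ∃ j ∈ I, c.1 j i ≠ 0)
    {m₀ : Fin n →₀ ℕ} (hm₀ : m₀ ∈ G) (hmin : ∀ m ∈ G, ∀ j, coneDot c j m₀ ≤ coneDot c j m) :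
    IsCompact (coneFace G c I) := by
  have hnn : 0 ≤ ∑ j ∈ I, realVec (c.1 j) := Finset.sum_nonneg fun j _ => realVec_nonneg c j
  refine isCompact_firstMeet (fun i => ?_) hm₀ ?_
  · obtain ⟨j, hj, hji⟩ := hI i
    rw [Finset.sum_apply]
    refine Finset.sum_pos' (fun j _ => realVec_nonneg c j i) ⟨j, hj, ?_⟩
    exact Int.cast_pos.2 (lt_of_le_of_ne (MaxCone_nonneg F c i j) (Ne.symm hji))
  · exact (expVec_mem_firstMeet_iff hnn hm₀).1
      ((expVec_mem_coneFace_iff I hm₀ hmin hm₀).2 fun _ _ => rfl)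

theorem finite_coneFace {G : Set (Fin n →₀ ℕ)} {c : F.MaxCone} {I : Finset (Fin n)}
    (hI : ∀ i, ∃ j ∈ I, c.1 j i ≠ 0) {m₀ : Fin n →₀ ℕ} (hm₀ : m₀ ∈ G)
    (hmin : ∀ m ∈ G, ∀ j, coneDot c j m₀ ≤ coneDot c j m) :
    {m | m ∈ G ∧ expVec m ∈ coneFace G c I}.Finite := by
  refine (finite_dotProduct_eq (a := ∑ j ∈ I, realVec (c.1 j)) (fun i => ?_)
    ((∑ j ∈ I, coneDot c j m₀ : ℕ) : ℝ)).subset ?_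
  · obtain ⟨j, hj, hji⟩ := hI i
    rw [Finset.sum_apply]
    refine Finset.sum_pos' (fun j _ => realVec_nonneg c j i) ⟨j, hj, ?_⟩
    exact Int.cast_pos.2 (lt_of_le_of_ne (MaxCone_nonneg F c i j) (Ne.symm hji))
  · rintro m ⟨hm, hmτ⟩
    rw [expVec_mem_coneFace_iff I hm₀ hmin hm] at hmτ
    have := sum_smul_dotProduct_expVec c I (fun _ => 1) m
    simp only [one_smul, one_mul] at this
    rw [mem_ofPred_eq, this]
    push_cast
    exact Finset.sum_congr rfl fun j hj => by rw [hmτ j hj]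

theorem prod_monomialMap_pow {K : Type*} [Field K] (c : F.MaxCone) (y : Fin n → K)
    (m : Fin n →₀ ℕ) : ∏ i, monomialMap K c y i ^ m i = ∏ j, y j ^ coneDot c j m := by
  unfold monomialMap coneDot
  simp only [← Finset.prod_pow]
  rw [Finset.prod_comm]
  refine Finset.prod_congr rfl fun j _ => ?_
  rw [← Finset.prod_pow_eq_pow_sum]
  exact Finset.prod_congr rfl fun i _ => (pow_mul _ _ _).symm

end Newton

/-! ### Division by monomials -/

section Division

variable {n : ℕ} {K : Type*} [NontriviallyNormedField K]

theorem eventually_update {b : Fin n → K} {i : Fin n} (hb : b i = 0) {P : (Fin n → K) → Prop}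
    (hP : ∀ᶠ y in 𝓝 b, P y) : ∀ᶠ y in 𝓝 b, ∀ᶠ s in 𝓝 (0 : K), P (Function.update y i s) := by
  have hcont : Continuous fun q : (Fin n → K) × K => Function.update q.1 i q.2 :=
    continuous_fst.update i continuous_snd
  have ht := hcont.tendsto (b, (0 : K))
  have hb' : Function.update b i (0 : K) = b := by rw [← hb, Function.update_eq_self]
  simp only [hb'] at ht
  have := ht.eventually hP
  rw [nhds_prod_eq] at this
  exact this.curry

/-- Division of an analytic function by a power of a coordinate. -/
theorem AnalyticAt.exists_eq_coord_pow_mul [CompleteSpace K] {b : Fin n → K} {i : Fin n}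
    (hb : b i = 0) (N : ℕ) {F : (Fin n → K) → K} (hF : AnalyticAt K F b)
    (h : ∀ᶠ y in 𝓝 b, (∀ j ≠ i, y j ≠ 0) →
      ∃ C : ℝ, ∀ᶠ s in 𝓝[≠] (0 : K), ‖F (Function.update y i s)‖ ≤ C * ‖s‖ ^ N) :
    ∃ w : (Fin n → K) → K, AnalyticAt K w b ∧ ∀ᶠ y in 𝓝 b, F y = y i ^ N * w y := by
  classical
  induction N generalizing F with
  | zero => exact ⟨F, hF, by simp⟩
  | succ N ih =>
    -- The growth bound is only available where the other coordinates are nonzero, as the induction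
    -- over several coordinates requires. Other points of the hyperplane are reached along γ, which
    -- moves their vanishing coordinates to t ≠ 0.
    have hzero : ∀ᶠ x in 𝓝 b, x i = 0 → F x = 0 := by
      have hcont : ∀ᶠ y in 𝓝 b, ContinuousAt F y :=
        hF.eventually_analyticAt.mono fun _ h => h.continuousAt
      filter_upwards [(h.and hcont).eventually_nhds, hcont] with x hx hxc hxi
      let γ : K → Fin n → K := fun t j => if j ≠ i ∧ x j = 0 then t else x j
      have hγ : Tendsto γ (𝓝[≠] 0) (𝓝 x) := by
        refine tendsto_pi_nhds.2 fun j => ?_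
        by_cases hj : j ≠ i ∧ x j = 0
        · simp only [γ, if_pos hj]
          rw [hj.2]
          exact tendsto_id.mono_left nhdsWithin_le_nhds
        · simp only [γ, if_neg hj]
          exact tendsto_const_nhds
      have hFγ : ∀ᶠ t in 𝓝[≠] (0 : K), F (γ t) = 0 := by
        filter_upwards [hγ.eventually hx, self_mem_nhdsWithin] with t ht ht0
        obtain ⟨C, hC⟩ := ht.1 fun j hj => by
          simp only [γ]
          split_ifs with h'
          · exact ht0
          · exact fun h0 => h' ⟨hj, h0⟩
        have hγi : γ t i = 0 := by simp [γ, hxi]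
        have hup : Tendsto (fun s : K => Function.update (γ t) i s) (𝓝[≠] 0) (𝓝 (γ t)) := by
          have hc : Continuous fun s : K => Function.update (γ t) i s :=
            continuous_const.update i continuous_id
          have := hc.tendsto 0
          rw [← hγi, Function.update_eq_self, hγi] at this
          exact this.mono_left nhdsWithin_le_nhds
        have h1 : Tendsto (fun s : K => F (Function.update (γ t) i s)) (𝓝[≠] 0) (𝓝 (F (γ t))) :=
          ht.2.tendsto.comp hup
        have h2 : Tendsto (fun s : K => F (Function.update (γ t) i s)) (𝓝[≠] 0) (𝓝 0) := by
          refine squeeze_zero_norm' hC ?_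
          have hc : Continuous fun s : K => C * ‖s‖ ^ (N + 1) := by fun_prop
          have := hc.tendsto 0
          simp only [norm_zero, ne_eq, Nat.add_eq_zero_iff, one_ne_zero, and_false,
            not_false_eq_true, zero_pow, mul_zero] at this
          exact this.mono_left nhdsWithin_le_nhds
        exact tendsto_nhds_unique h1 h2
      have h3 : Tendsto (fun t => F (γ t)) (𝓝[≠] 0) (𝓝 (F x)) := hxc.tendsto.comp hγ
      exact (tendsto_nhds_unique (tendsto_const_nhds.congr' (hFγ.mono fun _ h => h.symm)) h3).symm
    obtain ⟨w₁, hw₁, hFw⟩ := AnalyticAt.exists_eq_coord_mul hF i hb hzero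
    obtain ⟨w, hw, hw₁w⟩ := ih hw₁ (by
      filter_upwards [h, eventually_update hb hFw] with y hy hyF hj
      obtain ⟨C, hC⟩ := hy hj
      refine ⟨C, ?_⟩
      filter_upwards [hC, nhdsWithin_le_nhds hyF, self_mem_nhdsWithin] with s hs hsF hs0
      rw [hsF, Function.update_self, norm_mul, pow_succ] at hs
      have hs0' : 0 < ‖s‖ := norm_pos_iff.2 hs0
      have : ‖s‖ * ‖w₁ (Function.update y i s)‖ ≤ ‖s‖ * (C * ‖s‖ ^ N) := by linarith
      exact le_of_mul_le_mul_left this hs0')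
    refine ⟨w, hw, ?_⟩
    filter_upwards [hFw, hw₁w] with y h1 h2
    rw [h1, h2, pow_succ]
    ring

/-- Division of an analytic function by a monomial. -/
theorem AnalyticAt.exists_eq_monomial_mul [CompleteSpace K] {b : Fin n → K} (I : Finset (Fin n))
    (hb : ∀ i ∈ I, b i = 0) (N : Fin n → ℕ) {F : (Fin n → K) → K} (hF : AnalyticAt K F b)
    (h : ∀ i ∈ I, ∀ᶠ y in 𝓝 b,
      ∃ C : ℝ, ∀ᶠ s in 𝓝[≠] (0 : K), ‖F (Function.update y i s)‖ ≤ C * ‖s‖ ^ N i) :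
    ∃ w : (Fin n → K) → K, AnalyticAt K w b ∧
      ∀ᶠ y in 𝓝 b, F y = (∏ i ∈ I, y i ^ N i) * w y := by
  classical
  induction I using Finset.induction_on with
  | empty => exact ⟨F, hF, by simp⟩
  | insert i S hi ih =>
    obtain ⟨w₁, hw₁, hFw⟩ := ih (fun j hj => hb j (Finset.mem_insert_of_mem hj))
      fun j hj => h j (Finset.mem_insert_of_mem hj)
    have hbi := hb i (Finset.mem_insert_self i S)
    obtain ⟨w, hw, hw₁w⟩ := AnalyticAt.exists_eq_coord_pow_mul hbi (N i) hw₁ (by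
      filter_upwards [h i (Finset.mem_insert_self i S), eventually_update hbi hFw] with y hy hyF hj
      obtain ⟨C, hC⟩ := hy
      have hne : ∏ k ∈ S, y k ^ N k ≠ 0 := Finset.prod_ne_zero_iff.2 fun k hk =>
        pow_ne_zero _ (hj k fun h => hi (h ▸ hk))
      -- The bound for F passes to the quotient w₁ at points whose coordinates in S are nonzero; the
      -- constant may depend on y.
      refine ⟨C / ‖∏ k ∈ S, y k ^ N k‖, ?_⟩
      filter_upwards [hC, nhdsWithin_le_nhds hyF] with s hs hsF
      have h1 : ∏ k ∈ S, Function.update y i s k ^ N k = ∏ k ∈ S, y k ^ N k :=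
        Finset.prod_congr rfl fun k hk => by
          rw [Function.update_of_ne (ne_of_mem_of_not_mem hk hi)]
      rw [hsF, h1, norm_mul] at hs
      rw [div_mul_eq_mul_div, le_div_iff₀ (norm_pos_iff.2 hne)]
      linarith)
    refine ⟨w, hw, ?_⟩
    filter_upwards [hFw, hw₁w] with y h1 h2
    rw [h1, h2, Finset.prod_insert hi]
    ring

end Division

/-! ### Orders of vanishing of power series over ultrametric fields -/

section Ultrametric

variable {n : ℕ} {K : Type*} [NontriviallyNormedField K] [IsUltrametricDist K]

theorem HasSum.norm_le_of_forall_norm_le {ι : Type*} [Nonempty ι] {u : ι → K} {a : K}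
    (h : HasSum u a) {C : ℝ} (hC : ∀ m, ‖u m‖ ≤ C) : ‖a‖ ≤ C := by
  rw [← h.tsum_eq]
  exact IsUltrametricDist.norm_tsum_le_of_forall_le hC

/-- A series in one variable with terms of degree at least `N` is `O(s ^ N)`. -/
theorem exists_norm_le_of_hasSum {ι : Type*} [Nonempty ι] {u : ι → K} {e : ι → ℕ} {N : ℕ}
    {g : K → K} (hu : ∀ m, u m ≠ 0 → N ≤ e m)
    (h : ∀ᶠ s in 𝓝[≠] (0 : K), HasSum (fun m => u m * s ^ e m) (g s)) :
    ∃ C : ℝ, ∀ᶠ s in 𝓝[≠] (0 : K), ‖g s‖ ≤ C * ‖s‖ ^ N := by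
  -- Convergence at one s₀ ≠ 0 bounds all terms by a constant. For |s| < |s₀| they shrink by at
  -- least |s / s₀| ^ N, and the ultrametric inequality bounds the sum by the same quantity.
  obtain ⟨s₀, hs₀, hs₀0⟩ := (h.and self_mem_nhdsWithin).exists
  have hs₀0 : s₀ ≠ 0 := hs₀0
  obtain ⟨C₀, hC₀⟩ := (hs₀.summable.tendsto_cofinite_zero.norm).bddAbove_range_of_cofinite
  have hC₀ : ∀ m, ‖u m * s₀ ^ e m‖ ≤ C₀ := fun m => hC₀ (mem_range_self m)
  have hC₀0 : 0 ≤ C₀ := (norm_nonneg _).trans (hC₀ (Classical.arbitrary ι))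
  have hpos : 0 < ‖s₀‖ := norm_pos_iff.2 hs₀0
  refine ⟨C₀ / ‖s₀‖ ^ N, ?_⟩
  have hball : ∀ᶠ s in 𝓝[≠] (0 : K), ‖s‖ < ‖s₀‖ := nhdsWithin_le_nhds
    ((continuous_norm.tendsto' (0 : K) 0 norm_zero).eventually (gt_mem_nhds hpos))
  filter_upwards [h, hball] with s hs hlt
  refine HasSum.norm_le_of_forall_norm_le hs fun m => ?_
  by_cases hm : u m = 0
  · rw [hm, zero_mul, norm_zero]
    positivity
  have h1 : u m * s ^ e m = (u m * s₀ ^ e m) * (s / s₀) ^ e m := by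
    rw [div_pow]
    field_simp
  have h2 : ‖s / s₀‖ ≤ 1 := by
    rw [norm_div]
    exact div_le_one_of_le₀ hlt.le hpos.le
  calc ‖u m * s ^ e m‖ = ‖u m * s₀ ^ e m‖ * ‖s / s₀‖ ^ e m := by rw [h1, norm_mul, norm_pow]
    _ ≤ C₀ * ‖s / s₀‖ ^ N :=
        mul_le_mul (hC₀ m) (pow_le_pow_of_le_one (norm_nonneg _) h2 (hu m hm))
          (by positivity) hC₀0
    _ = C₀ / ‖s₀‖ ^ N * ‖s‖ ^ N := by rw [norm_div, div_pow]; ring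

variable {ι : Type*} [Nonempty ι] {a : ι → K} {M : ι → Fin n → ℕ} {F : (Fin n → K) → K}
  {b : Fin n → K}

/-- On the line through y in direction i the series becomes one in the single variable s with
exponents M m i. -/
theorem exists_norm_update_le {i : Fin n} (hb : b i = 0)
    (hsum : ∀ᶠ y in 𝓝 b, HasSum (fun m => a m * ∏ j, y j ^ M m j) (F y)) {N : ℕ}
    (hN : ∀ m, a m ≠ 0 → N ≤ M m i) :
    ∀ᶠ y in 𝓝 b, ∃ C : ℝ, ∀ᶠ s in 𝓝[≠] (0 : K), ‖F (Function.update y i s)‖ ≤ C * ‖s‖ ^ N := by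
  classical
  filter_upwards [eventually_update hb hsum] with y hy
  refine exists_norm_le_of_hasSum (u := fun m => a m * ∏ j ∈ Finset.univ.erase i, y j ^ M m j)
    (e := fun m => M m i) (fun m hm => hN m (left_ne_zero_of_mul hm)) ?_
  filter_upwards [nhdsWithin_le_nhds hy] with s hs
  convert hs using 2 with m
  rw [← Finset.mul_prod_erase _ _ (Finset.mem_univ i), Function.update_self, mul_assoc,
    mul_comm (s ^ _)]
  congr 2
  exact Finset.prod_congr rfl fun j hj => by rw [Function.update_of_ne (Finset.ne_of_mem_erase hj)]

/-- The quotient of a power series by the monomial of minimal exponents. -/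
theorem exists_eq_monomial_mul_of_hasSum [CompleteSpace K] (I : Finset (Fin n))
    (hb : ∀ i ∈ I, b i = 0) (hF : AnalyticAt K F b)
    (hsum : ∀ᶠ y in 𝓝 b, HasSum (fun m => a m * ∏ j, y j ^ M m j) (F y)) {N : Fin n → ℕ}
    (hN : ∀ m, a m ≠ 0 → ∀ i ∈ I, N i ≤ M m i) {A : Finset ι}
    (hA : ∀ m, a m ≠ 0 → (m ∈ A ↔ ∀ i ∈ I, M m i = N i)) :
    ∃ g : (Fin n → K) → K, AnalyticAt K g b ∧
      (∀ᶠ y in 𝓝 b, F y = (∏ i ∈ I, y i ^ N i) * g y) ∧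
      ∀ᶠ y in 𝓝 b, (∀ i ∈ I, y i = 0) → g y = ∑ m ∈ A, a m * ∏ j ∈ Iᶜ, y j ^ M m j := by
  classical
  obtain ⟨g, hg, hFg⟩ := AnalyticAt.exists_eq_monomial_mul I hb N hF
    fun i hi => exists_norm_update_le (hb i hi) hsum fun m hm => hN m hm i hi
  refine ⟨g, hg, hFg, ?_⟩
  filter_upwards [hsum.eventually_nhds, hFg.eventually_nhds, hg.eventually_analyticAt] with
    y hy hyg hyc hyI
  let γ : K → Fin n → K := fun t j => if j ∈ I then t else y j
  have hγ : Tendsto γ (𝓝[≠] 0) (𝓝 y) := by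
    refine tendsto_pi_nhds.2 fun j => ?_
    by_cases hj : j ∈ I
    · simp only [γ, if_pos hj]
      rw [hyI j hj]
      exact tendsto_id.mono_left nhdsWithin_le_nhds
    · simp only [γ, if_neg hj]
      exact tendsto_const_nhds
  have hprod : ∀ (t : K) (e : Fin n → ℕ),
      ∏ j, γ t j ^ e j = t ^ (∑ j ∈ I, e j) * ∏ j ∈ Iᶜ, y j ^ e j := by
    intro t e
    rw [← Finset.prod_mul_prod_compl I, ← Finset.prod_pow_eq_pow_sum]
    congr 1
    · exact Finset.prod_congr rfl fun j hj => by simp only [γ, if_pos hj]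
    · exact Finset.prod_congr rfl fun j hj => by
        simp only [γ, if_neg (Finset.mem_compl.1 hj)]
  set P := ∑ m ∈ A, a m * ∏ j ∈ Iᶜ, y j ^ M m j with hP
  set d := ∑ j ∈ I, N j with hd
  -- Along γ the terms in A give t ^ d * P, and every other nonzero term has degree at least d + 1.
  -- Division by t ^ d gives g (γ t) = P + O(t).
  obtain ⟨C, hC⟩ := exists_norm_le_of_hasSum (N := d + 1)
    (u := fun m => (if m ∈ A then 0 else a m) * ∏ j ∈ Iᶜ, y j ^ M m j)
    (e := fun m => ∑ j ∈ I, M m j) (g := fun t => F (γ t) - t ^ d * P) (by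
      intro m hm
      have h1 := left_ne_zero_of_mul hm
      have hmA : m ∉ A := fun h => h1 (if_pos h)
      rw [if_neg hmA] at h1
      rw [hA m h1] at hmA
      push Not at hmA
      obtain ⟨i, hi, hne⟩ := hmA
      rw [hd, Nat.add_one_le_iff]
      exact Finset.sum_lt_sum (fun j hj => hN m h1 j hj)
        ⟨i, hi, lt_of_le_of_ne (hN m h1 i hi) (Ne.symm hne)⟩) (by
      filter_upwards [hγ.eventually hy] with t ht
      have h1 : HasSum (fun m => if m ∈ A then a m * ∏ j, γ t j ^ M m j else 0)
          (∑ m ∈ A, a m * ∏ j, γ t j ^ M m j) := by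
        have := hasSum_sum_of_ne_finset_zero (f := fun m =>
          if m ∈ A then a m * ∏ j, γ t j ^ M m j else 0) (s := A) (L := .unconditional _)
          fun m hm => if_neg hm
        convert this using 1
        exact Finset.sum_congr rfl fun m hm => (if_pos hm).symm
      have h2 : ∑ m ∈ A, a m * ∏ j, γ t j ^ M m j = t ^ d * P := by
        rw [hP, Finset.mul_sum]
        refine Finset.sum_congr rfl fun m hm => ?_
        by_cases ham : a m = 0
        · simp [ham]
        rw [hprod, hd, Finset.sum_congr rfl ((hA m ham).1 hm)]
        ring
      rw [h2] at h1
      refine (ht.sub h1).congr_fun fun m => ?_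
      rw [hprod]
      split_ifs <;> ring)
  have h1 : Tendsto (fun t => g (γ t)) (𝓝[≠] 0) (𝓝 (g y)) := hyc.continuousAt.tendsto.comp hγ
  have h2 : Tendsto (fun t => g (γ t)) (𝓝[≠] 0) (𝓝 P) := by
    rw [tendsto_iff_norm_sub_tendsto_zero]
    have h3 : Tendsto (fun t : K => C * ‖t‖) (𝓝[≠] 0) (𝓝 0) := by
      have hc : Continuous fun t : K => C * ‖t‖ := by fun_prop
      exact (hc.tendsto' 0 0 (by simp)).mono_left nhdsWithin_le_nhds
    refine squeeze_zero' (Eventually.of_forall fun _ => norm_nonneg _) ?_ h3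
    filter_upwards [hC, hγ.eventually hyg, self_mem_nhdsWithin] with t ht htg ht0
    have h4 : ∏ i ∈ I, γ t i ^ N i = t ^ d := by
      rw [hd, ← Finset.prod_pow_eq_pow_sum]
      exact Finset.prod_congr rfl fun j hj => by simp only [γ, if_pos hj]
    rw [htg, h4, ← mul_sub, norm_mul, norm_pow, pow_succ] at ht
    have ht0' : 0 < ‖t‖ ^ d := pow_pos (norm_pos_iff.2 ht0) d
    refine le_of_mul_le_mul_left ?_ ht0'
    linarith
  exact tendsto_nhds_unique h1 h2

end Ultrametric

/-! ### Consequences of strong non-degeneracy -/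

section Nondegenerate

variable {n l : ℕ} {K : Type*} [NontriviallyNormedField K]

theorem hasFDerivAt_mvPolynomial_eval (p : MvPolynomial (Fin n) K) (z : Fin n → K) :
    HasFDerivAt (fun z => MvPolynomial.eval z p)
      (∑ j, MvPolynomial.eval z (MvPolynomial.pderiv j p) •
        (ContinuousLinearMap.proj j : (Fin n → K) →L[K] K)) z := by
  classical
  induction p using MvPolynomial.induction_on with
  | C a =>
    refine ((hasFDerivAt_const (𝕜 := K) a z).congr_of_eventuallyEq
      (Eventually.of_forall fun y => MvPolynomial.eval_C a)).congr_fderiv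
      (ContinuousLinearMap.ext fun v => ?_)
    simp [sum_apply]
  | add p q hp hq =>
    refine ((hp.add hq).congr_of_eventuallyEq
      (Eventually.of_forall fun y => map_add _ p q)).congr_fderiv
      (ContinuousLinearMap.ext fun v => ?_)
    simp only [add_apply, sum_apply, smul_apply, smul_eq_mul, ContinuousLinearMap.proj_apply]
    rw [← Finset.sum_add_distrib]
    exact Finset.sum_congr rfl fun j _ => by rw [map_add, map_add, add_mul]
  | mul_X p i hp =>
    have hX : HasFDerivAt (fun z : Fin n → K => z i)
        (ContinuousLinearMap.proj i : (Fin n → K) →L[K] K) z := hasFDerivAt_apply i z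
    refine ((hp.mul hX).congr_of_eventuallyEq
      (Eventually.of_forall fun y => ?_)).congr_fderiv
      (ContinuousLinearMap.ext fun v => ?_)
    · rw [map_mul, MvPolynomial.eval_X]
      rfl
    · simp only [add_apply, sum_apply, smul_apply, smul_eq_mul, ContinuousLinearMap.proj_apply]
      have h1 : ∀ j, MvPolynomial.eval z (MvPolynomial.pderiv j (p * MvPolynomial.X i)) * v j =
          z i * (MvPolynomial.eval z (MvPolynomial.pderiv j p) * v j) +
            if j = i then MvPolynomial.eval z p * v i else 0 := by
        intro j
        rw [MvPolynomial.pderiv_mul, map_add, map_mul, map_mul, MvPolynomial.eval_X]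
        split_ifs with hj
        · subst hj
          rw [MvPolynomial.pderiv_X_self, map_one]
          ring
        · rw [MvPolynomial.pderiv_X_of_ne (Ne.symm hj), map_zero]
          ring
      rw [Finset.sum_congr rfl fun j _ => h1 j, Finset.sum_add_distrib, Finset.mul_sum]
      simp [add_comm]

/-- The projection onto the subspace where the coordinates in `I` vanish. -/
def coordProj (K : Type*) [NontriviallyNormedField K] (I : Finset (Fin n)) :
    (Fin n → K) →L[K] (Fin n → K) :=
  ContinuousLinearMap.pi fun j => if j ∈ I then 0 else ContinuousLinearMap.proj j

theorem coordProj_apply (I : Finset (Fin n)) (v : Fin n → K) (j : Fin n) :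
    coordProj K I v j = if j ∈ I then 0 else v j := by
  unfold coordProj
  rw [ContinuousLinearMap.pi_apply]
  split_ifs <;> simp

/-- If the rows of a matrix of maximal rank pull back to functionals that do not depend on the
coordinates in `I ≠ ∅`, these functionals and the coordinates in `I` are independent. -/
theorem linearIndependent_of_rank_eq [CompleteSpace K] {L : Matrix (Fin l) (Fin n) K} (hL : L.rank = min l n)
    {A : (Fin n → K) →L[K] (Fin n → K)} (hA : A.det ≠ 0) {D : Fin l → (Fin n → K) →L[K] K}
    {I : Finset (Fin n)} (hI : I.Nonempty)
    (h : ∀ v, L.mulVec (A v) = fun i => D i (coordProj K I v)) :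
    LinearIndependent K (Sum.elim D fun j : I =>
      (ContinuousLinearMap.proj j.1 : (Fin n → K) →L[K] K)) := by
  classical
  have hA' : Function.Injective A := (A.toContinuousLinearEquivOfDetNeZero hA).injective
  have hsurj : Function.Surjective A := (A.toContinuousLinearEquivOfDetNeZero hA).surjective
  obtain ⟨j₀, hj₀⟩ := hI
  -- Since I is nonempty, L has a nonzero kernel vector. So its rank is less than n, hence equal to
  -- l, and its rows are independent.
  have hker : A (Pi.single j₀ 1) ∈ LinearMap.ker L.mulVecLin := by
    rw [LinearMap.mem_ker, Matrix.mulVecLin_apply, h]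
    funext i
    have : coordProj K I (Pi.single j₀ 1) = 0 := by
      funext j
      rw [coordProj_apply]
      split_ifs with hj
      · rfl
      · rw [Pi.single_eq_of_ne (ne_of_mem_of_not_mem hj₀ hj).symm]
        rfl
    rw [this, map_zero]
    rfl
  have hne : A (Pi.single j₀ 1) ≠ 0 := by
    rw [Ne, map_eq_zero_iff A hA']
    simp
  have hpos : 0 < Module.finrank K (LinearMap.ker L.mulVecLin) := by
    have : Nontrivial (LinearMap.ker L.mulVecLin) :=
      ⟨⟨⟨_, hker⟩, 0, fun e => hne (congrArg Subtype.val e)⟩⟩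
    exact Module.finrank_pos
  have hrk := LinearMap.finrank_range_add_finrank_ker L.mulVecLin
  rw [Module.finrank_fin_fun] at hrk
  change L.rank + _ = n at hrk
  have hrow : LinearIndependent K L.row := by
    rw [linearIndependent_iff_card_eq_finrank_span, Set.finrank,
      ← Matrix.rank_eq_finrank_span_row, hL, Fintype.card_fin]
    omega
  rw [Fintype.linearIndependent_iff] at hrow ⊢
  intro g hg
  rw [Fintype.sum_sum_type] at hg
  simp only [Sum.elim_inl, Sum.elim_inr] at hg
  have hev : ∀ v, (∑ i, g (Sum.inl i) * D i v) + ∑ j : I, g (Sum.inr j) * v j.1 = 0 := by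
    intro v
    have := DFunLike.congr_fun hg v
    simpa [sum_apply] using this
  -- Projecting v removes the coordinate forms of I. As A is surjective, the relation that remains
  -- is one between the rows of L.
  have h1 : ∀ v, ∑ i, g (Sum.inl i) * D i (coordProj K I v) = 0 := by
    intro v
    have h2 := hev (coordProj K I v)
    rw [Finset.sum_eq_zero (s := (Finset.univ : Finset I)), add_zero] at h2
    · exact h2
    · intro j _
      rw [coordProj_apply, if_pos j.2, mul_zero]
  have h3 : ∀ i, g (Sum.inl i) = 0 := by
    apply hrow
    funext k
    obtain ⟨v, hv⟩ := hsurj (Pi.single k 1)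
    have h4 := h1 v
    have h5 := h v
    rw [hv] at h5
    have h6 : ∀ i, D i (coordProj K I v) = L i k := by
      intro i
      rw [← congrFun h5 i]
      simp
    simp only [h6] at h4
    rw [Finset.sum_apply]
    exact h4
  rintro (i | j)
  · exact h3 i
  · have h7 := hev (Pi.single j.1 1)
    simp only [h3, zero_mul, Finset.sum_const_zero, zero_add] at h7
    rw [Finset.sum_eq_single j] at h7
    · simpa using h7
    · intro k _ hk
      rw [Pi.single_eq_of_ne (fun e => hk (Subtype.ext e)), mul_zero]
    · simp

/-- Independence gives l + |I| ≤ n, so there is room for l indices outside I. -/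
theorem exists_embedding_of_linearIndependent {D : Fin l → (Fin n → K) →L[K] K}
    {I : Finset (Fin n)} (h : LinearIndependent K (Sum.elim D fun j : I =>
      (ContinuousLinearMap.proj j.1 : (Fin n → K) →L[K] K))) :
    ∃ s : Fin l ↪ Fin n, ∀ k, s k ∉ I := by
  classical
  have h1 : LinearIndependent K (fun x => ((Sum.elim D fun j : I =>
      (ContinuousLinearMap.proj j.1 : (Fin n → K) →L[K] K)) x : (Fin n → K) →ₗ[K] K)) :=
    h.map' (ContinuousLinearMap.coeLM K)
      (LinearMap.ker_eq_bot.2 ContinuousLinearMap.coe_injective)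
  have h2 := h1.fintype_card_le_finrank
  rw [Subspace.dual_finrank_eq, Module.finrank_fin_fun, Fintype.card_sum, Fintype.card_fin,
    Fintype.card_coe] at h2
  have h3 : Fintype.card (Fin l) ≤ Fintype.card {j // j ∉ I} := by
    rw [Fintype.card_subtype_compl, Fintype.card_fin, Fintype.card_fin, Fintype.card_coe]
    omega
  obtain ⟨e⟩ := Function.Embedding.nonempty_of_card_le h3
  exact ⟨e.trans (Function.Embedding.subtype _), fun k => (e k).2⟩

variable {F : SimpleFan n}

theorem faceRestriction_eq_sum {φ : MvPowerSeries (Fin n) K} {τ : Set (Fin n → ℝ)}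
    {A : Finset (Fin n →₀ ℕ)}
    (hA : ∀ m, m ∈ A ↔ MvPowerSeries.coeff m φ ≠ 0 ∧ expVec m ∈ τ) :
    faceRestriction φ τ =
      ∑ m ∈ A, MvPolynomial.monomial m (MvPowerSeries.coeff m φ) := by
  unfold faceRestriction
  rw [← finsum_mem_coe_finset]
  congr 1
  funext m
  simp only [mem_ofPred_eq, Finset.mem_coe, hA]

/-- The pull-back of a face polynomial under the toric map. -/
theorem eval_faceRestriction_monomialMap {φ : MvPowerSeries (Fin n) K} {τ : Set (Fin n → ℝ)}
    {A : Finset (Fin n →₀ ℕ)}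
    (hA : ∀ m, m ∈ A ↔ MvPowerSeries.coeff m φ ≠ 0 ∧ expVec m ∈ τ) (c : F.MaxCone)
    {I : Finset (Fin n)} {N : Fin n → ℕ} (hN : ∀ m ∈ A, ∀ j ∈ I, coneDot c j m = N j)
    (y : Fin n → K) :
    MvPolynomial.eval (monomialMap K c y) (faceRestriction φ τ) =
      (∏ j ∈ I, y j ^ N j) *
        ∑ m ∈ A, MvPowerSeries.coeff m φ * ∏ j ∈ Iᶜ, y j ^ coneDot c j m := by
  classical
  rw [faceRestriction_eq_sum hA, map_sum, Finset.mul_sum]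
  refine Finset.sum_congr rfl fun m hm => ?_
  rw [MvPolynomial.eval_monomial, Finsupp.prod_fintype _ _ (fun _ => pow_zero _),
    prod_monomialMap_pow, ← Finset.prod_mul_prod_compl I,
    Finset.prod_congr rfl fun j hj => by rw [hN m hm j hj]]
  ring

/-- Local form of the pull-back of `f` at a point over the origin. -/
theorem exists_local_factorization [CompleteSpace K] [IsUltrametricDist K] (hn : 0 < n)
    {f : (Fin n → K) → Fin l → K} (hf : AnalyticAt K f 0)
    {φ : Fin l → MvPowerSeries (Fin n) K} (hφ : HasExpansion f φ) (hnd : StronglyNondegenerate φ)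
    {c : F.MaxCone} {m₀ : Fin n →₀ ℕ} (hm₀ : m₀ ∈ support φ)
    (hmin : ∀ m ∈ support φ, ∀ j, coneDot c j m₀ ≤ coneDot c j m)
    {b : Fin n → K} (hσ : monomialMap K c b = 0)
    {I : Finset (Fin n)} (hI : ∀ j, j ∈ I ↔ b j = 0) :
    ∃ g : Fin l → (Fin n → K) → K, (∀ i, AnalyticAt K (g i) b) ∧
      (∀ᶠ y in 𝓝 b, ∀ i,
        f (monomialMap K c y) i = (∏ j ∈ I, y j ^ coneDot c j m₀) * g i y) ∧
      ((∃ i, g i b ≠ 0) ∨ (I.Nonempty ∧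
        LinearIndependent K (Sum.elim (fun i => fderiv K (g i) b) fun j : I =>
          (ContinuousLinearMap.proj j.1 : (Fin n → K) →L[K] K)))) := by
  classical
  -- Each x i vanishes at b, so some vanishing y j occurs in it; this makes the face of I compact.
  have hIc : ∀ i, ∃ j ∈ I, c.1 j i ≠ 0 := by
    intro i
    obtain ⟨j, -, hj⟩ := Finset.prod_eq_zero_iff.1 (congrFun hσ i)
    have hj' := pow_eq_zero_iff'.1 hj
    refine ⟨j, (hI j).2 hj'.1, fun h0 => hj'.2 ?_⟩
    rw [h0]; rfl
  have hIne : I.Nonempty := by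
    obtain ⟨j, hj, -⟩ := hIc ⟨0, hn⟩
    exact ⟨j, hj⟩
  let τ := coneFace (support φ) c I
  have hfin : ∀ i, {m | MvPowerSeries.coeff m (φ i) ≠ 0 ∧ expVec m ∈ τ}.Finite := fun i =>
    (finite_coneFace hIc hm₀ hmin).subset fun m hm => ⟨⟨i, hm.1⟩, hm.2⟩
  let A : Fin l → Finset (Fin n →₀ ℕ) := fun i => (hfin i).toFinset
  have hA : ∀ i m, m ∈ A i ↔ MvPowerSeries.coeff m (φ i) ≠ 0 ∧ expVec m ∈ τ := fun i m =>
    (hfin i).mem_toFinset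
  have hAτ : ∀ i m, MvPowerSeries.coeff m (φ i) ≠ 0 →
      (m ∈ A i ↔ ∀ j ∈ I, coneDot c j m = coneDot c j m₀) := by
    intro i m hm
    rw [hA, ← expVec_mem_coneFace_iff I hm₀ hmin ⟨i, hm⟩]
    exact and_iff_right hm
  have hσt : Tendsto (monomialMap K c) (𝓝 b) (𝓝 0) := by
    have := (analyticAt_monomialMap c b).continuousAt.tendsto
    rwa [hσ] at this
  have hfa : AnalyticAt K (fun y => f (monomialMap K c y)) b :=
    AnalyticAt.fun_comp (by rw [hσ]; exact hf) (analyticAt_monomialMap c b)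
  choose g hg hfg hgP using fun i => exists_eq_monomial_mul_of_hasSum (b := b) I
    (fun j hj => (hI j).1 hj) (F := fun y => f (monomialMap K c y) i)
    (analyticAt_pi_iff.1 hfa i) (a := fun m => MvPowerSeries.coeff m (φ i))
    (M := fun m j => coneDot c j m) (by
      filter_upwards [hσt.eventually hφ] with y hy
      refine (hy i).congr_fun fun m => ?_
      rw [prod_monomialMap_pow]) (N := fun j => coneDot c j m₀)
    (fun m hm j _ => hmin m ⟨i, hm⟩ j) (A := A i) (hAτ i)
  refine ⟨g, hg, eventually_all.2 hfg, ?_⟩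
  by_cases hzero : ∃ i, g i b ≠ 0
  · exact Or.inl hzero
  refine Or.inr ⟨hIne, ?_⟩
  push Not at hzero
  -- A torus point that projects to b, at whose image non-degeneracy applies. The value 1 makes the
  -- monomial in the coordinates of I equal to 1 there.
  let b' : Fin n → K := fun j => if j ∈ I then 1 else b j
  have hb' : ∀ j, b' j ≠ 0 := by
    intro j
    simp only [b']
    split_ifs with hj
    · exact one_ne_zero
    · exact fun h0 => hj ((hI j).2 h0)
  have hρ : coordProj K I b' = b := by
    funext j
    rw [coordProj_apply]
    split_ifs with hj
    · exact ((hI j).1 hj).symm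
    · simp only [b', if_neg hj]
  let Q : Fin l → (Fin n → K) → K := fun i y =>
    ∑ m ∈ A i, MvPowerSeries.coeff m (φ i) * ∏ j ∈ Iᶜ, y j ^ coneDot c j m
  have hQρ : ∀ i y, Q i (coordProj K I y) = Q i y := by
    intro i y
    refine Finset.sum_congr rfl fun m _ => ?_
    congr 1
    refine Finset.prod_congr rfl fun j hj => ?_
    rw [coordProj_apply, if_neg (Finset.mem_compl.1 hj)]
  have hρt : Tendsto (coordProj K I) (𝓝 b') (𝓝 b) := by
    have := (coordProj K I).continuous.tendsto b'
    rwa [hρ] at this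
  have hQg : ∀ i, ∀ᶠ y in 𝓝 b', Q i y = g i (coordProj K I y) := by
    intro i
    filter_upwards [hρt.eventually (hgP i)] with y hy
    rw [hy fun j hj => by rw [coordProj_apply, if_pos hj]]
    exact (hQρ i y).symm
  have hN : ∀ i, ∀ m ∈ A i, ∀ j ∈ I, coneDot c j m = coneDot c j m₀ := fun i m hm =>
    (hAτ i m ((hA i m).1 hm).1).1 hm
  have hev : ∀ i y, MvPolynomial.eval (monomialMap K c y) (faceRestriction (φ i) τ) =
      (∏ j ∈ I, y j ^ coneDot c j m₀) * Q i y := fun i y =>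
    eval_faceRestriction_monomialMap (hA i) c (hN i) y
  have hmono : ∏ j ∈ I, b' j ^ coneDot c j m₀ = 1 :=
    Finset.prod_eq_one fun j hj => by simp only [b', if_pos hj, one_pow]
  have hQ0 : ∀ i, Q i b' = 0 := by
    intro i
    rw [(hQg i).self_of_nhds, hρ, hzero i]
  have hrank := hnd τ (isFace_coneFace I hm₀ hmin) (isCompact_coneFace hIc hm₀ hmin)
    (monomialMap K c b') (fun i => Finset.prod_ne_zero_iff.2 fun j _ => pow_ne_zero _ (hb' j))
    (fun i => by rw [hev, hQ0, mul_zero])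
  refine linearIndependent_of_rank_eq hrank (A := fderiv K (monomialMap K c) b')
    ((det_fderiv_monomialMap_ne_zero_iff c b').2 fun j _ => hb' j) hIne fun v => ?_
  funext i
  have hd1 := (hasFDerivAt_mvPolynomial_eval (faceRestriction (φ i) τ)
    (monomialMap K c b')).comp b' (analyticAt_monomialMap c b').differentiableAt.hasFDerivAt
  have hg' : HasFDerivAt (fun y => g i (coordProj K I y))
      ((fderiv K (g i) b).comp (coordProj K I)) b' := by
    refine HasFDerivAt.comp b' (g := g i) ?_ (coordProj K I).hasFDerivAt
    rw [hρ]
    exact (hg i).differentiableAt.hasFDerivAt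
  have hm' : DifferentiableAt K (fun y : Fin n → K => ∏ j ∈ I, y j ^ coneDot c j m₀) b' := by
    fun_prop
  -- The pulled-back face polynomial is the monomial times g i ∘ `coordProj`. At b' the monomial is
  -- 1 and g i vanishes, so the derivative of the product is that of the second factor.
  have hd2 := hm'.hasFDerivAt.mul hg'
  have hd3 : HasFDerivAt
      ((fun z => MvPolynomial.eval z (faceRestriction (φ i) τ)) ∘ monomialMap K c) _ b' :=
    hd2.congr_of_eventuallyEq (by
      filter_upwards [hQg i] with y hy
      change MvPolynomial.eval (monomialMap K c y) _ = _
      rw [hev, hy]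
      rfl)
  have h1 := DFunLike.congr_fun (hd1.unique hd3) v
  beta_reduce at h1
  rw [hρ, hzero i, hmono] at h1
  simp only [ContinuousLinearMap.comp_apply, sum_apply, smul_apply, ContinuousLinearMap.proj_apply,
    smul_eq_mul, one_smul, zero_smul, add_zero] at h1
  exact h1

end Nondegenerate

/-! ### Adapted charts on the toric manifold -/

section Adapted

variable {n l : ℕ} {K : Type*} [NontriviallyNormedField K]

/-- The pull-back of an adapted chart on `Kⁿ` under a coordinate system. -/
def AdaptedChart.comap [CompleteSpace K] {M : Type*} [TopologicalSpace M]
    [ChartedSpace (Fin n → K) M] [IsManifold 𝓘(K, Fin n → K) ω M]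
    {Φ : M → Fin l → K} {Θ E : Set M} {Φ₀ : (Fin n → K) → Fin l → K} {Θ₀ E₀ : Set (Fin n → K)}
    (C : AdaptedChart n Φ₀ Θ₀ E₀) {ψ : OpenPartialHomeomorph M (Fin n → K)}
    (hψ : ψ ∈ coordinateSystems n K M) (hΦ : ∀ q ∈ ψ.source, Φ q = Φ₀ (ψ q))
    (hΘ : ∀ q ∈ ψ.source, q ∈ Θ ↔ ψ q ∈ Θ₀) (hE : ∀ q ∈ ψ.source, q ∈ E ↔ ψ q ∈ E₀) :
    AdaptedChart n Φ Θ E where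
  chart := ψ.trans C.chart
  mem := by
    have h1 := mem_coordinateSystems_iff.1 C.mem
    refine trans_mem_coordinateSystems hψ (fun x hx => ?_) (fun x hx => ?_)
    · exact ((contMDiffOn_iff_contDiffOn.1 h1.1).contDiffAt
        (C.chart.open_source.mem_nhds hx)).analyticAt
    · exact ((contMDiffOn_iff_contDiffOn.1 h1.2).contDiffAt
        (C.chart.open_target.mem_nhds hx)).analyticAt
  T := C.T
  N := C.N
  N_eq_zero := C.N_eq_zero
  h := fun q => C.h (ψ q)
  analytic := by
    intro q hq
    rw [OpenPartialHomeomorph.trans_source] at hq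
    exact (C.analytic _ hq.2).comp q
      (((mem_coordinateSystems_iff.1 hψ).1).contMDiffAt (ψ.open_source.mem_nhds hq.1))
  mem_torus_iff := by
    intro q hq
    rw [OpenPartialHomeomorph.trans_source] at hq
    rw [hΘ q hq.1]
    exact C.mem_torus_iff _ hq.2
  exc := by
    obtain ⟨T', hT'⟩ := C.exc
    refine ⟨T', fun q hq => ?_⟩
    rw [OpenPartialHomeomorph.trans_source] at hq
    rw [hE q hq.1]
    exact hT' _ hq.2
  factor := by
    intro q hq i
    rw [OpenPartialHomeomorph.trans_source] at hq
    rw [hΦ q hq.1]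
    exact C.factor _ hq.2 i
  alt := by
    obtain ⟨i, hi⟩ | ⟨s, hT, hsT, hs⟩ := C.alt
    · refine Or.inl ⟨i, fun q hq => ?_⟩
      rw [OpenPartialHomeomorph.trans_source] at hq
      exact hi _ hq.2
    · refine Or.inr ⟨s, hT, hsT, fun q hq k => ?_⟩
      rw [OpenPartialHomeomorph.trans_source] at hq
      exact hs _ hq.2 k

variable {F : SimpleFan n}

variable (K n) in
/-- The torus in `Kⁿ`. -/
def torus : Set (Fin n → K) := {y | ∀ j, y j ≠ 0}

variable (K) in
/-- The critical points of the toric map in the chart of a cone. -/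
def coneExceptional (c : F.MaxCone) : Set (Fin n → K) := {y | ∃ j, coneWeight c j ≠ 1 ∧ y j = 0}

theorem monomialMap_mem_torus_iff (c : F.MaxCone) (y : Fin n → K) :
    monomialMap K c y ∈ torus n K ↔ y ∈ torus n K := by
  have h : monomialMap K c y ∈ torus n K ↔ ∏ i, monomialMap K c y i ≠ 0 := by
    simp [torus, Finset.prod_ne_zero_iff]
  rw [h, prod_monomialMap, Finset.prod_ne_zero_iff]
  refine ⟨fun h j => ?_, fun h j _ => pow_ne_zero _ (h j)⟩
  exact (pow_ne_zero_iff (coneWeight_pos c j).ne').1 (h j (Finset.mem_univ j))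

/-- Every point over the origin has an adapted chart. -/
theorem exists_adaptedChart_monomialMap [CompleteSpace K] [IsUltrametricDist K] (hn : 0 < n)
    {f : (Fin n → K) → Fin l → K} (hf : AnalyticAt K f 0)
    {φ : Fin l → MvPowerSeries (Fin n) K} (hφ : HasExpansion f φ) (hnd : StronglyNondegenerate φ)
    (hne : (support φ).Nonempty) (hF : F.Subordinated (newtonPolyhedron (support φ)))
    {c : F.MaxCone} {b : Fin n → K} (hσ : monomialMap K c b = 0) :
    ∃ C : AdaptedChart n (fun y => f (monomialMap K c y)) (torus n K) (coneExceptional K c),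
      b ∈ C.chart.source := by
  classical
  obtain ⟨m₀, hm₀, hmin⟩ := exists_forall_coneDot_le hne hF c
  let I : Finset (Fin n) := Finset.univ.filter fun j => b j = 0
  have hI : ∀ j, j ∈ I ↔ b j = 0 := by simp [I]
  obtain ⟨g, hg, hfg, halt⟩ := exists_local_factorization hn hf hφ hnd hm₀ hmin hσ hI
  have hJ : ∀ᶠ y in 𝓝 b, ∀ j ∉ I, y j ≠ 0 := by
    rw [eventually_all]
    intro j
    by_cases hj : j ∈ I
    · simp [hj]
    · filter_upwards [(continuous_apply j).continuousAt.eventually_ne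
        (fun h0 => hj ((hI j).2 h0))] with y hy _ using hy
  have hga : ∀ᶠ y in 𝓝 b, ∀ i, AnalyticAt K (g i) y :=
    eventually_all.2 fun i => (hg i).eventually_analyticAt
  let N : Fin n → ℕ := fun j => if j ∈ I then coneDot c j m₀ else 0
  have build : ∀ χ ∈ coordinateSystems n K (Fin n → K),
      (∀ y ∈ χ.source, (∀ i, f (monomialMap K c y) i =
        (∏ j ∈ I, y j ^ coneDot c j m₀) * g i y) ∧ (∀ j ∉ I, y j ≠ 0) ∧
        ∀ i, AnalyticAt K (g i) y) →
      (∀ y ∈ χ.source, ∀ j ∈ I, χ y j = y j) → b ∈ χ.source →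
      ((∃ i, ∀ y ∈ χ.source, g i y ≠ 0) ∨
        ∃ s : Fin l ↪ Fin n, I.Nonempty ∧ (∀ k, s k ∉ I) ∧
          ∀ y ∈ χ.source, ∀ k, g k y = χ y (s k)) →
      ∃ C : AdaptedChart n (fun y => f (monomialMap K c y)) (torus n K) (coneExceptional K c),
        b ∈ C.chart.source := by
    intro χ hχ h1 h2 hb h3
    refine ⟨{
      chart := χ
      mem := hχ
      T := I
      N := N
      N_eq_zero := fun j hj => if_neg hj
      h := fun y i => g i y
      analytic := fun y hy => contMDiffAt_iff_contDiffAt.2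
        (contDiffAt_pi.2 fun i => ((h1 y hy).2.2 i).contDiffAt)
      mem_torus_iff := ?_
      exc := ⟨I.filter fun j => coneWeight c j ≠ 1, ?_⟩
      factor := ?_
      alt := h3 }, hb⟩
    · intro y hy
      constructor
      · intro h j hj
        rw [h2 y hy j hj]
        exact h j
      · intro h j
        by_cases hj : j ∈ I
        · rw [← h2 y hy j hj]
          exact h j hj
        · exact (h1 y hy).2.1 j hj
    · intro y hy
      constructor
      · rintro ⟨j, hj1, hj0⟩
        have hj : j ∈ I := by
          by_contra hj
          exact (h1 y hy).2.1 j hj hj0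
        exact ⟨j, Finset.mem_filter.2 ⟨hj, hj1⟩, by rw [h2 y hy j hj, hj0]⟩
      · rintro ⟨j, hj, hj0⟩
        obtain ⟨hj, hj1⟩ := Finset.mem_filter.1 hj
        exact ⟨j, hj1, by rw [← h2 y hy j hj, hj0]⟩
    · intro y hy i
      rw [(h1 y hy).1 i, mul_comm, ← Finset.prod_subset (Finset.subset_univ I)
        (fun j _ hj => by simp only [N, if_neg hj, pow_zero])]
      congr 1
      exact Finset.prod_congr rfl fun j hj => by rw [h2 y hy j hj]; simp only [N, if_pos hj]
  have hid : OpenPartialHomeomorph.refl (Fin n → K) ∈ coordinateSystems n K (Fin n → K) :=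
    mem_coordinateSystems_iff.2 ⟨contMDiffOn_id, contMDiffOn_id⟩
  obtain ⟨i₀, hi₀⟩ | ⟨hIne, hind⟩ := halt
  · obtain ⟨O, hO, hOo, hbO⟩ := eventually_nhds_iff.1
      ((hfg.and (hJ.and hga)).and ((hg i₀).continuousAt.eventually_ne hi₀))
    refine build _ (restrOpen_mem_coordinateSystems hid hOo) ?_ ?_ ?_ (Or.inl ⟨i₀, ?_⟩)
    · exact fun y hy => (hO y hy.2).1
    · exact fun y _ j _ => rfl
    · exact ⟨mem_univ b, hbO⟩
    · exact fun y hy => (hO y hy.2).2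
  · obtain ⟨s, hs⟩ := exists_embedding_of_linearIndependent hind
    -- The index s k carries g k and the others carry the old coordinates; only the indices in P,
    -- those of s and of I, are prescribed below.
    let G : Fin n → (Fin n → K) → K := fun j =>
      if h : ∃ k, s k = j then g h.choose else fun y => y j
    have hGs : ∀ k, G (s k) = g k := by
      intro k
      have h : ∃ k', s k' = s k := ⟨k, rfl⟩
      simp only [G, dif_pos h]
      rw [s.injective h.choose_spec]
    have hGI : ∀ j ∈ I, G j = fun y => y j := by
      intro j hj
      have h : ¬ ∃ k, s k = j := by
        rintro ⟨k, rfl⟩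
        exact hs k hj
      simp only [G, dif_neg h]
    have hcoord : ∀ j, AnalyticAt K (fun y : Fin n → K => y j) b := fun j =>
      (ContinuousLinearMap.proj j : (Fin n → K) →L[K] K).analyticAt b
    let e : Fin l ⊕ I → Fin n := Sum.elim s Subtype.val
    have he : Function.Injective e := by
      rintro (k | j) (k' | j') h
      · exact congrArg Sum.inl (s.injective h)
      · exact absurd ((show s k = j'.1 from h) ▸ j'.2) (hs k)
      · exact absurd ((show j.1 = s k' from h) ▸ j.2) (hs k')
      · exact congrArg Sum.inr (Subtype.ext h)
    let P : Finset (Fin n) := Finset.univ.image e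
    have hP : (P : Set (Fin n)) = range e := by simp [P]
    have hPs : ∀ k, s k ∈ P := fun k =>
      Finset.mem_image_of_mem e (Finset.mem_univ (Sum.inl k))
    have hPI : ∀ j ∈ I, j ∈ P := fun j hj =>
      Finset.mem_image.2 ⟨Sum.inr ⟨j, hj⟩, Finset.mem_univ _, rfl⟩
    have hGP : ∀ j ∈ P, AnalyticAt K (G j) b := by
      intro j hj
      obtain ⟨k | j', -, rfl⟩ := Finset.mem_image.1 hj
      · exact (hGs k).symm ▸ hg k
      · change AnalyticAt K (G j'.1) b
        rw [hGI _ j'.2]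
        exact hcoord _
    have hindP : LinearIndepOn K (fun j => fderiv K (G j) b) (P : Set (Fin n)) := by
      rw [hP, linearIndepOn_range_iff he]
      convert hind using 1
      funext x
      rcases x with k | j
      · change fderiv K (G (s k)) b = _
        rw [hGs]
        rfl
      · change fderiv K (G j.1) b = _
        rw [hGI _ j.2]
        exact (ContinuousLinearMap.proj j.1 : (Fin n → K) →L[K] K).fderiv
    obtain ⟨χ, hχ, hbχ, -, hχO, hχG⟩ := exists_coordinateSystem_extending hid (mem_univ b) P G hGP
      hindP (hfg.and (hJ.and hga))
    refine build χ hχ (fun y hy => hχO hy) ?_ hbχ (Or.inr ⟨s, hIne, hs, ?_⟩)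
    · intro y hy j hj
      rw [hχG j (hPI j hj) y hy, hGI j hj]
      rfl
    · intro y hy k
      rw [hχG (s k) (hPs k) y hy, hGs]
      rfl

/-- The inverse image of the torus. -/
def toricTorus (F : SimpleFan n) (V : TopologicalSpace.Opens (Fin n → K)) : Set (toricOpen F V) :=
  sigmaZero F V ⁻¹' torus n K

theorem exists_adaptedChart_sigmaZero [CompleteSpace K] {f : (Fin n → K) → Fin l → K}
    {V : TopologicalSpace.Opens (Fin n → K)} (q : toricOpen F V) {c : F.MaxCone} {y : Fin n → K}
    (hq : q.1 = toricPoint F K c y)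
    (C : AdaptedChart n (fun y => f (monomialMap K c y)) (torus n K) (coneExceptional K c))
    (hy : y ∈ C.chart.source) :
    ∃ C' : AdaptedChart n (fun q => f (sigmaZero F V q)) (toricTorus F V)
      (exceptionalLocus n K (sigmaZero F V)), q ∈ C'.chart.source := by
  have hV : Nonempty (toricOpen F V) := ⟨q⟩
  refine ⟨C.comap (toricOpenChart_mem hV c) (fun q' hq' => ?_) (fun q' hq' => ?_)
    (fun q' hq' => mem_exceptionalLocus_iff hV c hq'), ?_⟩
  · rw [sigmaZero_eq_monomialMap hV c hq']
  · rw [← monomialMap_mem_torus_iff c, ← sigmaZero_eq_monomialMap hV c hq']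
    rfl
  · change q ∈ ((toricOpenChart hV c).trans C.chart).source
    rw [OpenPartialHomeomorph.trans_source]
    refine ⟨(mem_toricOpenChart_source hV c q).2 ⟨y, hq.symm⟩, ?_⟩
    rw [mem_preimage, toricOpenChart_apply, hq, toricHomeo_toricPoint]
    exact hy

/-- Around a point of the torus the toric map carries adapted charts to adapted charts. -/
theorem exists_adaptedChart_of_mem_torus [CompleteSpace K] {f : (Fin n → K) → Fin l → K}
    {c : F.MaxCone} {y : Fin n → K} (hyt : y ∈ torus n K)
    (C : AdaptedChart n (fun y => f (monomialMap K c y)) (torus n K) (coneExceptional K c))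
    (hy : y ∈ C.chart.source) :
    ∃ C' : AdaptedChart n f (torus n K) ∅,
      monomialMap K c y ∈ C'.chart.source ∧ C'.chart.source ⊆ torus n K := by
  have hdet := (det_fderiv_monomialMap_ne_zero_iff c y).2 fun j _ => hyt j
  have hopen : IsOpen (torus n K) := by
    simp only [torus, ofPred_forall]
    exact isOpen_iInter_of_finite fun j => isOpen_ne_fun (continuous_apply j) continuous_const
  obtain ⟨ψ, hyψ, hψt, hψσ, h1, h2⟩ := AnalyticAt.exists_openPartialHomeomorph
    (analyticAt_monomialMap c y)
    ((fderiv K (monomialMap K c) y).toContinuousLinearEquivOfDetNeZero hdet)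
    (ContinuousLinearMap.coe_toContinuousLinearEquivOfDetNeZero _ _).symm (hopen.mem_nhds hyt)
  -- On the torus the local inverse of the toric map is a coordinate system, along which the adapted
  -- chart is pulled back.
  have hψ : ψ.symm ∈ coordinateSystems n K (Fin n → K) :=
    mem_coordinateSystems_iff.2
      ⟨contMDiffOn_iff_contDiffOn.2 (h2.contDiffOn ψ.open_target.uniqueDiffOn),
        contMDiffOn_iff_contDiffOn.2 (h1.contDiffOn ψ.open_source.uniqueDiffOn)⟩
  have hmap : ∀ x ∈ ψ.symm.source, ψ.symm x ∈ torus n K ∧ monomialMap K c (ψ.symm x) = x := by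
    intro x hx
    have hx' := ψ.map_target hx
    exact ⟨hψt hx', by rw [← hψσ _ hx', ψ.right_inv hx]⟩
  have htor : ∀ x ∈ ψ.symm.source, x ∈ torus n K := by
    intro x hx
    rw [← (hmap x hx).2, monomialMap_mem_torus_iff]
    exact (hmap x hx).1
  refine ⟨C.comap hψ (fun x hx => ?_) (fun x hx => ?_) (fun x hx => ?_), ?_, ?_⟩
  · rw [(hmap x hx).2]
  · exact ⟨fun _ => (hmap x hx).1, fun _ => htor x hx⟩
  · refine ⟨fun h => h.elim, ?_⟩
    rintro ⟨j, -, hj⟩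
    exact ((hmap x hx).1 j hj).elim
  · change _ ∈ (ψ.symm.trans C.chart).source
    rw [OpenPartialHomeomorph.trans_source, ← hψσ y hyψ]
    refine ⟨ψ.map_source hyψ, ?_⟩
    rw [mem_preimage, ψ.left_inv hyψ]
    exact hy
  · intro x hx
    change x ∈ (ψ.symm.trans C.chart).source at hx
    rw [OpenPartialHomeomorph.trans_source] at hx
    exact htor x hx.1

/-- A point of the torus zero set has coordinates in which the zero set is a coordinate
subspace. -/
theorem AdaptedChart.exists_isCoordinateSubspace_torusZeros {f : (Fin n → K) → Fin l → K}
    (C : AdaptedChart n f (torus n K) ∅) (hC : C.chart.source ⊆ torus n K)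
    {V : TopologicalSpace.Opens (Fin n → K)} {x : Fin n → K} (hx : x ∈ C.chart.source)
    (hxZ : x ∈ torusZeros f V) :
    (∃ χ ∈ coordinateSystems n K (Fin n → K), x ∈ χ.source ∧
      ∃ S : Finset (Fin n), S.card = l ∧ IsCoordinateSubspace χ S (torusZeros f V)) ∧ l < n := by
  have hcl : x ∈ zeroClosure f (torus n K) := subset_closure ⟨hxZ.2.1, hxZ.2.2⟩
  refine ⟨?_, C.lt_of_mem_zeroClosure hx hcl⟩
  obtain ⟨s, -, -, hs⟩ := C.exists_embedding hx hcl
  refine ⟨C.chart.restrOpen V V.2, restrOpen_mem_coordinateSystems C.mem V.2, ⟨hx, hxZ.1⟩,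
    Finset.univ.map s, by simp, fun x' hx' => ?_⟩
  have h1 := C.isCoordinateSubspace s hs x' hx'.1
  rw [C.mem_zeroClosure_iff hx'.1, ← C.eq_zero_iff hx'.1 (hC hx'.1)] at h1
  exact Iff.trans ⟨fun h => h.2.2, fun h => ⟨hx'.2, hC hx'.1, h⟩⟩ h1

end Adapted

/-! ### A neighbourhood of the fibre over the origin -/

section Fibre

variable {n l : ℕ} {K : Type*} [NontriviallyNormedField K]

theorem support_nonempty {f : (Fin n → K) → Fin l → K} {φ : Fin l → MvPowerSeries (Fin n) K}
    (hφ : HasExpansion f φ) (hfne : ¬ ∀ᶠ x in 𝓝 (0 : Fin n → K), f x = 0) :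
    (support φ).Nonempty := by
  by_contra hcon
  rw [not_nonempty_iff_eq_empty] at hcon
  have h0 : ∀ i m, MvPowerSeries.coeff m (φ i) = 0 := by
    intro i m
    by_contra h
    have : m ∈ support φ := ⟨i, h⟩
    rw [hcon] at this
    exact this
  refine hfne (hφ.mono fun x hx => funext fun i => ?_)
  have h := hx i
  simp only [h0, zero_mul] at h
  exact h.unique hasSum_zero

/-- Over a small ball around the origin the toric manifold is covered by adapted charts. -/
theorem exists_forall_adaptedChart [ProperSpace K] [IsUltrametricDist K] (hn : 0 < n)
    {f : (Fin n → K) → Fin l → K} (hf : AnalyticAt K f 0)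
    {φ : Fin l → MvPowerSeries (Fin n) K} (hφ : HasExpansion f φ) (hnd : StronglyNondegenerate φ)
    (hne : (support φ).Nonempty) {F : SimpleFan n}
    (hF : F.Subordinated (newtonPolyhedron (support φ))) :
    ∃ ε : ℝ, 0 < ε ∧ ∀ q : ToricManifold F K, ‖toricMap F K q‖ < ε →
      ∃ (c : F.MaxCone) (y : Fin n → K)
        (C : AdaptedChart n (fun y => f (monomialMap K c y)) (torus n K) (coneExceptional K c)),
        q = toricPoint F K c y ∧ y ∈ C.chart.source := by
  have : CompleteSpace K := inferInstance
  let W : Set (ToricManifold F K) := {q | ∃ (c : F.MaxCone) (y : Fin n → K)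
    (C : AdaptedChart n (fun y => f (monomialMap K c y)) (torus n K) (coneExceptional K c)),
    q = toricPoint F K c y ∧ y ∈ C.chart.source}
  refine exists_norm_toricMap_lt F (W := W) ?_ ?_
  · rw [isOpen_iff_mem_nhds]
    rintro _ ⟨c, y, C, rfl, hy⟩
    have h1 : IsOpen ((toricHomeo F K c).symm '' C.chart.source) :=
      (toricHomeo F K c).isOpen_image_symm_of_subset_target C.chart.open_source
        (fun _ _ => mem_univ _)
    refine mem_of_superset (h1.mem_nhds ⟨y, hy, rfl⟩) ?_
    rintro _ ⟨y', hy', rfl⟩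
    exact ⟨c, y', C, rfl, hy'⟩
  · intro q hq
    obtain ⟨c, y, rfl⟩ := exists_toricPoint_eq F q
    rw [mem_preimage, toricMap_toricPoint_eq, mem_singleton_iff] at hq
    obtain ⟨C, hC⟩ := exists_adaptedChart_monomialMap hn hf hφ hnd hne hF hq
    exact ⟨c, y, C, rfl, hC⟩

theorem strictZeros_eq_zeroClosure (F : SimpleFan n) (f : (Fin n → K) → Fin l → K)
    (V : TopologicalSpace.Opens (Fin n → K)) :
    strictZeros F f V =
      AdaptedChart.zeroClosure (fun q => f (sigmaZero F V q)) (toricTorus F V) := by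
  unfold strictZeros AdaptedChart.zeroClosure
  congr 1
  ext q
  exact ⟨fun h => ⟨h.2.1, h.2.2⟩, fun h => ⟨q.2, h.1, h.2⟩⟩

/-- It suffices that natural numbers have norm at most 1, and the norm of K extends the one of ℚ_p.
-/
theorem isUltrametricDist_of_padic (p : ℕ) [Fact p.Prime] (K : Type*) [NontriviallyNormedField K]
    [NormedAlgebra ℚ_[p] K] : IsUltrametricDist K := by
  refine IsUltrametricDist.isUltrametricDist_of_forall_norm_natCast_le_one fun m => ?_
  have h := norm_algebraMap' K (m : ℚ_[p])
  rw [map_natCast] at h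
  rw [h]
  exact_mod_cast Padic.norm_int_le_one (p := p) (m : ℤ)

end Fibre

end NewtonPrincipalization

end

/-! ### Choice of the neighbourhood and conclusion. -/

theorem mainTheorem5 (p : ℕ) [Fact p.Prime] (K : Type u) [NontriviallyNormedField K]
    [NormedAlgebra ℚ_[p] K] [FiniteDimensional ℚ_[p] K] (n l : ℕ)
    (U : Set (Fin n → K)) (hU : IsOpen U) (h0U : (0 : Fin n → K) ∈ U)
    (f : (Fin n → K) → Fin l → K) (hf : AnalyticOnNhd K f U) (hf0 : f 0 = 0)
    (hfne : ¬ ∀ᶠ x in 𝓝 (0 : Fin n → K), f x = 0)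
    (φ : Fin l → MvPowerSeries (Fin n) K) (hφ : HasExpansion f φ)
    (hnd : StronglyNondegenerate φ)
    (F : SimpleFan n) (hF : F.Subordinated (newtonPolyhedron (support φ))) :
    ∃ U₀ : TopologicalSpace.Opens (Fin n → K), 0 ∈ U₀ ∧ (U₀ : Set (Fin n → K)) ⊆ U ∧
      ∀ V : TopologicalSpace.Opens (Fin n → K), 0 ∈ V → V ≤ U₀ →
        (torusZeros f V = ∅ ∨ (IsSubmanifold n K (torusZeros f V) l ∧ l < n)) ∧
        ((torusZeros f V = ∅ ∨ l = 1) → PrincipalMonomialNearFibre f (sigmaZero F V)) ∧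
        ((torusZeros f V).Nonempty →
          IsClosed (strictZeros F f V) ∧
          IsSubmanifold n K (strictZeros F f V) l ∧
          HasNormalCrossings n K (strictZeros F f V) (exceptionalLocus n K (sigmaZero F V)) ∧
          (∃ (X : Type u) (_ : TopologicalSpace X) (_ : ChartedSpace (Fin n → K) X)
            (_ : IsManifold 𝓘(K, Fin n → K) ω X) (π : X → toricOpen F V),
            IsBlowUp n K π (strictZeros F f V)) ∧
          ∀ (X : Type u) [TopologicalSpace X] [ChartedSpace (Fin n → K) X]
            [IsManifold 𝓘(K, Fin n → K) ω X] (π : X → toricOpen F V),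
            IsBlowUp n K π (strictZeros F f V) →
              PrincipalMonomialNearFibre f (sigmaZero F V ∘ π)) := by
  have hproper : ProperSpace K := FiniteDimensional.proper ℚ_[p] K
  have hcomplete : CompleteSpace K := inferInstance
  have hultra : IsUltrametricDist K := isUltrametricDist_of_padic p K
  have hn : 0 < n := by
    rcases Nat.eq_zero_or_pos n with rfl | h
    · exact absurd (Eventually.of_forall fun x => by rw [Subsingleton.elim x 0, hf0]) hfne
    · exact h
  have hl : 0 < l := by
    rcases Nat.eq_zero_or_pos l with rfl | h
    · exact absurd (Eventually.of_forall fun x => Subsingleton.elim _ _) hfne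
    · exact h
  obtain ⟨ε, hε, hcov⟩ := exists_forall_adaptedChart hn (hf 0 h0U) hφ hnd
    (support_nonempty hφ hfne) hF
  refine ⟨⟨U ∩ Metric.ball 0 ε, hU.inter Metric.isOpen_ball⟩,
    ⟨h0U, Metric.mem_ball_self hε⟩, inter_subset_left, fun V _ hVU => ?_⟩
  have hVε : ∀ x ∈ V, ‖x‖ < ε := fun x hx => mem_ball_zero_iff.1 (hVU hx).2
  have hgood : ∀ q : toricOpen F V, ∃ C : AdaptedChart n (fun q => f (sigmaZero F V q))
      (toricTorus F V) (exceptionalLocus n K (sigmaZero F V)), q ∈ C.chart.source := by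
    intro q
    obtain ⟨c, y, C, hq, hy⟩ := hcov q.1 (hVε _ q.2)
    exact exists_adaptedChart_sigmaZero q hq C hy
  have hZ : ∀ x ∈ torusZeros f V,
      (∃ χ ∈ coordinateSystems n K (Fin n → K), x ∈ χ.source ∧ ∃ S : Finset (Fin n),
        S.card = l ∧ IsCoordinateSubspace χ S (torusZeros f V)) ∧ l < n := by
    intro x hx
    -- Every toric chart contains the whole torus, so any maximal cone serves to lift x. The adapted
    -- chart found there may belong to another cone c with the same image point.
    obtain ⟨c₀, -⟩ := exists_maxCone F (le_refl 0)
    obtain ⟨y₀, rfl⟩ := exists_monomialMap_eq c₀ hx.2.1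
    obtain ⟨c, y, C, hq, hy⟩ := hcov (toricPoint F K c₀ y₀)
      (by rw [toricMap_toricPoint_eq]; exact hVε _ hx.1)
    have hσ : monomialMap K c₀ y₀ = monomialMap K c y := by
      rw [← toricMap_toricPoint_eq, hq, toricMap_toricPoint_eq]
    rw [hσ] at hx ⊢
    obtain ⟨C', hxC', hC'⟩ := exists_adaptedChart_of_mem_torus
      ((monomialMap_mem_torus_iff c y).1 hx.2.1) C hy
    exact C'.exists_isCoordinateSubspace_torusZeros hC' hxC' hx
  refine ⟨?_, ?_, fun _ => ?_⟩
  · rcases (torusZeros f V).eq_empty_or_nonempty with h | ⟨x, hx⟩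
    · exact Or.inl h
    · exact Or.inr ⟨fun x hx => (hZ x hx).1, (hZ x hx).2⟩
  · intro h
    -- Adapted charts cover all of the inverse image of V, so principality holds everywhere and not
    -- only near the fibre.
    refine ⟨univ, isOpen_univ, subset_univ _, fun q _ => ?_⟩
    obtain ⟨C, hC⟩ := hgood q
    rcases h with h | h
    · refine C.isPrincipalMonomialAt_of_notMem hC ?_
      rw [← strictZeros_eq_zeroClosure]
      unfold strictZeros
      simp [h]
    · exact C.isPrincipalMonomialAt_of_eq_one h hC
  · rw [strictZeros_eq_zeroClosure]
    exact ⟨isClosed_closure, AdaptedChart.isSubmanifold hgood,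
      AdaptedChart.hasNormalCrossings hgood, AdaptedChart.exists_isBlowUp hl hgood,
      fun X _ _ _ π hπ => ⟨univ, isOpen_univ, subset_univ _, fun x _ =>
        AdaptedChart.isPrincipalMonomialAt_of_isBlowUp hgood hπ x⟩⟩
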